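/- **Setting.** Let $A\in\mathbb C^{N\times N}$, $N=2^n$, be an invertible Hermitian matrix, $0\ne \boldsymbol b\in\mathbb C^N$, $A\boldsymbol x=\boldsymbol b$, $\kappa=\|A\|\|A^{-1}\|$ (spectral norms), $|v\rangle=\boldsymbol v/\|\boldsymbol v\|$, and $\xi=\|A^{-1}|b\rangle\|$. Put $\zeta(p)=p\,e^{-p^2/2}$. *Discretization.* For $R>0$ and $N_p=2^{n_p}$ ($n_p\ge1$) let $\Delta p=2\pi R/N_p$, $p_k=-\pi R+k\Delta p$, $\mu_l=(l-N_p/2)/R$ $(0\le k,l<N_p)$, $D_\mu=\mathrm{diag}(\mu_0,\dots,\mu_{N_p-1})$, $\boldsymbol\zeta=(\zeta(p_0),\dots,\zeta(p_{N_p-1}))$, $\tilde\zeta_l=\frac1{N_p}\sum_k\zeta(p_k)e^{-i\mu_l(p_k+\pi R)}$ and $\tilde{\boldsymbol w}_h(0)=\tilde{\boldsymbol\zeta}\otimes\boldsymbol b$. For $T>0$ and $N_t,Q\ge 1$ let $\tau=T/N_t$, and let $(\alpha_j,t_j)$, $0\le j<N_tQ$, be the weights and nodes of the composite Gauss quadrature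 rule on $[0,T]$ with $Q$ nodes in each of the $N_t$ intervals of length $\tau$; put $\alpha_j=t_j=0$ for $N_tQ\le j<2^{n_a}$, where $n_a=\lceil\log_2(N_tQ)\rceil$. Let $\|\boldsymbol\alpha\|_1=\sum_j|\alpha_j|$. *Oracles.* Unitaries $O_{\mathrm{coef}}:|0^{n_a}\rangle\mapsto\|\boldsymbol\alpha\|_1^{-1/2}\sum_j\sqrt{\alpha_j}\,|j\rangle$ and $O_w:|0^{n_p+n}\rangle\mapsto|\tilde w_h(0)\rangle$ (arbitrary on the other basis states), and $\mathrm{SEL}_A=\sum_{j<2^{n_a}}|j\rangle\langle j|\otimes e^{i(D_\mu\otimes A)t_j}$. A quantum query algorithm is a fixed finite sequence of oracle-independent unitaries and of applications of the oracles and their inverses, on $n_a+n_p+n$ qubits and any number of work qubits initialized to $|0\cdots0\rangle$, followed by a measurement of a success flag on the qubits other than the $n$ output qubits. **Theorem.** There are absolute constants $C,c>0$ and a choice, determined by $n,\|A\|,\kappa,\xi,\varepsilon$ only, of discretization parameters $R,n_p,T,N_t,Q$ and of a quantum query algorithm, such that the following holds for all $n$, $A$, $\boldsymbol b$ as above and all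 $0<\varepsilon<1$ with $\varepsilon\xi\le 1/e$. Put $\delta=\varepsilon\xi/\log^{1/4}(1/(\varepsilon\xi))$ (so that $0<\delta\le\varepsilon\xi$). 1. For all oracles $O_{\mathrm{coef}},\mathrm{SEL}_A,O_w$ as above, the flag indicates success with probability at least $c$, and in that case the $n$ output qubits are in a pure state $|y\rangle$ with $\||y\rangle-|x\rangle\|\le\varepsilon$. 2. The total number of queries to $O_{\mathrm{coef}}$, $\mathrm{SEL}_A$, $O_w$ and their inverses is at most $C\,\|\boldsymbol\alpha\|_1\|\boldsymbol\zeta\|/\xi$. 3. $\|\boldsymbol\alpha\|_1\le C\,T$ and $T=\Theta\Big(\frac{\kappa}{\|A\|}\sqrt{2\log\frac{2\kappa}{\|A\|\delta}}\Big)$, with absolute constants. 4. $\|\boldsymbol\zeta\|=\mathcal O(\log^{1/4}(1/\delta))$ in the following sense: if $L\ge1$ and $\log(1/\varepsilon)\le L\log(1/\delta)$, then $\|\boldsymbol\zeta\|\le C\,(L\log(1/\delta))^{1/4}$. (If $\xi\le1$, then $L=1$ is allowed; for fixed $A,\boldsymbol b$ and $\varepsilon\to0$, $L=2$ is allowed eventually.)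 5. $\tau=1/\|D_\mu\otimes A\|$ and $Q=\Theta(\log(T/\delta))$, with absolute constants. -/

import Mathlib

open scoped Matrix Kronecker BigOperators

namespace SchrQLS

noncomputable section

/-- The spectral (Euclidean operator) norm of a matrix. -/
def specNorm {ι : Type} [Fintype ι] [DecidableEq ι] (A : Matrix ι ι ℂ) : ℝ :=
  ‖Matrix.toEuclideanCLM (n := ι) (𝕜 := ℂ) A‖

/-- The spectral condition number. -/
def condNumber {ι : Type} [Fintype ι] [DecidableEq ι] (A : Matrix ι ι ℂ) : ℝ :=
  specNorm A * specNorm A⁻¹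

/-- The normalized vector `v / ‖v‖`, i.e. the quantum state `|v⟩`. -/
def ket {ι : Type} [Fintype ι] (v : EuclideanSpace ℂ ι) : EuclideanSpace ℂ ι :=
  ((‖v‖⁻¹ : ℝ) : ℂ) • v

/-- `ξ = ‖A⁻¹ |b⟩‖`. -/
def xiOf {ι : Type} [Fintype ι] [DecidableEq ι] (A : Matrix ι ι ℂ) (b : EuclideanSpace ℂ ι) : ℝ :=
  ‖Matrix.toEuclideanCLM (n := ι) (𝕜 := ℂ) A⁻¹ (ket b)‖

/-- The kernel function `ζ(p) = p exp(-p² / 2)`. -/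
def zeta (p : ℝ) : ℝ := p * Real.exp (-(p ^ 2) / 2)

/-- The `Q`-point Gauss(-Legendre) quadrature rule on `[0, 1]`: increasing nodes, with weights
that integrate every polynomial of degree at most `2 Q - 1` exactly. -/
structure GaussRule (Q : ℕ) where
  node : Fin Q → ℝ
  weight : Fin Q → ℝ
  strictMono_node : StrictMono node
  node_mem : ∀ q, node q ∈ Set.Icc (0 : ℝ) 1
  exact_of_natDegree_lt : ∀ f : Polynomial ℝ, f.natDegree < 2 * Q →
    ∑ q, weight q * f.eval (node q) = ∫ s in (0 : ℝ)..1, f.eval s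

/-- The parameters of the discretization: the auxiliary variable `p` ranges over `[-π R, π R]`
with `2 ^ np` grid points (`np ≥ 1`, so that `p = 0` is one of them), the time variable ranges over
`[0, T]`, cut into `Nt` intervals, each of them carrying a `Q`-point Gauss rule. -/
structure Discretization where
  R : ℝ
  R_pos : 0 < R
  np : ℕ
  np_pos : 0 < np
  T : ℝ
  T_pos : 0 < T
  Nt : ℕ
  Nt_pos : 0 < Nt
  Q : ℕ
  Q_pos : 0 < Q
  rule : GaussRule Q

namespace Discretization

variable (D : Discretization)

/-- The mesh size `Δp = 2 π R / N_p`. -/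
def dp : ℝ := 2 * Real.pi * D.R / 2 ^ D.np

/-- The grid points `p_k = -π R + k Δp`, `0 ≤ k < N_p`. -/
def grid (k : Fin (2 ^ D.np)) : ℝ := -(Real.pi * D.R) + (k : ℕ) * D.dp

/-- The frequencies `μ_l = 2 π (l - N_p / 2) / (b - a)`, `[a, b] = [-π R, π R]`. -/
def mu (l : Fin (2 ^ D.np)) : ℝ :=
  2 * Real.pi * (((l : ℕ) : ℝ) - 2 ^ D.np / 2) / (2 * Real.pi * D.R)

/-- `D_μ = diag(μ_0, …, μ_{N_p - 1})`. -/
def Dmu : Matrix (Fin (2 ^ D.np)) (Fin (2 ^ D.np)) ℂ :=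
  Matrix.diagonal fun l => ((D.mu l : ℝ) : ℂ)

/-- The vector `(ζ(p_0), …, ζ(p_{N_p - 1}))`, with its Euclidean norm. -/
def zetaVec : EuclideanSpace ℝ (Fin (2 ^ D.np)) :=
  WithLp.toLp 2 fun k => zeta (D.grid k)

/-- The coefficients `ζ̃_l = (1 / N_p) ∑_k ζ(p_k) exp(-i μ_l (p_k - a))`, `a = -π R`, of the
trigonometric interpolant `∑_l ζ̃_l exp(i μ_l (p - a))` of `ζ` at the grid points. -/
def zetaTilde (l : Fin (2 ^ D.np)) : ℂ :=
  (1 / 2 ^ D.np : ℂ) * ∑ k, ((zeta (D.grid k) : ℝ) : ℂ) *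
    Complex.exp (-(Complex.I * (D.mu l : ℝ) * ((D.grid k + Real.pi * D.R : ℝ) : ℂ)))

/-- The initial vector `w̃_h(0) = ζ̃ ⊗ b`. -/
def initVec {n : ℕ} (b : EuclideanSpace ℂ (Fin (2 ^ n))) :
    EuclideanSpace ℂ (Fin (2 ^ D.np) × Fin (2 ^ n)) :=
  WithLp.toLp 2 fun li => D.zetaTilde li.1 * b li.2

/-- The Hamiltonian `D_μ ⊗ A`. -/
def hamiltonian {n : ℕ} (A : Matrix (Fin (2 ^ n)) (Fin (2 ^ n)) ℂ) :
    Matrix (Fin (2 ^ D.np) × Fin (2 ^ n)) (Fin (2 ^ D.np) × Fin (2 ^ n)) ℂ :=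
  D.Dmu ⊗ₖ A

/-- The evolution `U(A, t) = exp(i (D_μ ⊗ A) t)`. -/
def evolution {n : ℕ} (A : Matrix (Fin (2 ^ n)) (Fin (2 ^ n)) ℂ) (t : ℝ) :
    Matrix (Fin (2 ^ D.np) × Fin (2 ^ n)) (Fin (2 ^ D.np) × Fin (2 ^ n)) ℂ :=
  NormedSpace.exp ((Complex.I * (t : ℂ)) • D.hamiltonian A)

/-- The time step `τ = T / N_t`. -/
def tau : ℝ := D.T / D.Nt

/-- The number of qubits that index the `N_t Q` quadrature nodes. -/
def na : ℕ := Nat.clog 2 (D.Nt * D.Q)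

/-- The weight `α_j` of the composite Gauss rule on `[0, T]`; the node with index `j = m Q + q`
is the `q`-th node in the `m`-th interval, and indices `j ≥ N_t Q` are padding with weight `0`. -/
def alpha (j : Fin (2 ^ D.na)) : ℝ :=
  if (j : ℕ) < D.Nt * D.Q then
    D.tau * D.rule.weight ⟨(j : ℕ) % D.Q, Nat.mod_lt _ D.Q_pos⟩
  else 0

/-- The node `t_j` of the composite Gauss rule on `[0, T]` (`0` at the padding indices). -/
def time (j : Fin (2 ^ D.na)) : ℝ :=
  if (j : ℕ) < D.Nt * D.Q then
    (((j : ℕ) / D.Q : ℕ) + D.rule.node ⟨(j : ℕ) % D.Q, Nat.mod_lt _ D.Q_pos⟩) * D.tau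
  else 0

/-- `‖α‖₁`. -/
def alphaNorm : ℝ := ∑ j, |D.alpha j|

/-- `SEL_A = ∑_j |j⟩⟨j| ⊗ U_j` with `U_j = exp(i (D_μ ⊗ A) t_j)`. -/
def selectMatrix {n : ℕ} (A : Matrix (Fin (2 ^ n)) (Fin (2 ^ n)) ℂ) :
    Matrix (Fin (2 ^ D.na) × (Fin (2 ^ D.np) × Fin (2 ^ n)))
      (Fin (2 ^ D.na) × (Fin (2 ^ D.np) × Fin (2 ^ n))) ℂ :=
  ∑ j, Matrix.single j j (1 : ℂ) ⊗ₖ D.evolution A (D.time j)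

end Discretization

/-- Three unitary oracles: `coef` acts on `na` qubits, `sel` on `na + np + n` qubits, and `prep`
on `np + n` qubits. -/
structure Oracles (na np n : ℕ) where
  coef : Matrix.unitaryGroup (Fin (2 ^ na)) ℂ
  sel : Matrix.unitaryGroup (Fin (2 ^ na) × (Fin (2 ^ np) × Fin (2 ^ n))) ℂ
  prep : Matrix.unitaryGroup (Fin (2 ^ np) × Fin (2 ^ n)) ℂ

/-- The oracles are a coefficient oracle `|0⟩ ↦ ‖α‖₁^(-1/2) ∑_j √α_j |j⟩`, the select oracle and a
state preparation oracle `|0⟩ ↦ |w̃_h(0)⟩` for the system with matrix `A` and right-hand side `b`.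
Nothing is assumed on how `coef` and `prep` act on the other basis states. -/
structure Oracles.Implement {n : ℕ} (D : Discretization) (O : Oracles D.na D.np n)
    (A : Matrix (Fin (2 ^ n)) (Fin (2 ^ n)) ℂ) (b : EuclideanSpace ℂ (Fin (2 ^ n))) : Prop where
  coef_apply : ∀ j, O.coef.1 j 0 = ((√(D.alpha j) / √D.alphaNorm : ℝ) : ℂ)
  sel_eq : O.sel.1 = D.selectMatrix A
  prep_apply : ∀ li, O.prep.1 li (0, 0) = ket (D.initVec b) li

/-- Computational basis of the register: `na` index qubits, `np + n` data qubits and `a` further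
work qubits. -/
abbrev Reg (na np n a : ℕ) : Type :=
  (Fin (2 ^ na) × (Fin (2 ^ np) × Fin (2 ^ n))) × Fin (2 ^ a)

/-- One step of a quantum query algorithm: a unitary that does not involve the oracles (free of
charge), or one application of an oracle (`inv = false`) or of its inverse (`inv = true`) to its
designated qubits. -/
inductive Gate (na np n a : ℕ) : Type
  | free (U : Matrix.unitaryGroup (Reg na np n a) ℂ)
  | coef (inv : Bool)
  | sel (inv : Bool)
  | prep (inv : Bool)

namespace Gate

variable {na np n a : ℕ}

/-- The number of oracle queries made by a gate. -/
def queries : Gate na np n a → ℕ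
  | free _ => 0
  | coef _ => 1
  | sel _ => 1
  | prep _ => 1

/-- `U` or its inverse. -/
def orInv {ι : Type} [Fintype ι] [DecidableEq ι] (U : Matrix.unitaryGroup ι ℂ) (inv : Bool) :
    Matrix ι ι ℂ :=
  if inv then (U.1)ᴴ else U.1

/-- The action of a gate on the register, for given oracles. -/
def toMatrix (O : Oracles na np n) :
    Gate na np n a → Matrix (Reg na np n a) (Reg na np n a) ℂ
  | free U => U.1
  | coef inv => (orInv O.coef inv ⊗ₖ (1 : Matrix (Fin (2 ^ np) × Fin (2 ^ n)) _ ℂ)) ⊗ₖ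
      (1 : Matrix (Fin (2 ^ a)) (Fin (2 ^ a)) ℂ)
  | sel inv => orInv O.sel inv ⊗ₖ (1 : Matrix (Fin (2 ^ a)) (Fin (2 ^ a)) ℂ)
  | prep inv => ((1 : Matrix (Fin (2 ^ na)) (Fin (2 ^ na)) ℂ) ⊗ₖ orInv O.prep inv) ⊗ₖ
      (1 : Matrix (Fin (2 ^ a)) (Fin (2 ^ a)) ℂ)

end Gate

/-- A quantum query algorithm with a flag: a sequence of gates, applied to `|0…0⟩` from the first
to the last, and then a measurement of whether the qubits other than the `n` output qubits are in
one of the basis states in `success`. The sequence is fixed before the oracles are given. -/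
structure Algorithm (na np n : ℕ) where
  a : ℕ
  circuit : List (Gate na np n a)
  success : Finset ((Fin (2 ^ na) × Fin (2 ^ np)) × Fin (2 ^ a))

namespace Algorithm

variable {na np n : ℕ} (alg : Algorithm na np n)

/-- The total number of queries (to all three oracles and their inverses). -/
def queries : ℕ := (alg.circuit.map Gate.queries).sum

/-- The state of the register before the measurement. -/
def finalState (O : Oracles na np n) : Reg na np n alg.a → ℂ :=
  alg.circuit.foldl (fun ψ g => g.toMatrix O *ᵥ ψ) (Pi.single ((0, (0, 0)), 0) 1)

/-- With probability at least `c` the flag indicates success, and then the `n` output qubits are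
in a pure state `y`, a unit vector with `‖y - x‖ ≤ ε`. (The part of the final state in the success
subspace is `γ ⊗ y`, so its squared norm, which is the success probability, is `∑ |γ_k|²`.) -/
def Prepares (O : Oracles na np n) (x : EuclideanSpace ℂ (Fin (2 ^ n))) (ε c : ℝ) : Prop :=
  ∃ (γ : (Fin (2 ^ na) × Fin (2 ^ np)) × Fin (2 ^ alg.a) → ℂ)
    (y : EuclideanSpace ℂ (Fin (2 ^ n))),
    ‖y‖ = 1 ∧ ‖y - x‖ ≤ ε ∧ c ≤ ∑ k ∈ alg.success, ‖γ k‖ ^ 2 ∧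
    ∀ k ∈ alg.success, ∀ i,
      alg.finalState O ((k.1.1, (k.1.2, i)), k.2) = γ k * y i

end Algorithm

/-- A discretization together with a query algorithm for the oracles that belong to it. -/
structure Plan (n : ℕ) where
  disc : Discretization
  alg : Algorithm disc.na disc.np n

/-- `δ = ε ξ / log^{1/4}(1 / (ε ξ))`. -/
def deltaOf (ε ξ : ℝ) : ℝ := ε * ξ / (Real.log (1 / (ε * ξ))) ^ (1 / 4 : ℝ)

/-- `(κ / ‖A‖) √(2 log (2 κ / (‖A‖ δ)))`, with `σ` for `‖A‖`. -/
def timeScale (σ κ δ : ℝ) : ℝ := κ / σ * √(2 * Real.log (2 * κ / (σ * δ)))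

end

end SchrQLS

/-!
The solution operator is a superposition of Hamiltonian evolutions. Since `ζ(p) = p exp(-p² / 2)` is
minus the derivative of `exp(-p² / 2)`, one has `∫₀^∞ ζ(λ t) dt = 1 / λ` for every real `λ ≠ 0`. If
`ζ` is replaced by its trigonometric interpolant `∑_l ζ̃_l exp(i μ_l (p + π R))` and the integral by a
quadrature rule on `[0, T]`, this becomes `A⁻¹ b ≈ ∑_j α_j ∑_l ζ̃_l exp(i μ_l π R) exp(i μ_l A t_j) b`.
The right-hand side is what a linear combination of the evolutions `exp(i (D_μ ⊗ A) t_j)`, applied to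
`ζ̃ ⊗ b`, shows at the grid point `p = 0` after the inverse Fourier transform in the `p` register.

*Scalar error.* Everything is diagonal in an eigenbasis of `A`, so it suffices to compare the scalar
function `response λ` with `1 / λ` on the spectrum (`norm_response_sub_inv_le`). Four errors arise.
Truncating at `T` costs `exp(-(λ T)² / 2) / |λ|`. Sampling `ζ` with mesh size `1 / K` costs
`O(exp(-K²)) / |λ|`: by Poisson summation (`exists_hasSum_aliasKernel`, the functional equation of the
theta kernels) the Fourier series of the samples is a periodized Gaussian, and the aliases of a
frequency `θ` nearly cancel in pairs, with a factor `|θ|` that compensates the growth `1 / |θ λ|` of the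
time integral (`interpolation_error`). That these two errors are relative to `1 / |λ|` is what keeps
`K² ~ log (1 / ε)` free of `κ` and gives `‖ζ‖ ~ √K`. Replacing the infinite grid by a finite one costs an
arbitrarily small amount, because nothing restricts the number of qubits (`exists_np_close`). The Gauss
rule, exact up to degree `2 Q - 1`, costs `O(T / (2 Q)!)` as soon as the time step resolves the largest
frequency (`composite_error`).

*Algorithm.* The linear combination has a good component of norm about `ξ / (‖α‖₁ ‖ζ‖)`, where
`‖α‖₁ = T` (`lcuCircuit_good`). This value is known up to a factor close to `1`, so a number of rounds of
amplitude amplification proportional to its inverse, fixed in advance, brings the success probability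
above a constant (`amplifiedCircuit_good`, `sin_amplified_ge`). Amplification rescales the good component
without changing its direction, so the output error is the relative error of the approximation of
`A⁻¹ |b⟩` (`solver_prepares`).

*Parameters.* `T` is a multiple of `1 / ‖D_μ ⊗ A‖` near `2 timeScale`, and `Q` is proportional to
`log (T / δ)`, which makes `(2 Q)!` exceed a fixed power of `T / δ` (`exists_good_discretization`).
-/

namespace SchrQLS

noncomputable section

/-! ### Gauss quadrature -/

open Polynomial in
/-- The inner product `∫₀¹ f g` on real polynomials. -/
@[reducible] def polynomialInnerCore : InnerProductSpace.Core ℝ ℝ[X] where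
  inner f g := ∫ s in (0 : ℝ)..1, f.eval s * g.eval s
  conj_inner_symm f g := by simp [mul_comm]
  re_inner_nonneg f :=
    intervalIntegral.integral_nonneg zero_le_one fun s _ => mul_self_nonneg _
  add_left f g h := by
    simp only [eval_add, add_mul]
    exact intervalIntegral.integral_add
      ((f.continuous.mul h.continuous).intervalIntegrable _ _)
      ((g.continuous.mul h.continuous).intervalIntegrable _ _)
  smul_left f g r := by
    simp [mul_assoc]
  definite f hf := by
    have h0 : ∀ s ∈ Set.Icc (0 : ℝ) 1, f.eval s = 0 := by
      by_contra! hne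
      obtain ⟨s, hs, hs0⟩ := hne
      refine absurd hf (ne_of_gt ?_)
      exact intervalIntegral.integral_pos zero_lt_one (f.continuous.mul f.continuous).continuousOn
        (fun x _ => mul_self_nonneg _) ⟨s, hs, mul_self_pos.2 hs0⟩
    exact Polynomial.eq_zero_of_infinite_isRoot f
      ((Set.Icc_infinite zero_lt_one).mono fun s hs => h0 s hs)

open Polynomial in
/-- Nodes and weights come from the compression `J` of multiplication by `x` to the polynomials of
degree `< Q`: the eigenvalues of `J` and the squared components of `1` in an eigenbasis. -/
theorem exists_eigen_quadrature (Q : ℕ) :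
    ∃ (lam c : Fin Q → ℝ), Antitone lam ∧ (∀ i, lam i ∈ Set.Icc (0 : ℝ) 1) ∧
      ∀ f : ℝ[X], f.natDegree < 2 * Q →
        ∑ i, c i * f.eval (lam i) = ∫ s in (0 : ℝ)..1, f.eval s := by
  let _ := polynomialInnerCore
  let _ : NormedAddCommGroup ℝ[X] := InnerProductSpace.Core.toNormedAddCommGroup (𝕜 := ℝ)
  let _ : InnerProductSpace ℝ ℝ[X] := InnerProductSpace.ofCore polynomialInnerCore.toCore
  have inner_def : ∀ f g : ℝ[X], inner ℝ f g = ∫ s in (0 : ℝ)..1, f.eval s * g.eval s :=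
    fun _ _ => rfl
  let E : Submodule ℝ ℝ[X] := degreeLT ℝ Q
  have : FiniteDimensional ℝ E := inferInstance
  have hdim : Module.finrank ℝ E = Q := by
    rw [(degreeLTEquiv ℝ Q).finrank_eq]; simp
  let J : E →ₗ[ℝ] E := E.orthogonalProjectionOnto.toLinearMap ∘ₗ (LinearMap.mulLeft ℝ X) ∘ₗ E.subtype
  have hJ : ∀ f g : E, inner ℝ (J f) g = ∫ s in (0 : ℝ)..1, s * (f.1.eval s * g.1.eval s) := by
    intro f g
    have h1 : inner ℝ (J f) g = inner ℝ (X * f.1) g.1 := by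
      simp [J]
    rw [h1, inner_def]
    simp [mul_assoc]
  have hsym : J.IsSymmetric := by
    intro f g
    rw [hJ, real_inner_comm, hJ]
    simp [mul_comm]
  let e := hsym.eigenvectorBasis hdim
  let lam := hsym.eigenvalues hdim
  have hJe : ∀ i, J (e i) = lam i • e i := fun i => hsym.apply_eigenvectorBasis hdim i
  have hsmul : ∀ (r : ℝ) (f g : E), inner ℝ (r • f) g = r * inner ℝ f g := fun r f g => by
    rw [Submodule.coe_inner, Submodule.coe_inner, inner_def, inner_def,
      ← intervalIntegral.integral_const_mul]
    simp [mul_assoc]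
  have hmem : ∀ a, a < Q → (X ^ a : ℝ[X]) ∈ E := fun a ha => by
    rw [mem_degreeLT]
    exact (degree_X_pow_le a).trans_lt (by exact_mod_cast ha)
  let m : ∀ a, a < Q → E := fun a ha => ⟨X ^ a, hmem a ha⟩
  -- `⟨x ^ a, e i⟩ = lam i ^ a * ⟨1, e i⟩` as long as the degree stays below `Q`
  have hpow : ∀ (h0 : 0 < Q) (a : ℕ) (ha : a < Q) (i : Fin Q),
      inner ℝ (m a ha) (e i) = lam i ^ a * inner ℝ (m 0 h0) (e i) := by
    intro h0 a
    induction a with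
    | zero => intro ha i; simp
    | succ a ih =>
      intro ha i
      have ha' : a < Q := by omega
      have h1 : inner ℝ (m (a + 1) ha) (e i) = inner ℝ (J (e i)) (m a ha') := by
        rw [hJ, Submodule.coe_inner, inner_def]
        simp only [m, eval_pow, eval_X]
        congr 1; ext s; ring
      rw [h1, hJe, hsmul, real_inner_comm, ih ha']
      ring
  refine ⟨lam, fun i => if h0 : 0 < Q then (inner ℝ (m 0 h0) (e i)) ^ 2 else 0,
    hsym.eigenvalues_antitone hdim, fun i => ?_, fun f hf => ?_⟩
  · have h1 : inner ℝ (J (e i)) (e i) = lam i := by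
      rw [hJe, hsmul]
      simp [e.norm_eq_one]
    have h2 : (1 : ℝ) = ∫ s in (0 : ℝ)..1, ((e i).1.eval s * (e i).1.eval s) := by
      rw [← inner_def, ← Submodule.coe_inner, real_inner_self_eq_norm_sq, e.norm_eq_one]; simp
    have hc : Continuous fun s : ℝ => (e i).1.eval s := (e i).1.continuous
    rw [← h1, hJ]
    constructor
    · exact intervalIntegral.integral_nonneg zero_le_one fun s hs =>
        mul_nonneg hs.1 (mul_self_nonneg _)
    · refine le_of_le_of_eq ?_ h2.symm
      refine intervalIntegral.integral_mono_on zero_le_one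
        ((continuous_id.mul (hc.mul hc)).intervalIntegrable _ _)
        ((hc.mul hc).intervalIntegrable _ _) fun s hs => ?_
      exact mul_le_of_le_one_left (mul_self_nonneg _) hs.2
  · rcases Nat.eq_zero_or_pos Q with h0 | h0
    · omega
    simp only [h0, dite_true]
    -- a monomial of degree `< 2 Q` is `x ^ a * x ^ b` or `x * x ^ a * x ^ b` with `a, b < Q`
    have hmono : ∀ k, k < 2 * Q → ∑ i, (inner ℝ (m 0 h0) (e i)) ^ 2 * lam i ^ k
        = ∫ s in (0 : ℝ)..1, s ^ k := by
      intro k hk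
      obtain ⟨a, ha, r, hr, rfl⟩ : ∃ a, a < Q ∧ ∃ r, r < 2 ∧ k = a + a + r :=
        ⟨k / 2, by omega, k % 2, by omega, by omega⟩
      interval_cases r
      · have h1 : inner ℝ (m a ha) (m a ha) = ∫ s in (0 : ℝ)..1, s ^ (a + a + 0) := by
          rw [Submodule.coe_inner, inner_def]
          simp [m, pow_add]
        rw [← h1, ← e.sum_inner_mul_inner (m a ha) (m a ha)]
        refine Finset.sum_congr rfl fun i _ => ?_
        rw [real_inner_comm (m a ha) (e i), hpow h0 a ha]; ring
      · have h1 : inner ℝ (J (m a ha)) (m a ha) = ∫ s in (0 : ℝ)..1, s ^ (a + a + 1) := by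
          rw [hJ]
          simp only [m, eval_pow, eval_X]
          congr 1; ext s; ring
        rw [← h1, ← e.sum_inner_mul_inner]
        refine Finset.sum_congr rfl fun i _ => ?_
        rw [hsym (m a ha) (e i), hJe, real_inner_comm (lam i • e i), hsmul,
          real_inner_comm (m a ha) (e i), hpow h0 a ha]
        ring
    conv_rhs => simp only [eval_eq_sum_range]
    rw [intervalIntegral.integral_finsetSum
      fun k _ => (by fun_prop : Continuous _).intervalIntegrable _ _]
    simp only [eval_eq_sum_range, Finset.mul_sum]
    rw [Finset.sum_comm]
    refine Finset.sum_congr rfl fun k hk => ?_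
    rw [intervalIntegral.integral_const_mul, ← hmono k (by simp at hk; omega), Finset.mul_sum]
    exact Finset.sum_congr rfl fun i _ => by ring

open Polynomial in
/-- The squared product over fewer than `Q` nodes would have degree `< 2 Q`, positive integral and
vanish at all nodes; so the eigenvalues in `exists_eigen_quadrature` are distinct. -/
theorem nonempty_gaussRule (Q : ℕ) : Nonempty (GaussRule Q) := by
  obtain ⟨lam, c, hanti, hmem, hex⟩ := exists_eigen_quadrature Q
  have hinj : Function.Injective lam := by
    by_contra hni
    have hcard : (Finset.univ.image lam).card < Q := by
      refine lt_of_le_of_ne (Finset.card_image_le.trans (by simp)) fun h => hni ?_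
      have := Finset.card_image_iff (s := Finset.univ) (f := lam) |>.1 (by simpa using h)
      simpa using this
    set f : ℝ[X] := ∏ r ∈ Finset.univ.image lam, (X - C r) with hf
    have hfm : f.Monic := monic_prod_of_monic _ _ fun r _ => monic_X_sub_C r
    have hdeg : (f * f).natDegree < 2 * Q := by
      rw [hfm.natDegree_mul hfm, hf, natDegree_prod_of_monic _ _ fun r _ => monic_X_sub_C r]
      simp only [natDegree_X_sub_C, Finset.sum_const, smul_eq_mul, mul_one]
      omega
    have h0 := hex (f * f) hdeg
    have h1 : ∑ i, c i * (f * f).eval (lam i) = 0 := by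
      refine Finset.sum_eq_zero fun i _ => ?_
      have : f.eval (lam i) = 0 := by
        rw [hf, eval_prod]
        exact Finset.prod_eq_zero (Finset.mem_image_of_mem _ (Finset.mem_univ i)) (by simp)
      simp [this]
    have h2 : f = 0 := by
      refine polynomialInnerCore.definite f ?_
      rw [h1] at h0
      simp only [eval_mul] at h0
      exact h0.symm
    exact hfm.ne_zero h2
  exact ⟨{  node := fun q => lam (Fin.rev q)
            weight := fun q => c (Fin.rev q)
            strictMono_node := fun p q hpq =>
              lt_of_le_of_ne (hanti (by simpa using hpq.le))
                fun h => hpq.ne (Fin.rev_injective (hinj h))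
            node_mem := fun q => hmem _
            exact_of_natDegree_lt := fun f hf => by
              rw [← hex f hf]
              exact Equiv.sum_comp Fin.revPerm fun i => c i * f.eval (lam i) }⟩

namespace GaussRule

variable {Q : ℕ} (G : GaussRule Q)

open Polynomial in
/-- Testing the exactness on the square of the product over the other nodes isolates the weight. -/
theorem weight_nonneg (q : Fin Q) : 0 ≤ G.weight q := by
  set f : ℝ[X] := ∏ r ∈ Finset.univ.erase q, (X - C (G.node r)) with hf
  have hfm : f.Monic := monic_prod_of_monic _ _ fun r _ => monic_X_sub_C _
  have hdeg : (f * f).natDegree < 2 * Q := by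
    rw [hfm.natDegree_mul hfm, hf, natDegree_prod_of_monic _ _ fun r _ => monic_X_sub_C _]
    simp only [natDegree_X_sub_C, Finset.sum_const, smul_eq_mul, mul_one,
      Finset.card_erase_of_mem (Finset.mem_univ q), Finset.card_univ, Fintype.card_fin]
    have := q.pos
    omega
  have h0 := G.exact_of_natDegree_lt (f * f) hdeg
  rw [Finset.sum_eq_single q] at h0
  · have h1 : 0 ≤ ∫ s in (0 : ℝ)..1, (f * f).eval s := by
      refine intervalIntegral.integral_nonneg zero_le_one fun s _ => ?_
      rw [eval_mul]; exact mul_self_nonneg _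
    have h2 : 0 < (f * f).eval (G.node q) := by
      rw [eval_mul]
      refine mul_self_pos.2 ?_
      rw [hf, eval_prod]
      refine Finset.prod_ne_zero_iff.2 fun r hr => ?_
      simp only [eval_sub, eval_X, eval_C]
      exact sub_ne_zero.2 fun h => (Finset.ne_of_mem_erase hr) (G.strictMono_node.injective h).symm
    rw [← h0] at h1
    exact nonneg_of_mul_nonneg_left h1 h2
  · intro r _ hr
    have : f.eval (G.node r) = 0 := by
      rw [hf, eval_prod]
      exact Finset.prod_eq_zero (Finset.mem_erase.2 ⟨hr, Finset.mem_univ r⟩) (by simp)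
    simp [this]
  · simp

theorem sum_weight (hQ : 0 < Q) : ∑ q, G.weight q = 1 := by
  have := G.exact_of_natDegree_lt 1 (by simpa using hQ)
  simpa using this

/-- The Taylor polynomial of degree `2 Q - 1` is integrated exactly, so only the Taylor remainder
contributes, once in the sum and once in the integral. -/
theorem exp_quadrature_error (hQ : 0 < Q) (θ : ℝ) (hθ : |θ| ≤ 1) :
    ‖∑ q, (G.weight q : ℂ) * Complex.exp (Complex.I * θ * G.node q)
      - ∫ s in (0 : ℝ)..1, Complex.exp (Complex.I * θ * s)‖ ≤ 4 / (2 * Q).factorial := by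
  set p : ℂ → ℂ := fun z => ∑ m ∈ Finset.range (2 * Q), z ^ m / m.factorial with hp
  have hrem : ∀ s ∈ Set.Icc (0 : ℝ) 1,
      ‖Complex.exp (Complex.I * θ * s) - p (Complex.I * θ * s)‖ ≤ 2 / (2 * Q).factorial := by
    intro s hs
    have hn : ‖Complex.I * θ * s‖ ≤ 1 := by
      simp only [norm_mul, Complex.norm_I, one_mul, Complex.norm_real, Real.norm_eq_abs]
      rw [abs_of_nonneg hs.1]
      exact mul_le_one₀ hθ hs.1 hs.2
    refine (Complex.exp_bound hn (by omega : 0 < 2 * Q)).trans ?_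
    have h1 : ‖Complex.I * θ * s‖ ^ (2 * Q) ≤ 1 := pow_le_one₀ (norm_nonneg _) hn
    have hf : (0 : ℝ) < (2 * Q).factorial := by exact_mod_cast Nat.factorial_pos _
    have hQ' : (1 : ℝ) ≤ (2 * Q : ℕ) := by exact_mod_cast (by omega : 1 ≤ 2 * Q)
    calc _ ≤ 1 * (((2 * Q).succ : ℝ) * (((2 * Q).factorial : ℝ) * (2 * Q : ℕ))⁻¹) := by
          refine mul_le_mul_of_nonneg_right h1 (by positivity)
      _ ≤ 2 / (2 * Q).factorial := by
          rw [one_mul, ← div_eq_mul_inv, div_le_div_iff₀ (by positivity) hf]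
          push_cast [Nat.succ_eq_add_one] at hQ' ⊢
          nlinarith
  have hcont : Continuous p := by
    rw [hp]
    exact continuous_finsetSum _ fun m _ => (continuous_id.pow m).div_const _
  have hexact : ∑ q, (G.weight q : ℂ) * p (Complex.I * θ * G.node q)
      = ∫ s in (0 : ℝ)..1, p (Complex.I * θ * s) := by
    simp only [hp, mul_pow, Finset.mul_sum]
    rw [Finset.sum_comm, intervalIntegral.integral_finsetSum
      fun k _ => (by fun_prop : Continuous _).intervalIntegrable _ _]
    refine Finset.sum_congr rfl fun m hm => ?_
    have h1 := G.exact_of_natDegree_lt (Polynomial.X ^ m) (by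
      rw [Polynomial.natDegree_X_pow]; exact Finset.mem_range.1 hm)
    simp only [Polynomial.eval_pow, Polynomial.eval_X] at h1
    have h2 : (∫ s in (0 : ℝ)..1, Complex.I ^ m * (θ : ℂ) ^ m * (s : ℂ) ^ m / m.factorial)
        = Complex.I ^ m * (θ : ℂ) ^ m / m.factorial * ∫ s in (0 : ℝ)..1, ((s ^ m : ℝ) : ℂ) := by
      rw [← intervalIntegral.integral_const_mul]
      congr 1; ext s; push_cast; ring
    rw [h2, intervalIntegral.integral_ofReal, ← h1]
    push_cast
    rw [Finset.mul_sum]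
    exact Finset.sum_congr rfl fun q _ => by ring
  have hsplit : ∑ q, (G.weight q : ℂ) * Complex.exp (Complex.I * θ * G.node q)
      - ∫ s in (0 : ℝ)..1, Complex.exp (Complex.I * θ * s)
      = ∑ q, (G.weight q : ℂ) *
          (Complex.exp (Complex.I * θ * G.node q) - p (Complex.I * θ * G.node q))
        - ∫ s in (0 : ℝ)..1, (Complex.exp (Complex.I * θ * s) - p (Complex.I * θ * s)) := by
    rw [intervalIntegral.integral_sub
      (Continuous.intervalIntegrable (by fun_prop) _ _)
      (Continuous.intervalIntegrable (by fun_prop) _ _), ← hexact]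
    simp only [mul_sub, Finset.sum_sub_distrib]
    ring
  rw [hsplit]
  have hA : ‖∑ q, (G.weight q : ℂ) *
      (Complex.exp (Complex.I * θ * G.node q) - p (Complex.I * θ * G.node q))‖
      ≤ 2 / (2 * Q).factorial := by
    refine (norm_sum_le _ _).trans ?_
    calc _ ≤ ∑ q, G.weight q * (2 / (2 * Q).factorial) := by
          refine Finset.sum_le_sum fun q _ => ?_
          rw [norm_mul, Complex.norm_real, Real.norm_of_nonneg (G.weight_nonneg q)]
          exact mul_le_mul_of_nonneg_left (hrem _ (G.node_mem q)) (G.weight_nonneg q)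
      _ = _ := by rw [← Finset.sum_mul, G.sum_weight hQ, one_mul]
  have hB : ‖∫ s in (0 : ℝ)..1, (Complex.exp (Complex.I * θ * s) - p (Complex.I * θ * s))‖
      ≤ 2 / (2 * Q).factorial := by
    have := intervalIntegral.norm_integral_le_of_norm_le_const (a := (0 : ℝ)) (b := 1)
      (f := fun s : ℝ => Complex.exp (Complex.I * θ * s) - p (Complex.I * θ * s))
      (C := 2 / (2 * Q).factorial) fun s hs => hrem s (by
        rw [Set.uIoc_of_le zero_le_one] at hs; exact ⟨hs.1.le, hs.2⟩)
    simpa using this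
  calc _ ≤ _ := norm_sub_le _ _
    _ ≤ 2 / (2 * Q).factorial + 2 / (2 * Q).factorial := add_le_add hA hB
    _ = _ := by ring

end GaussRule

/-! ### The composite rule in time and the discrete Fourier transform in `p` -/

namespace Discretization

variable (D : Discretization)

theorem tau_pos : 0 < D.tau := div_pos D.T_pos (by exact_mod_cast D.Nt_pos)

theorem Nt_mul_tau : (D.Nt : ℝ) * D.tau = D.T := by
  have : (D.Nt : ℝ) ≠ 0 := by exact_mod_cast D.Nt_pos.ne'
  unfold tau; field_simp

/-- Sums over the padded index set are double sums over the time intervals and the nodes. -/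
theorem sum_padded {M : Type*} [AddCommMonoid M] (g : ℕ → Fin D.Q → M) :
    ∑ j : Fin (2 ^ D.na), (if (j : ℕ) < D.Nt * D.Q then
      g ((j : ℕ) / D.Q) ⟨(j : ℕ) % D.Q, Nat.mod_lt _ D.Q_pos⟩ else 0)
      = ∑ m : Fin D.Nt, ∑ q, g m q := by
  rw [Fin.sum_univ_eq_sum_range (fun j => if j < D.Nt * D.Q then
      g (j / D.Q) ⟨j % D.Q, Nat.mod_lt _ D.Q_pos⟩ else 0), ← Finset.sum_filter]
  have h1 : (Finset.range (2 ^ D.na)).filter (· < D.Nt * D.Q) = Finset.range (D.Nt * D.Q) := by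
    ext j
    have : D.Nt * D.Q ≤ 2 ^ D.na := Nat.le_pow_clog (by norm_num) _
    simp only [Finset.mem_filter, Finset.mem_range]
    omega
  rw [h1, ← Fin.sum_univ_eq_sum_range (fun j => g (j / D.Q) ⟨j % D.Q, Nat.mod_lt _ D.Q_pos⟩),
    ← Fintype.sum_prod_type', ← finProdFinEquiv.sum_comp]
  refine Finset.sum_congr rfl fun x _ => ?_
  have h2 : ((finProdFinEquiv x : Fin _) : ℕ) = x.2 + D.Q * x.1 := rfl
  congr 1
  · rw [h2, Nat.add_mul_div_left _ _ D.Q_pos, Nat.div_eq_of_lt x.2.2, zero_add]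
  · ext
    simp only [h2, Nat.add_mul_mod_self_left]
    exact Nat.mod_eq_of_lt x.2.2

theorem alpha_nonneg (j : Fin (2 ^ D.na)) : 0 ≤ D.alpha j := by
  unfold alpha
  split_ifs
  · exact mul_nonneg D.tau_pos.le (D.rule.weight_nonneg _)
  · exact le_rfl

theorem alphaNorm_eq : D.alphaNorm = D.T := by
  have h1 : D.alphaNorm = ∑ j, D.alpha j :=
    Finset.sum_congr rfl fun j _ => abs_of_nonneg (D.alpha_nonneg j)
  rw [h1]
  unfold alpha
  rw [D.sum_padded fun _ q => D.tau * D.rule.weight q]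
  simp only [← Finset.mul_sum, D.rule.sum_weight D.Q_pos]
  simp [← Nt_mul_tau, mul_comm]

theorem sum_alpha_mul (φ : ℝ → ℂ) :
    ∑ j, (D.alpha j : ℂ) * φ (D.time j)
      = ∑ m : Fin D.Nt, ∑ q,
        ((D.tau * D.rule.weight q : ℝ) : ℂ) * φ (((m : ℕ) + D.rule.node q) * D.tau) := by
  rw [← D.sum_padded fun m q =>
    ((D.tau * D.rule.weight q : ℝ) : ℂ) * φ ((m + D.rule.node q) * D.tau)]
  refine Finset.sum_congr rfl fun j _ => ?_
  unfold alpha time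
  split_ifs <;> simp

/-- Error of the composite rule for oscillations that are resolved by the time step. -/
theorem composite_error (ω : ℝ) (hω : |ω| * D.tau ≤ 1) :
    ‖∑ j, (D.alpha j : ℂ) * Complex.exp (Complex.I * ω * D.time j)
      - ∫ t in (0 : ℝ)..D.T, Complex.exp (Complex.I * ω * t)‖
      ≤ 4 * D.T / (2 * D.Q).factorial := by
  set f : ℝ → ℂ := fun t => Complex.exp (Complex.I * ω * t) with hf
  have hfc : Continuous f := by fun_prop
  have hint : ∫ t in (0 : ℝ)..D.T, f t = ∑ m : Fin D.Nt,
      ∫ t in ((m : ℕ) : ℝ) * D.tau..((m + 1 : ℕ) : ℝ) * D.tau, f t := by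
    rw [Fin.sum_univ_eq_sum_range
      (fun m => ∫ t in (m : ℝ) * D.tau..((m + 1 : ℕ) : ℝ) * D.tau, f t),
      intervalIntegral.sum_integral_adjacent_intervals (a := fun m : ℕ => (m : ℝ) * D.tau)
        fun k _ => hfc.intervalIntegrable _ _]
    simp [Nt_mul_tau]
  have hpiece : ∀ m : ℕ, ∫ t in (m : ℝ) * D.tau..((m + 1 : ℕ) : ℝ) * D.tau, f t
      = D.tau * Complex.exp (Complex.I * ω * (m * D.tau)) *
        ∫ s in (0 : ℝ)..1, Complex.exp (Complex.I * ((ω * D.tau : ℝ) : ℂ) * s) := by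
    intro m
    have := intervalIntegral.smul_integral_comp_mul_add (a := 0) (b := 1) f D.tau (m * D.tau)
    have h2 : D.tau * 0 + m * D.tau = m * D.tau := by ring
    have h3 : D.tau * 1 + m * D.tau = ((m + 1 : ℕ) : ℝ) * D.tau := by push_cast; ring
    rw [h2, h3] at this
    rw [← this, Complex.real_smul, ← intervalIntegral.integral_const_mul,
      ← intervalIntegral.integral_const_mul]
    refine intervalIntegral.integral_congr fun s _ => ?_
    simp only [hf]
    rw [mul_assoc (D.tau : ℂ), ← Complex.exp_add]
    congr 1
    congr 1; push_cast; ring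
  rw [D.sum_alpha_mul f, hint, ← Finset.sum_sub_distrib]
  calc _ ≤ ∑ m : Fin D.Nt, D.tau * (4 / (2 * D.Q).factorial) := by
        refine (norm_sum_le _ _).trans (Finset.sum_le_sum fun m _ => ?_)
        rw [hpiece]
        have h4 : ∑ q, ((D.tau * D.rule.weight q : ℝ) : ℂ) *
            f (((m : ℕ) + D.rule.node q) * D.tau)
            = D.tau * Complex.exp (Complex.I * ω * ((m : ℕ) * D.tau)) *
              ∑ q, (D.rule.weight q : ℂ) *
                Complex.exp (Complex.I * ((ω * D.tau : ℝ) : ℂ) * D.rule.node q) := by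
          rw [Finset.mul_sum]
          refine Finset.sum_congr rfl fun q _ => ?_
          have h5 : f (((m : ℕ) + D.rule.node q) * D.tau)
              = Complex.exp (Complex.I * ω * ((m : ℕ) * D.tau)) *
                Complex.exp (Complex.I * ((ω * D.tau : ℝ) : ℂ) * D.rule.node q) := by
            simp only [hf]
            rw [← Complex.exp_add]
            congr 1; push_cast; ring
          rw [h5]; push_cast; ring
        rw [h4, ← mul_sub, norm_mul, norm_mul, Complex.norm_real, Real.norm_of_nonneg D.tau_pos.le]
        have h6 : ‖Complex.exp (Complex.I * ω * ((m : ℕ) * D.tau))‖ = 1 := by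
          rw [show Complex.I * ω * ((m : ℕ) * D.tau) = ((ω * ((m : ℕ) * D.tau) : ℝ) : ℂ) *
            Complex.I by push_cast; ring]
          exact Complex.norm_exp_ofReal_mul_I _
        rw [h6, mul_one]
        refine mul_le_mul_of_nonneg_left (D.rule.exp_quadrature_error D.Q_pos _ ?_) D.tau_pos.le
        rwa [abs_mul, abs_of_pos D.tau_pos]
    _ = 4 * D.T / (2 * D.Q).factorial := by
        rw [Finset.sum_const, Finset.card_univ, Fintype.card_fin, nsmul_eq_mul, ← D.Nt_mul_tau]
        ring

/-- The index of the grid point `p = 0`. -/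
def mid : Fin (2 ^ D.np) :=
  ⟨2 ^ (D.np - 1), Nat.pow_lt_pow_right (by norm_num) (Nat.sub_lt D.np_pos one_pos)⟩

theorem two_mul_mid : 2 * ((D.mid : ℕ) : ℝ) = 2 ^ D.np := by
  have : 2 * 2 ^ (D.np - 1) = 2 ^ D.np := by
    rw [← pow_succ', Nat.sub_add_cancel D.np_pos]
  simp only [mid]
  exact_mod_cast this

theorem grid_add (k : Fin (2 ^ D.np)) : D.grid k + Real.pi * D.R = (k : ℕ) * D.dp := by
  unfold grid; ring

theorem mid_mul_dp : ((D.mid : ℕ) : ℝ) * D.dp = Real.pi * D.R := by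
  have h := D.two_mul_mid
  unfold dp
  rw [← h]
  have : ((D.mid : ℕ) : ℝ) ≠ 0 := by
    have : (0 : ℝ) < 2 ^ D.np := by positivity
    rw [← h] at this
    intro h0; rw [h0] at this; simp at this
  field_simp

theorem grid_eq (k : Fin (2 ^ D.np)) : D.grid k = (((k : ℕ) : ℝ) - (D.mid : ℕ)) * D.dp := by
  rw [sub_mul, mid_mul_dp]; unfold grid; ring

theorem mu_eq (l : Fin (2 ^ D.np)) : D.mu l = (((l : ℕ) : ℝ) - (D.mid : ℕ)) / D.R := by
  have := D.two_mul_mid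
  have hR := D.R_pos.ne'
  unfold mu
  rw [← this]
  have hpi := Real.pi_ne_zero
  field_simp

theorem mu_mul_dp (l : Fin (2 ^ D.np)) :
    D.mu l * D.dp = 2 * Real.pi * (((l : ℕ) : ℝ) - (D.mid : ℕ)) / 2 ^ D.np := by
  rw [mu_eq]; unfold dp
  have hR := D.R_pos.ne'
  field_simp

/-- The unitary matrix of the trigonometric interpolation: it maps the coefficients `√N_p ζ̃` to
the grid values of `∑_l ζ̃_l exp(i μ_l (p + π R))`. -/
def fourier : Matrix (Fin (2 ^ D.np)) (Fin (2 ^ D.np)) ℂ :=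
  Matrix.of fun k l => ((√(2 ^ D.np))⁻¹ : ℝ) *
    Complex.exp (Complex.I * (D.mu l : ℝ) * ((D.grid k + Real.pi * D.R : ℝ) : ℂ))

theorem fourier_star_mul : D.fourierᴴ * D.fourier = 1 := by
  ext l l'
  have hN : (0 : ℝ) < 2 ^ D.np := by positivity
  have hNc : (2 ^ D.np : ℂ) ≠ 0 := pow_ne_zero _ two_ne_zero
  set z : ℂ := Complex.exp (2 * Real.pi * Complex.I *
    ((((l' : ℕ) : ℤ) - ((l : ℕ) : ℤ) : ℤ) / 2 ^ D.np)) with hz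
  have hterm : ∀ k : Fin (2 ^ D.np), star (D.fourier k l) * D.fourier k l'
      = (2 ^ D.np : ℂ)⁻¹ * z ^ (k : ℕ) := by
    intro k
    simp only [fourier, Matrix.of_apply, Complex.star_def, map_mul, Complex.conj_ofReal,
      ← Complex.exp_conj, Complex.conj_I]
    rw [mul_mul_mul_comm, ← Complex.exp_add, hz, ← Complex.exp_nat_mul, ← Complex.ofReal_mul,
      ← mul_inv, Real.mul_self_sqrt hN.le]
    have h1 : D.mu l' * D.dp - D.mu l * D.dp
        = 2 * Real.pi * (((l' : ℕ) : ℝ) - (l : ℕ)) / 2 ^ D.np := by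
      rw [mu_mul_dp, mu_mul_dp]; ring
    have h2 : -Complex.I * (D.mu l : ℂ) * ((D.grid k + Real.pi * D.R : ℝ) : ℂ)
        + Complex.I * (D.mu l' : ℂ) * ((D.grid k + Real.pi * D.R : ℝ) : ℂ)
        = (k : ℕ) * (2 * Real.pi * Complex.I *
          ((((l' : ℕ) : ℤ) - ((l : ℕ) : ℤ) : ℤ) / 2 ^ D.np)) := by
      rw [grid_add]
      have h3 := congrArg (fun x : ℝ => Complex.I * ((k : ℕ) : ℂ) * (x : ℂ)) h1
      push_cast at h3 ⊢
      linear_combination h3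
    rw [h2]
    push_cast; rfl
  rw [Matrix.mul_apply]
  simp only [Matrix.conjTranspose_apply, hterm]
  rw [← Finset.mul_sum, Fin.sum_univ_eq_sum_range (fun k => z ^ k)]
  have hzN : z ^ (2 ^ D.np) = 1 := by
    rw [hz, ← Complex.exp_nat_mul, Complex.exp_eq_one_iff]
    refine ⟨((l' : ℕ) : ℤ) - ((l : ℕ) : ℤ), ?_⟩
    push_cast
    field_simp
  by_cases hll : l = l'
  · subst hll
    simp [hz]
  · rw [Matrix.one_apply_ne hll]
    have hz1 : z ≠ 1 := by
      intro h
      rw [hz, Complex.exp_eq_one_iff] at h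
      obtain ⟨n, hn⟩ := h
      have h2 : (((((l' : ℕ) : ℤ) - ((l : ℕ) : ℤ) : ℤ)) : ℂ) = ((n * 2 ^ D.np : ℤ) : ℂ) := by
        have h3 := mul_left_cancel₀ Complex.two_pi_I_ne_zero (hn.trans (mul_comm _ _))
        rw [div_eq_iff hNc] at h3
        push_cast at h3 ⊢
        exact h3
      have h3 : ((l' : ℕ) : ℤ) - ((l : ℕ) : ℤ) = n * 2 ^ D.np := by exact_mod_cast h2
      have hl := l.2
      have hl' := l'.2
      have hn0 : n = 0 := by
        have hl2 : ((l : ℕ) : ℤ) < 2 ^ D.np := by exact_mod_cast hl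
        have hl2' : ((l' : ℕ) : ℤ) < 2 ^ D.np := by exact_mod_cast hl'
        by_contra hne
        rcases lt_or_gt_of_ne hne with h | h <;> nlinarith
      rw [hn0] at h3
      exact hll (Fin.ext (by omega))
    rw [geom_sum_eq hz1, hzN]
    simp

/-- `fourier` as a unitary. -/
def fourierUnitary : Matrix.unitaryGroup (Fin (2 ^ D.np)) ℂ :=
  ⟨D.fourier, Matrix.mem_unitaryGroup_iff'.2 D.fourier_star_mul⟩

theorem zetaTilde_eq (l : Fin (2 ^ D.np)) :
    D.zetaTilde l = ((√(2 ^ D.np))⁻¹ : ℝ) *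
      (D.fourierᴴ *ᵥ fun k => ((zeta (D.grid k) : ℝ) : ℂ)) l := by
  have hN : (0 : ℝ) ≤ 2 ^ D.np := by positivity
  have h1 : (1 / 2 ^ D.np : ℂ) = ((√(2 ^ D.np))⁻¹ : ℝ) * ((√(2 ^ D.np))⁻¹ : ℝ) := by
    rw [← Complex.ofReal_mul, ← mul_inv, Real.mul_self_sqrt hN]
    push_cast; rw [one_div]
  rw [zetaTilde, h1, mul_assoc, Matrix.mulVec, dotProduct, Finset.mul_sum]
  congr 1
  refine Finset.sum_congr rfl fun k _ => ?_
  simp only [fourier, Matrix.conjTranspose_apply, Matrix.of_apply, Complex.star_def, map_mul,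
    Complex.conj_ofReal, ← Complex.exp_conj, Complex.conj_I]
  rw [mul_assoc (_ : ℂ) (Complex.exp _), mul_comm (Complex.exp _)]
  congr 3
  ring_nf

/-- Parseval's identity. -/
theorem sum_norm_zetaTilde_sq :
    ∑ l, ‖D.zetaTilde l‖ ^ 2 = ‖D.zetaVec‖ ^ 2 / 2 ^ D.np := by
  have hN : (0 : ℝ) ≤ 2 ^ D.np := by positivity
  set v : Fin (2 ^ D.np) → ℂ := fun k => ((zeta (D.grid k) : ℝ) : ℂ) with hv
  have hdot : ∀ w : Fin (2 ^ D.np) → ℂ, star w ⬝ᵥ w = ((∑ k, ‖w k‖ ^ 2 : ℝ) : ℂ) := by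
    intro w
    rw [dotProduct]
    push_cast
    exact Finset.sum_congr rfl fun k _ => by
      rw [Pi.star_apply, Complex.star_def, Complex.conj_mul']
  have hF : D.fourier * D.fourierᴴ = 1 := mul_eq_one_comm.1 D.fourier_star_mul
  have h1 : star (D.fourierᴴ *ᵥ v) ⬝ᵥ (D.fourierᴴ *ᵥ v) = star v ⬝ᵥ v := by
    rw [Matrix.star_mulVec, Matrix.conjTranspose_conjTranspose, ← Matrix.dotProduct_mulVec,
      Matrix.mulVec_mulVec, hF, Matrix.one_mulVec]
  rw [hdot, hdot] at h1
  have h2 := Complex.ofReal_injective h1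
  have h3 : ∑ k, ‖v k‖ ^ 2 = ‖D.zetaVec‖ ^ 2 := by
    rw [EuclideanSpace.norm_sq_eq]
    exact Finset.sum_congr rfl fun k _ => by simp [hv, zetaVec]
  rw [← h3, ← h2, Finset.sum_div]
  refine Finset.sum_congr rfl fun l _ => ?_
  rw [zetaTilde_eq, norm_mul, mul_pow, Complex.norm_real, norm_inv,
    Real.norm_of_nonneg (Real.sqrt_nonneg _), inv_pow, Real.sq_sqrt hN]
  rw [← hv, inv_mul_eq_div]

theorem norm_zetaTilde_le (l : Fin (2 ^ D.np)) :
    ‖D.zetaTilde l‖ ≤ (∑ k, |zeta (D.grid k)|) / 2 ^ D.np := by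
  unfold zetaTilde
  rw [norm_mul, div_eq_mul_inv, mul_comm]
  refine mul_le_mul ((norm_sum_le _ _).trans (Finset.sum_le_sum fun k _ => ?_)) ?_
    (norm_nonneg _) (Finset.sum_nonneg fun k _ => abs_nonneg _)
  · rw [norm_mul, Complex.norm_real, Real.norm_eq_abs]
    refine mul_le_of_le_one_right (abs_nonneg _) (le_of_eq ?_)
    rw [show -(Complex.I * (D.mu l : ℂ) * ((D.grid k + Real.pi * D.R : ℝ) : ℂ))
      = ((-(D.mu l * (D.grid k + Real.pi * D.R)) : ℝ) : ℂ) * Complex.I by push_cast; ring]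
    exact Complex.norm_exp_ofReal_mul_I _
  · simp

theorem sum_norm_zetaTilde_le : ∑ l, ‖D.zetaTilde l‖ ≤ ∑ k, |zeta (D.grid k)| := by
  refine (Finset.sum_le_sum fun l _ => D.norm_zetaTilde_le l).trans (le_of_eq ?_)
  simp only [Finset.sum_const, Finset.card_univ, Fintype.card_fin, nsmul_eq_mul]
  push_cast
  field_simp

end Discretization

/-! ### Sampling the kernel on an infinite grid -/

theorem abs_zeta_le (p : ℝ) : |zeta p| ≤ Real.exp 2 * Real.exp (-|p|) := by
  unfold zeta
  rw [abs_mul, Real.abs_exp, ← Real.exp_add]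
  have h1 : |p| ≤ Real.exp |p| := by linarith [Real.add_one_le_exp |p|]
  calc |p| * Real.exp (-(p ^ 2) / 2) ≤ Real.exp |p| * Real.exp (-(p ^ 2) / 2) :=
        mul_le_mul_of_nonneg_right h1 (Real.exp_pos _).le
    _ ≤ _ := by
        rw [← Real.exp_add]
        refine Real.exp_le_exp.2 ?_
        nlinarith [sq_nonneg (|p| - 2), sq_abs p]

theorem hasSum_exp_neg_abs_div {K : ℕ} (hK : 0 < K) :
    ∃ s ≤ 2 * ((K : ℝ) + 1), HasSum (fun j : ℤ => Real.exp (-|(j : ℝ) / K|)) s := by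
  have hK' : (0 : ℝ) < K := by exact_mod_cast hK
  set r := Real.exp (-(1 / K : ℝ)) with hr
  have hr0 : 0 ≤ r := (Real.exp_pos _).le
  have hr1 : r < 1 := by rw [hr, Real.exp_lt_one_iff]; simpa using hK
  have hg := hasSum_geometric_of_lt_one hr0 hr1
  have hle : (1 - r)⁻¹ ≤ (K : ℝ) + 1 := by
    rw [inv_le_comm₀ (by linarith) (by positivity)]
    have h1 : 1 / K + 1 ≤ Real.exp (1 / K : ℝ) := Real.add_one_le_exp _
    have h2 : r ≤ (1 / K + 1 : ℝ)⁻¹ := by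
      rw [hr, Real.exp_neg]
      exact inv_anti₀ (by positivity) h1
    have h3 : (1 / K + 1 : ℝ)⁻¹ = 1 - ((K : ℝ) + 1)⁻¹ := by field_simp; ring
    linarith
  have hpow : ∀ n : ℕ, r ^ n = Real.exp (-|((n : ℤ) : ℝ) / K|) := by
    intro n
    rw [hr, ← Real.exp_nat_mul]
    congr 1
    rw [abs_of_nonneg (by positivity)]
    push_cast; ring
  have hs1 : HasSum (fun n : ℕ => Real.exp (-|((n : ℤ) : ℝ) / K|)) (1 - r)⁻¹ := by
    simpa only [hpow] using hg
  have hs2 : HasSum (fun n : ℕ => Real.exp (-|((-((n : ℤ) + 1) : ℤ) : ℝ) / K|))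
      (r * (1 - r)⁻¹) := by
    refine (hg.mul_left r).congr_fun fun n => ?_
    rw [← pow_succ', hpow (n + 1)]
    congr 2
    push_cast
    rw [neg_div, abs_neg]
  refine ⟨_, ?_, hs1.of_nat_of_neg_add_one hs2⟩
  have : r * (1 - r)⁻¹ ≤ (1 - r)⁻¹ :=
    mul_le_of_le_one_left (inv_nonneg.2 (by linarith)) hr1.le
  linarith

/-- The Fourier series `∑_j ζ(j / K) exp(-2 π i j θ)` of the samples of `ζ` on the grid of mesh size
`1 / K`. -/
def sampleSeries (K : ℕ) (θ : ℝ) : ℂ :=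
  ∑' j : ℤ, ((zeta (j / K) : ℝ) : ℂ) * Complex.exp (-(2 * Real.pi * Complex.I * j * θ))

theorem norm_sampleSeries_term (K : ℕ) (j : ℤ) (θ : ℝ) :
    ‖((zeta (j / K) : ℝ) : ℂ) * Complex.exp (-(2 * Real.pi * Complex.I * j * θ))‖
      = |zeta (j / K)| := by
  rw [norm_mul, Complex.norm_real, Real.norm_eq_abs,
    show -(2 * Real.pi * Complex.I * j * θ) = ((-(2 * Real.pi * j * θ) : ℝ) : ℂ) * Complex.I by
      push_cast; ring, Complex.norm_exp_ofReal_mul_I, mul_one]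

theorem summable_zeta {K : ℕ} (hK : 0 < K) : Summable fun j : ℤ => |zeta (j / K)| := by
  obtain ⟨s, -, hs⟩ := hasSum_exp_neg_abs_div hK
  exact Summable.of_nonneg_of_le (fun _ => abs_nonneg _) (fun j => abs_zeta_le _)
    (hs.mul_left (Real.exp 2)).summable

theorem tsum_zeta_le {K : ℕ} (hK : 0 < K) :
    ∑' j : ℤ, |zeta (j / K)| ≤ Real.exp 2 * (2 * ((K : ℝ) + 1)) := by
  obtain ⟨s, hle, hs⟩ := hasSum_exp_neg_abs_div hK
  refine ((summable_zeta hK).tsum_le_tsum (fun j => abs_zeta_le _)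
    (hs.mul_left (Real.exp 2)).summable).trans ?_
  rw [(hs.mul_left (Real.exp 2)).tsum_eq]
  exact mul_le_mul_of_nonneg_left hle (Real.exp_pos _).le

theorem continuous_sampleSeries {K : ℕ} (hK : 0 < K) : Continuous (sampleSeries K) :=
  continuous_tsum (fun j => by fun_prop) (summable_zeta hK)
    fun j θ => (norm_sampleSeries_term K j θ).le

/-- `v exp(-2 π² K² v²)`, up to a factor the Fourier transform of `ζ` at frequency `2 π K v`. -/
def aliasKernel (K : ℕ) (v : ℝ) : ℝ := v * Real.exp (-(2 * Real.pi ^ 2 * K ^ 2) * v ^ 2)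

/-- Poisson summation: the samples have the periodized Fourier transform of `ζ` as their Fourier
series. This is the functional equation between the sine and the odd Jacobi theta kernels. -/
theorem exists_hasSum_aliasKernel {K : ℕ} (hK : 0 < K) (θ : ℝ) :
    ∃ s : ℝ, HasSum (fun n : ℤ => aliasKernel K (n + θ)) s ∧
      sampleSeries K θ = -(Complex.I * ((√(2 * Real.pi) * (2 * Real.pi) * K ^ 2 : ℝ) : ℂ)) * s := by
  have hK' : (0 : ℝ) < K := by exact_mod_cast hK
  have hpi := Real.pi_pos
  -- the parameter for which `exp(-π j² / x) = exp(-(j / K)² / 2)`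
  set x : ℝ := 2 * Real.pi * K ^ 2 with hx
  have hx0 : 0 < x := by positivity
  have h1 := HurwitzZeta.hasSum_int_oddKernel θ hx0
  refine ⟨HurwitzZeta.oddKernel θ x, ?_, ?_⟩
  · refine h1.congr_fun fun n => ?_
    unfold aliasKernel
    congr 2
    rw [hx]; ring
  · have h2 := HurwitzZeta.hasSum_int_sinKernel (-θ) (one_div_pos.2 hx0)
    have h3 := (h2.mul_left (Complex.I / K)).tsum_eq
    have hKc : (K : ℂ) ≠ 0 := by exact_mod_cast hK.ne'
    have h4 : sampleSeries K θ
        = Complex.I / K * (HurwitzZeta.sinKernel ((-θ : ℝ) : UnitAddCircle) (1 / x) : ℝ) := by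
      rw [← h3]
      unfold sampleSeries
      congr 1; ext j
      have e1 : zeta (j / K) = (j : ℝ) / K * Real.exp (-Real.pi * (j : ℝ) ^ 2 * (1 / x)) := by
        unfold zeta
        congr 2
        rw [hx]; field_simp
      have e2 : -(2 * Real.pi * Complex.I * j * θ)
          = 2 * Real.pi * Complex.I * ((-θ : ℝ) : ℂ) * j := by push_cast; ring
      rw [e1, e2]
      push_cast
      field_simp
      ring_nf
      simp
    have h5 := HurwitzZeta.oddKernel_functional_equation ((-θ : ℝ) : UnitAddCircle) x
    have h6 : x ^ (3 / 2 : ℝ) = √(2 * Real.pi) * (2 * Real.pi) * K ^ 3 := by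
      rw [show (3 / 2 : ℝ) = 1 + 1 / 2 by norm_num, Real.rpow_add hx0, Real.rpow_one,
        ← Real.sqrt_eq_rpow, hx, Real.sqrt_mul (by positivity), Real.sqrt_sq hK'.le]
      ring
    have h7 : HurwitzZeta.oddKernel ((-θ : ℝ) : UnitAddCircle) x
        = -HurwitzZeta.oddKernel (θ : UnitAddCircle) x := by
      rw [QuotientAddGroup.mk_neg, HurwitzZeta.oddKernel_neg]
    have h8 : HurwitzZeta.sinKernel ((-θ : ℝ) : UnitAddCircle) (1 / x)
        = -(√(2 * Real.pi) * (2 * Real.pi) * K ^ 3) * HurwitzZeta.oddKernel (θ : UnitAddCircle) x := by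
      rw [h7, h6] at h5
      have : √(2 * Real.pi) ≠ 0 := by positivity
      field_simp at h5
      linarith
    rw [h4, h8]
    push_cast
    field_simp

theorem abs_exp_sub_exp_neg_le (y : ℝ) :
    |Real.exp y - Real.exp (-y)| ≤ 2 * |y| * Real.exp |y| := by
  have key : ∀ z : ℝ, 0 ≤ z → |Real.exp z - Real.exp (-z)| ≤ 2 * z * Real.exp z := by
    intro z hz
    rw [abs_of_nonneg (sub_nonneg.2 (Real.exp_le_exp.2 (by linarith)))]
    have h1 := Real.add_one_le_exp (-(2 * z))
    have h2 : Real.exp (-z) = Real.exp z * Real.exp (-(2 * z)) := by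
      rw [← Real.exp_add]; congr 1; ring
    rw [h2]
    nlinarith [Real.exp_pos z]
  rcases le_total 0 y with h | h
  · simpa [abs_of_nonneg h] using key y h
  · have := key (-y) (by linarith)
    rw [neg_neg, abs_sub_comm] at this
    simpa [abs_of_nonpos h] using this

/-- The two aliases of `θ` at distance `n` nearly cancel: their sum vanishes linearly at `θ = 0`,
because the kernel is odd. -/
theorem abs_aliasKernel_pair_le {K : ℕ} {θ : ℝ} (hθ : |θ| ≤ 1 / 2) {n : ℕ} (hn : 1 ≤ n) :
    |aliasKernel K (n + θ) + aliasKernel K (-n + θ)|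
      ≤ 32 * |θ| * Real.exp (-(2 * Real.pi ^ 2 * K ^ 2) / 8) ^ n := by
  set a : ℝ := 2 * Real.pi ^ 2 * K ^ 2 with ha
  have ha0 : 0 ≤ a := by positivity
  have hn' : (1 : ℝ) ≤ n := by exact_mod_cast hn
  set y : ℝ := 2 * a * n * θ with hy
  have e1 : aliasKernel K (n + θ) + aliasKernel K (-n + θ)
      = Real.exp (-a * (n ^ 2 + θ ^ 2)) *
        (θ * (Real.exp y + Real.exp (-y)) - n * (Real.exp y - Real.exp (-y))) := by
    unfold aliasKernel
    rw [← ha]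
    have f1 : Real.exp (-a * ((n : ℝ) + θ) ^ 2)
        = Real.exp (-a * (n ^ 2 + θ ^ 2)) * Real.exp (-y) := by
      rw [← Real.exp_add]; congr 1; rw [hy]; ring
    have f2 : Real.exp (-a * (-(n : ℝ) + θ) ^ 2)
        = Real.exp (-a * (n ^ 2 + θ ^ 2)) * Real.exp y := by
      rw [← Real.exp_add]; congr 1; rw [hy]; ring
    rw [f1, f2]; ring
  have e2 : |θ * (Real.exp y + Real.exp (-y)) - n * (Real.exp y - Real.exp (-y))|
      ≤ 2 * |θ| * Real.exp |y| * (1 + 2 * a * n ^ 2) := by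
    refine (abs_sub _ _).trans ?_
    rw [abs_mul, abs_mul, abs_of_nonneg (by positivity : 0 ≤ Real.exp y + Real.exp (-y)),
      abs_of_nonneg (by positivity : (0 : ℝ) ≤ n)]
    have g1 : Real.exp y + Real.exp (-y) ≤ 2 * Real.exp |y| := by
      linarith [Real.exp_le_exp.2 (le_abs_self y), Real.exp_le_exp.2 (neg_le_abs y)]
    have g2 := abs_exp_sub_exp_neg_le y
    have g3 : |y| = 2 * a * n * |θ| := by
      rw [hy, abs_mul, abs_of_nonneg (by positivity)]
    calc _ ≤ |θ| * (2 * Real.exp |y|) + n * (2 * |y| * Real.exp |y|) := by gcongr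
      _ = _ := by rw [g3]; ring
  -- completing the square: the exponent is `-a (n - |θ|)²`, and `|θ| ≤ n / 2`
  have e3 : Real.exp (-a * (n ^ 2 + θ ^ 2)) * Real.exp |y| ≤ Real.exp (-a * n ^ 2 / 4) := by
    rw [← Real.exp_add]
    refine Real.exp_le_exp.2 ?_
    have g3 : |y| = 2 * a * n * |θ| := by
      rw [hy, abs_mul, abs_of_nonneg (by positivity)]
    have g4 : (n : ℝ) ^ 2 / 4 ≤ (n - |θ|) ^ 2 := by
      have : (n : ℝ) / 2 ≤ n - |θ| := by linarith
      nlinarith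
    rw [g3, ← sq_abs θ]
    nlinarith [mul_le_mul_of_nonneg_left g4 ha0]
  -- half of the decay absorbs the polynomial factor
  have e4 : 1 + 2 * a * n ^ 2 ≤ 16 * Real.exp (a * n ^ 2 / 8) := by
    have := Real.add_one_le_exp (a * n ^ 2 / 8)
    linarith
  have e5 : Real.exp (-a * n ^ 2 / 4) * Real.exp (a * n ^ 2 / 8) ≤ Real.exp (-a / 8) ^ n := by
    rw [← Real.exp_add, ← Real.exp_nat_mul]
    refine Real.exp_le_exp.2 ?_
    have : (n : ℝ) * a ≤ n ^ 2 * a := mul_le_mul_of_nonneg_right (by nlinarith) ha0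
    linarith
  rw [e1, abs_mul, Real.abs_exp]
  calc _ ≤ Real.exp (-a * (n ^ 2 + θ ^ 2)) *
        (2 * |θ| * Real.exp |y| * (16 * Real.exp (a * n ^ 2 / 8))) := by
        refine mul_le_mul_of_nonneg_left (e2.trans ?_) (Real.exp_pos _).le
        gcongr
    _ = 32 * |θ| * ((Real.exp (-a * (n ^ 2 + θ ^ 2)) * Real.exp |y|) *
        Real.exp (a * n ^ 2 / 8)) := by ring
    _ ≤ 32 * |θ| * (Real.exp (-a * n ^ 2 / 4) * Real.exp (a * n ^ 2 / 8)) := by gcongr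
    _ ≤ _ := by gcongr

theorem alias_exponent_ge {K : ℕ} : 2 * (K : ℝ) ^ 2 ≤ 2 * Real.pi ^ 2 * K ^ 2 / 8 := by
  have : (3 : ℝ) ^ 2 ≤ Real.pi ^ 2 := pow_le_pow_left₀ (by norm_num) Real.pi_gt_three.le 2
  nlinarith [sq_nonneg (K : ℝ)]

/-- All aliases together are of relative size `exp(-2 K²)`, and vanish linearly at `θ = 0`. The
geometric ratio of the pairs is at most `1 / 2`. -/
theorem abs_alias_sum_le {K : ℕ} (hK : 0 < K) {θ : ℝ} (hθ : |θ| ≤ 1 / 2) {s : ℝ}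
    (hs : HasSum (fun n : ℤ => aliasKernel K (n + θ)) s) :
    |s - aliasKernel K θ| ≤ 64 * |θ| * Real.exp (-(2 * (K : ℝ) ^ 2)) := by
  have h1 := (hasSum_nat_add_iff' 1).2 hs.nat_add_neg
  set r := Real.exp (-(2 * Real.pi ^ 2 * K ^ 2) / 8) with hr
  have hK' : (1 : ℝ) ≤ K := by exact_mod_cast hK
  have hrle : r ≤ Real.exp (-(2 * (K : ℝ) ^ 2)) := by
    rw [hr]
    refine Real.exp_le_exp.2 ?_
    have := alias_exponent_ge (K := K)
    linarith
  have hrhalf : r ≤ 1 / 2 := by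
    refine hrle.trans ?_
    have h2 : Real.exp (-(2 * (K : ℝ) ^ 2)) ≤ Real.exp (-1) :=
      Real.exp_le_exp.2 (by nlinarith)
    have h3 : Real.exp (-1) ≤ 1 / 2 := by
      rw [Real.exp_neg, ← one_div]
      exact one_div_le_one_div_of_le two_pos (by linarith [Real.add_one_le_exp (1 : ℝ)])
    linarith
  have hr0 : 0 ≤ r := (Real.exp_pos _).le
  have hg := (hasSum_geometric_of_lt_one hr0 (by linarith : r < 1)).mul_left (32 * |θ| * r)
  have h2 := tsum_of_norm_bounded hg (f := fun n : ℕ =>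
      aliasKernel K (((n + 1 : ℕ) : ℤ) + θ) + aliasKernel K ((-((n + 1 : ℕ) : ℤ) : ℤ) + θ)) (by
    intro n
    have := abs_aliasKernel_pair_le (K := K) hθ (Nat.le_add_left 1 n)
    rw [Real.norm_eq_abs, mul_assoc, ← pow_succ']
    push_cast at this ⊢
    exact this)
  rw [h1.tsum_eq] at h2
  simp only [Finset.range_one, Finset.sum_singleton, neg_zero, Int.cast_zero,
    zero_add, Real.norm_eq_abs, CharP.cast_eq_zero] at h2
  -- the two-sided sum over `n ∈ ℕ` counts the central term twice
  have h3 : s + aliasKernel K θ - (aliasKernel K θ + aliasKernel K θ) = s - aliasKernel K θ := by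
    ring
  rw [h3] at h2
  refine h2.trans ?_
  have h4 : (1 - r)⁻¹ ≤ 2 := by
    rw [inv_le_comm₀ (by linarith) two_pos]; linarith
  have h5 : 0 ≤ (1 - r)⁻¹ := inv_nonneg.2 (by linarith)
  calc 32 * |θ| * r * (1 - r)⁻¹ ≤ 32 * |θ| * Real.exp (-(2 * (K : ℝ) ^ 2)) * 2 := by gcongr
    _ = _ := by ring

/-- `∫₀^X exp(i ω s) ds`. -/
def oscIntegral (ω X : ℝ) : ℂ := ∫ s in (0 : ℝ)..X, Complex.exp (Complex.I * ω * s)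

theorem oscIntegral_eq {ω : ℝ} (hω : ω ≠ 0) (X : ℝ) :
    oscIntegral ω X = (Complex.exp (Complex.I * ω * X) - 1) / (Complex.I * ω) := by
  unfold oscIntegral
  have hc : Complex.I * (ω : ℂ) ≠ 0 := mul_ne_zero Complex.I_ne_zero (by exact_mod_cast hω)
  rw [integral_exp_mul_complex hc]
  simp

theorem norm_exp_I_mul_ofReal (ω X : ℝ) : ‖Complex.exp (Complex.I * ω * X)‖ = 1 := by
  rw [show Complex.I * (ω : ℂ) * X = ((ω * X : ℝ) : ℂ) * Complex.I by push_cast; ring]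
  exact Complex.norm_exp_ofReal_mul_I _

theorem norm_oscIntegral_le {ω : ℝ} (hω : ω ≠ 0) (X : ℝ) : ‖oscIntegral ω X‖ ≤ 2 / |ω| := by
  rw [oscIntegral_eq hω, norm_div]
  simp only [norm_mul, Complex.norm_I, one_mul, Complex.norm_real, Real.norm_eq_abs]
  refine div_le_div_of_nonneg_right ((norm_sub_le _ _).trans ?_) (abs_nonneg _)
  rw [norm_exp_I_mul_ofReal]
  norm_num

theorem continuous_oscIntegral : Continuous fun p : ℝ × ℝ => oscIntegral p.1 p.2 := by
  unfold oscIntegral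
  exact intervalIntegral.continuous_parametric_intervalIntegral_of_continuous
    (f := fun (p : ℝ × ℝ) (s : ℝ) => Complex.exp (Complex.I * p.1 * s))
    (by fun_prop) continuous_snd

/-! ### The error of band-limited interpolation -/

/-- The unaliased part of the sample series integrates to a Gaussian integral over
`[-1/2, 1/2]`. -/
theorem aliasKernel_mul_oscIntegral {K : ℕ} (hK : 0 < K) (X θ : ℝ) :
    -(Complex.I * ((√(2 * Real.pi) * (2 * Real.pi) * K ^ 2 : ℝ) : ℂ)) * (aliasKernel K θ : ℝ) *
      oscIntegral (2 * Real.pi * K * θ) X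
      = ((√(2 * Real.pi) * K : ℝ) : ℂ) *
        (((Real.exp (-(2 * Real.pi ^ 2 * K ^ 2) * θ ^ 2) : ℝ) : ℂ) *
          (1 - Complex.exp (Complex.I * (2 * Real.pi * K * X : ℝ) * θ))) := by
  have hKc : (K : ℂ) ≠ 0 := by exact_mod_cast hK.ne'
  have hpi : (Real.pi : ℂ) ≠ 0 := by exact_mod_cast Real.pi_ne_zero
  rcases eq_or_ne θ 0 with rfl | hθ
  · simp [aliasKernel]
  have hK' : (K : ℝ) ≠ 0 := by exact_mod_cast hK.ne'
  have hω : 2 * Real.pi * K * θ ≠ 0 := by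
    have := Real.pi_ne_zero
    positivity
  have hθc : (θ : ℂ) ≠ 0 := by exact_mod_cast hθ
  have hI := Complex.I_ne_zero
  rw [oscIntegral_eq hω]
  have e1 : Complex.I * ((2 * Real.pi * K * θ : ℝ) : ℂ) * X
      = Complex.I * (2 * Real.pi * K * X : ℝ) * θ := by push_cast; ring
  rw [e1]
  unfold aliasKernel
  push_cast
  field_simp
  ring

/-- Over the whole line the unaliased part gives `∫₀^X ζ` exactly. -/
theorem integral_gaussian_mul_one_sub_exp {K : ℕ} (hK : 0 < K) (X : ℝ) :
    ((√(2 * Real.pi) * K : ℝ) : ℂ) * ∫ θ : ℝ,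
      ((Real.exp (-(2 * Real.pi ^ 2 * K ^ 2) * θ ^ 2) : ℝ) : ℂ) *
          (1 - Complex.exp (Complex.I * (2 * Real.pi * K * X : ℝ) * θ))
      = ((1 - Real.exp (-(X ^ 2) / 2) : ℝ) : ℂ) := by
  have hK' : (0 : ℝ) < K := by exact_mod_cast hK
  have hpi := Real.pi_pos
  set a : ℝ := 2 * Real.pi ^ 2 * K ^ 2 with ha
  have ha0 : 0 < a := by positivity
  have hre : 0 < (a : ℂ).re := by simpa using ha0
  have h0 := fourierIntegral_gaussian hre 0
  have h1 := fourierIntegral_gaussian hre ((2 * Real.pi * K * X : ℝ) : ℂ)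
  have i0 : MeasureTheory.Integrable fun θ : ℝ => Complex.exp (-(a : ℂ) * (θ : ℂ) ^ 2) :=
    integrable_cexp_neg_mul_sq hre
  have i1 : MeasureTheory.Integrable fun θ : ℝ =>
      Complex.exp (Complex.I * ((2 * Real.pi * K * X : ℝ) : ℂ) * θ) *
        Complex.exp (-(a : ℂ) * (θ : ℂ) ^ 2) := by
    refine i0.bdd_mul (c := 1) (Continuous.aestronglyMeasurable (by fun_prop))
      (Filter.Eventually.of_forall fun θ => ?_)
    exact (norm_exp_I_mul_ofReal _ θ).le
  have e0 : ∀ θ : ℝ, ((Real.exp (-a * θ ^ 2) : ℝ) : ℂ) *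
      (1 - Complex.exp (Complex.I * (2 * Real.pi * K * X : ℝ) * θ))
      = Complex.exp (-(a : ℂ) * (θ : ℂ) ^ 2) -
        Complex.exp (Complex.I * ((2 * Real.pi * K * X : ℝ) : ℂ) * θ) *
        Complex.exp (-(a : ℂ) * (θ : ℂ) ^ 2) := by
    intro θ; push_cast; ring
  simp only [e0]
  rw [MeasureTheory.integral_sub i0 i1, h1]
  simp only [mul_zero, zero_mul, Complex.exp_zero, one_mul, ne_eq, OfNat.ofNat_ne_zero,
    not_false_eq_true, zero_pow, neg_zero, zero_div, mul_one] at h0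
  rw [h0]
  have hroot : ((Real.pi : ℂ) / a) ^ (1 / 2 : ℂ) = ((√(2 * Real.pi) * K : ℝ) : ℂ)⁻¹ := by
    have g1 : Real.pi / a = ((√(2 * Real.pi) * K) ^ 2)⁻¹ := by
      rw [mul_pow, Real.sq_sqrt (by positivity), ha]
      field_simp
    have g2 : (Real.pi / a) ^ (1 / 2 : ℝ) = (√(2 * Real.pi) * K)⁻¹ := by
      rw [← Real.sqrt_eq_rpow, g1, Real.sqrt_inv, Real.sqrt_sq (by positivity)]
    rw [← Complex.ofReal_inv, ← g2, Complex.ofReal_cpow (by positivity)]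
    push_cast; rfl
  have hexp : Complex.exp (-((2 * Real.pi * K * X : ℝ) : ℂ) ^ 2 / (4 * a))
      = ((Real.exp (-(X ^ 2) / 2) : ℝ) : ℂ) := by
    rw [Complex.ofReal_exp]
    congr 1
    have : -(2 * Real.pi * K * X) ^ 2 / (4 * a) = -(X ^ 2) / 2 := by
      rw [ha]; field_simp; ring
    rw [← this]; push_cast; ring
  have hne : ((√(2 * Real.pi) * K : ℝ) : ℂ) ≠ 0 := by
    have : √(2 * Real.pi) * K ≠ 0 := by positivity
    exact_mod_cast this
  rw [hroot, hexp]
  field_simp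
  push_cast; ring

theorem mul_exp_neg_two_sq_le (K : ℕ) :
    (K : ℝ) * Real.exp (-(2 * (K : ℝ) ^ 2)) ≤ Real.exp (-(K : ℝ) ^ 2) := by
  have h1 : (K : ℝ) ≤ Real.exp ((K : ℝ) ^ 2) := by
    have := Real.add_one_le_exp ((K : ℝ) ^ 2)
    nlinarith [sq_nonneg ((K : ℝ) - 1)]
  calc (K : ℝ) * Real.exp (-(2 * (K : ℝ) ^ 2))
      ≤ Real.exp ((K : ℝ) ^ 2) * Real.exp (-(2 * (K : ℝ) ^ 2)) :=
        mul_le_mul_of_nonneg_right h1 (Real.exp_pos _).le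
    _ = _ := by rw [← Real.exp_add]; congr 1; ring

theorem sqrt_two_pi_le : √(2 * Real.pi) ≤ 3 := by
  rw [Real.sqrt_le_left (by norm_num)]
  linarith [Real.pi_lt_four]

/-- Truncating the Gaussian integral to the band `[-1/2, 1/2]` costs an exponentially small
amount. -/
theorem gaussian_tail_le {K : ℕ} (hK : 0 < K) (X : ℝ) :
    ‖((√(2 * Real.pi) * K : ℝ) : ℂ) * (∫ θ in (-(1 / 2) : ℝ)..(1 / 2),
      ((Real.exp (-(2 * Real.pi ^ 2 * K ^ 2) * θ ^ 2) : ℝ) : ℂ) *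
          (1 - Complex.exp (Complex.I * (2 * Real.pi * K * X : ℝ) * θ)))
      - ((1 - Real.exp (-(X ^ 2) / 2) : ℝ) : ℂ)‖ ≤ 4 * Real.exp (-(K : ℝ) ^ 2) := by
  have hK' : (0 : ℝ) < K := by exact_mod_cast hK
  have hpi := Real.pi_pos
  rw [← integral_gaussian_mul_one_sub_exp hK X]
  set a : ℝ := 2 * Real.pi ^ 2 * K ^ 2 with ha
  have ha0 : 0 < a := by positivity
  set q : ℝ → ℂ := fun θ => ((Real.exp (-a * θ ^ 2) : ℝ) : ℂ) *
      (1 - Complex.exp (Complex.I * (2 * Real.pi * K * X : ℝ) * θ)) with hq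
  have hqn : ∀ θ, ‖q θ‖ ≤ 2 * Real.exp (-a * θ ^ 2) := by
    intro θ
    rw [hq, norm_mul, Complex.norm_real, Real.norm_of_nonneg (Real.exp_pos _).le, mul_comm]
    refine mul_le_mul_of_nonneg_right ((norm_sub_le _ _).trans ?_) (Real.exp_pos _).le
    rw [norm_exp_I_mul_ofReal]
    norm_num
  have hqi : MeasureTheory.Integrable q :=
    ((integrable_exp_neg_mul_sq ha0).const_mul 2).mono'
      (Continuous.aestronglyMeasurable (by fun_prop)) (Filter.Eventually.of_forall hqn)
  set s : Set ℝ := Set.Ioc (-(1 / 2)) (1 / 2) with hs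
  have hsm : MeasurableSet s := measurableSet_Ioc
  have hsplit := MeasureTheory.integral_add_compl hsm hqi
  rw [intervalIntegral.integral_of_le (by norm_num), ← hsplit, mul_add, sub_add_cancel_left,
    norm_neg, norm_mul, Complex.norm_real, Real.norm_of_nonneg (by positivity)]
  have ha2 : 0 < a / 2 := by positivity
  have hbound : ‖∫ θ in sᶜ, q θ‖ ≤ 2 * Real.exp (-(a / 8)) * √(Real.pi / (a / 2)) := by
    calc ‖∫ θ in sᶜ, q θ‖ ≤ ∫ θ in sᶜ, 2 * Real.exp (-(a / 8)) * Real.exp (-(a / 2) * θ ^ 2) := by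
          refine MeasureTheory.norm_integral_le_of_norm_le
            (((integrable_exp_neg_mul_sq ha2).const_mul _).integrableOn) ?_
          refine (MeasureTheory.ae_restrict_iff' hsm.compl).2
            (Filter.Eventually.of_forall fun θ hθ => (hqn θ).trans ?_)
          rw [mul_assoc, ← Real.exp_add]
          refine mul_le_mul_of_nonneg_left (Real.exp_le_exp.2 ?_) zero_le_two
          have h4 : 1 / 4 ≤ θ ^ 2 := by
            rw [hs, Set.mem_compl_iff, Set.mem_Ioc, not_and_or] at hθ
            rcases hθ with h | h
            · nlinarith [not_lt.1 h]
            · nlinarith [not_le.1 h]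
          nlinarith
      _ ≤ ∫ θ : ℝ, 2 * Real.exp (-(a / 8)) * Real.exp (-(a / 2) * θ ^ 2) :=
          MeasureTheory.setIntegral_le_integral ((integrable_exp_neg_mul_sq ha2).const_mul _)
            (Filter.Eventually.of_forall fun θ => by positivity)
      _ = _ := by rw [MeasureTheory.integral_const_mul, integral_gaussian]
  have hroot : √(Real.pi / (a / 2)) = (√Real.pi * K)⁻¹ := by
    rw [show Real.pi / (a / 2) = ((√Real.pi * K) ^ 2)⁻¹ by
      rw [mul_pow, Real.sq_sqrt hpi.le, ha]; field_simp]
    rw [Real.sqrt_inv, Real.sqrt_sq (by positivity)]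
  have hexp : Real.exp (-(a / 8)) ≤ Real.exp (-(K : ℝ) ^ 2) := by
    refine Real.exp_le_exp.2 ?_
    have := alias_exponent_ge (K := K)
    nlinarith [sq_nonneg (K : ℝ)]
  have hs2 : √2 ≤ 2 := by rw [Real.sqrt_le_left] <;> norm_num
  calc √(2 * Real.pi) * K * ‖∫ θ in sᶜ, q θ‖
      ≤ √(2 * Real.pi) * K * (2 * Real.exp (-(a / 8)) * √(Real.pi / (a / 2))) := by gcongr
    _ = 2 * √2 * Real.exp (-(a / 8)) := by
        rw [hroot, Real.sqrt_mul zero_le_two]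
        have : √Real.pi ≠ 0 := by positivity
        field_simp
    _ ≤ 2 * 2 * Real.exp (-(K : ℝ) ^ 2) := by gcongr
    _ = _ := by norm_num

/-- The integral over `[0, X]` of the band-limited interpolant of `ζ` is exponentially close to
`∫₀^X ζ = 1 - exp(-X²/2)`, uniformly in `X`. -/
theorem interpolation_error {K : ℕ} (hK : 0 < K) (X : ℝ) :
    ‖(∫ θ in (-(1 / 2) : ℝ)..(1 / 2), sampleSeries K θ * oscIntegral (2 * Real.pi * K * θ) X)
      - ((1 - Real.exp (-(X ^ 2) / 2) : ℝ) : ℂ)‖ ≤ 400 * Real.exp (-(K : ℝ) ^ 2) := by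
  have hK' : (0 : ℝ) < K := by exact_mod_cast hK
  have hpi := Real.pi_pos
  set c : ℂ := -(Complex.I * ((√(2 * Real.pi) * (2 * Real.pi) * K ^ 2 : ℝ) : ℂ)) with hc
  have hcn : ‖c‖ = √(2 * Real.pi) * (2 * Real.pi) * K ^ 2 := by
    rw [hc, norm_neg, norm_mul, Complex.norm_I, one_mul, Complex.norm_real,
      Real.norm_of_nonneg (by positivity)]
  have hosc : Continuous fun θ : ℝ => oscIntegral (2 * Real.pi * K * θ) X :=
    continuous_oscIntegral.comp (by fun_prop : Continuous fun θ : ℝ => (2 * Real.pi * K * θ, X))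
  have hker : Continuous (aliasKernel K) := by unfold aliasKernel; fun_prop
  have hkerc : Continuous fun θ : ℝ => c * ((aliasKernel K θ : ℝ) : ℂ) *
      oscIntegral (2 * Real.pi * K * θ) X := by
    have : Continuous fun θ : ℝ => ((aliasKernel K θ : ℝ) : ℂ) :=
      Complex.continuous_ofReal.comp hker
    fun_prop
  have hS : Continuous fun θ : ℝ => sampleSeries K θ * oscIntegral (2 * Real.pi * K * θ) X :=
    (continuous_sampleSeries hK).mul hosc
  -- the factor `|θ|` of the alias bound cancels the factor `1 / |θ|` of the oscillatory integral
  have halias : ‖(∫ θ in (-(1 / 2) : ℝ)..(1 / 2),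
      sampleSeries K θ * oscIntegral (2 * Real.pi * K * θ) X)
      - ∫ θ in (-(1 / 2) : ℝ)..(1 / 2), c * ((aliasKernel K θ : ℝ) : ℂ) *
        oscIntegral (2 * Real.pi * K * θ) X‖ ≤ 384 * Real.exp (-(K : ℝ) ^ 2) := by
    rw [← intervalIntegral.integral_sub (hS.intervalIntegrable _ _)
      (hkerc.intervalIntegrable _ _)]
    have hpt : ∀ θ ∈ Set.uIoc (-(1 / 2) : ℝ) (1 / 2),
        ‖sampleSeries K θ * oscIntegral (2 * Real.pi * K * θ) X - c * ((aliasKernel K θ : ℝ) : ℂ) *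
          oscIntegral (2 * Real.pi * K * θ) X‖ ≤ 384 * Real.exp (-(K : ℝ) ^ 2) := by
      intro θ hθ
      rw [Set.uIoc_of_le (by norm_num)] at hθ
      have hθ' : |θ| ≤ 1 / 2 := abs_le.2 ⟨hθ.1.le, hθ.2⟩
      obtain ⟨s, hs, hSs⟩ := exists_hasSum_aliasKernel hK θ
      have hE := abs_alias_sum_le hK hθ' hs
      rw [hSs, ← hc, ← sub_mul, ← mul_sub, ← Complex.ofReal_sub, norm_mul, norm_mul, hcn,
        Complex.norm_real, Real.norm_eq_abs]
      rcases eq_or_ne θ 0 with h0 | h0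
      · rw [h0, abs_zero, mul_zero, zero_mul] at hE
        rw [h0, le_antisymm hE (abs_nonneg _)]
        simp only [mul_zero, zero_mul]
        positivity
      have hω : 2 * Real.pi * K * θ ≠ 0 := by positivity
      have hO := norm_oscIntegral_le hω X
      rw [abs_mul, abs_of_pos (by positivity : 0 < 2 * Real.pi * (K : ℝ))] at hO
      have hθ0 : 0 < |θ| := abs_pos.2 h0
      calc √(2 * Real.pi) * (2 * Real.pi) * K ^ 2 * |s - aliasKernel K θ| *
            ‖oscIntegral (2 * Real.pi * K * θ) X‖
          ≤ √(2 * Real.pi) * (2 * Real.pi) * K ^ 2 *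
            (64 * |θ| * Real.exp (-(2 * (K : ℝ) ^ 2))) * (2 / (2 * Real.pi * K * |θ|)) := by
            gcongr
        _ = 128 * √(2 * Real.pi) * (K * Real.exp (-(2 * (K : ℝ) ^ 2))) := by
            field_simp; ring
        _ ≤ 128 * 3 * Real.exp (-(K : ℝ) ^ 2) := by
            gcongr
            · exact sqrt_two_pi_le
            · exact mul_exp_neg_two_sq_le K
        _ = _ := by norm_num
    refine (intervalIntegral.norm_integral_le_of_norm_le_const hpt).trans (le_of_eq ?_)
    norm_num
  have hmain := gaussian_tail_le hK X
  rw [← intervalIntegral.integral_const_mul] at hmain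
  simp only [hc, aliasKernel_mul_oscIntegral hK] at halias
  have htri := norm_sub_le_norm_sub_add_norm_sub
    (∫ θ in (-(1 / 2) : ℝ)..(1 / 2), sampleSeries K θ * oscIntegral (2 * Real.pi * K * θ) X)
    (∫ θ in (-(1 / 2) : ℝ)..(1 / 2), ((√(2 * Real.pi) * K : ℝ) : ℂ) *
      (((Real.exp (-(2 * Real.pi ^ 2 * K ^ 2) * θ ^ 2) : ℝ) : ℂ) *
          (1 - Complex.exp (Complex.I * (2 * Real.pi * K * X : ℝ) * θ))))
    ((1 - Real.exp (-(X ^ 2) / 2) : ℝ) : ℂ)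
  have := Real.exp_pos (-(K : ℝ) ^ 2)
  linarith

/-! ### From the infinite to the finite grid -/

/-- Riemann sums on the symmetric grid of `2 M` points of `[-1/2, 1/2]` converge uniformly in a
compact range of parameters. -/
theorem exists_riemann_sum_close {f : ℝ × ℝ → ℂ} (hf : Continuous f) (σ : ℝ) {η : ℝ} (hη : 0 < η) :
    ∃ M₀ : ℕ, ∀ M : ℕ, M₀ ≤ M → ∀ lam : ℝ, |lam| ≤ σ →
      ‖((2 * M : ℕ) : ℂ)⁻¹ * ∑ l ∈ Finset.range (2 * M), f (lam, ((l : ℝ) - M) / (2 * M : ℕ))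
        - ∫ θ in (-(1 / 2) : ℝ)..(1 / 2), f (lam, θ)‖ ≤ η := by
  have hcomp : IsCompact (Set.Icc (-σ) σ ×ˢ Set.Icc (-(1 / 2) : ℝ) (1 / 2)) :=
    isCompact_Icc.prod isCompact_Icc
  have hunif := hcomp.uniformContinuousOn_of_continuous hf.continuousOn
  obtain ⟨d, hd, hclose⟩ := Metric.uniformContinuousOn_iff.1 hunif η hη
  obtain ⟨M₀, hM₀⟩ := exists_nat_gt (1 / d)
  refine ⟨M₀ + 1, fun M hM lam hlam => ?_⟩
  set N : ℕ := 2 * M with hN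
  have hM0 : 0 < M := by omega
  have hMr : (0 : ℝ) < M := by exact_mod_cast hM0
  have hNr : (0 : ℝ) < N := by rw [hN]; push_cast; linarith
  have hNM : (N : ℝ) = 2 * M := by rw [hN]; push_cast; ring
  have hNd : 1 / (N : ℝ) < d := by
    have h1 : (M₀ : ℝ) < M := by exact_mod_cast hM
    rw [div_lt_iff₀ hNr]
    rw [div_lt_iff₀ hd] at hM₀
    nlinarith
  set g : ℕ → ℝ := fun l => ((l : ℝ) - M) / N with hg
  have hstep : ∀ l, g (l + 1) - g l = 1 / N := by
    intro l; simp only [hg]; push_cast; field_simp; ring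
  have hlamI : lam ∈ Set.Icc (-σ) σ := abs_le.1 hlam
  have hfc : Continuous fun θ => f (lam, θ) := by fun_prop
  have hgI : ∀ l, l ≤ N → g l ∈ Set.Icc (-(1 / 2) : ℝ) (1 / 2) := by
    intro l hl
    have hl' : (l : ℝ) ≤ N := by exact_mod_cast hl
    have hl0 : (0 : ℝ) ≤ l := Nat.cast_nonneg l
    simp only [hg]
    constructor
    · rw [le_div_iff₀ hNr]; linarith
    · rw [div_le_iff₀ hNr]; linarith
  have hsum : ∫ θ in (-(1 / 2) : ℝ)..(1 / 2), f (lam, θ)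
      = ∑ l ∈ Finset.range N, ∫ θ in g l..g (l + 1), f (lam, θ) := by
    rw [intervalIntegral.sum_integral_adjacent_intervals
      fun k _ => hfc.intervalIntegrable _ _]
    congr 1
    · simp only [hg]; rw [hNM]; field_simp; push_cast; ring
    · simp only [hg]; rw [hNM]; field_simp; ring
  rw [hsum, Finset.mul_sum, ← Finset.sum_sub_distrib]
  calc _ ≤ ∑ l ∈ Finset.range N, η * (1 / N) := by
        refine (norm_sum_le _ _).trans (Finset.sum_le_sum fun l hl => ?_)
        have hl' := Finset.mem_range.1 hl
        have hle : g l ≤ g (l + 1) := by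
          have := hstep l
          have : 0 < 1 / (N : ℝ) := by positivity
          linarith
        have hconst : ((N : ℕ) : ℂ)⁻¹ * f (lam, ((l : ℝ) - M) / N)
            = ∫ _ in g l..g (l + 1), f (lam, g l) := by
          rw [intervalIntegral.integral_const, hstep, Complex.real_smul]
          push_cast
          rw [one_div]
        rw [hconst, ← intervalIntegral.integral_sub (continuous_const.intervalIntegrable _ _)
          (hfc.intervalIntegrable _ _)]
        refine (intervalIntegral.norm_integral_le_of_norm_le_const (C := η) fun θ hθ => ?_).trans
          (le_of_eq ?_)
        · rw [Set.uIoc_of_le hle] at hθ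
          have h0 := hgI l hl'.le
          have h1 := hgI (l + 1) hl'
          have hst := hstep l
          rw [← dist_eq_norm]
          refine (hclose (lam, g l) ⟨hlamI, h0⟩ (lam, θ)
            ⟨hlamI, h0.1.trans hθ.1.le, hθ.2.trans h1.2⟩ ?_).le
          rw [Prod.dist_eq, dist_self, max_eq_right dist_nonneg, Real.dist_eq, abs_sub_comm,
            abs_of_pos (sub_pos.2 hθ.1)]
          linarith [hθ.2]
        · rw [hstep, abs_of_pos (by positivity)]
    _ = η := by
        rw [Finset.sum_const, Finset.card_range, nsmul_eq_mul]
        field_simp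

theorem norm_tsum_sub_sum_le {ι : Type*} {f : ι → ℂ} (hf : Summable fun i => ‖f i‖)
    (s : Finset ι) : ‖∑' i, f i - ∑ i ∈ s, f i‖ ≤ ∑' i, ‖f i‖ - ∑ i ∈ s, ‖f i‖ := by
  rw [← hf.of_norm.sum_add_tsum_subtype_compl s, ← hf.sum_add_tsum_subtype_compl s,
    add_sub_cancel_left, add_sub_cancel_left]
  exact norm_tsum_le_tsum_norm (hf.subtype _)

theorem tendsto_sum_Ico_int {f : ℤ → ℝ} (hf : Summable f) :
    Filter.Tendsto (fun M : ℕ => ∑ j ∈ Finset.Ico (-(M : ℤ)) M, f j) Filter.atTop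
      (nhds (∑' j, f j)) := by
  refine hf.hasSum.comp (Filter.tendsto_atTop_finset_of_monotone (fun M M' h => ?_) fun j => ?_)
  · refine Finset.Ico_subset_Ico ?_ ?_ <;> omega
  · exact ⟨j.natAbs + 1, by simp only [Finset.mem_Ico]; omega⟩

theorem sum_range_two_mul_sub (M : ℕ) {E : Type*} [AddCommMonoid E] (f : ℤ → E) :
    ∑ k ∈ Finset.range (2 * M), f ((k : ℤ) - M) = ∑ j ∈ Finset.Ico (-(M : ℤ)) M, f j := by
  refine Finset.sum_bij (fun k _ => (k : ℤ) - M) (fun k hk => ?_) (fun k _ k' _ h => ?_)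
    (fun j hj => ?_) fun _ _ => rfl
  · simp only [Finset.mem_range, Finset.mem_Ico] at hk ⊢; omega
  · omega
  · simp only [Finset.mem_Ico] at hj
    exact ⟨(j + M).toNat, by simp only [Finset.mem_range]; omega, by omega⟩

theorem norm_oscIntegral_le_abs (ω X : ℝ) : ‖oscIntegral ω X‖ ≤ |X| := by
  have := intervalIntegral.norm_integral_le_of_norm_le_const (a := (0 : ℝ)) (b := X) (C := 1)
    (f := fun s : ℝ => Complex.exp (Complex.I * ω * s))
    fun s _ => (norm_exp_I_mul_ofReal ω s).le
  simpa [oscIntegral] using this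

/-- The substitution `s ↦ lam s` moves the eigenvalue from the frequency to the length of the interval,
which makes all error bounds relative to `1 / |lam|`. -/
theorem mul_oscIntegral (lam ω T : ℝ) :
    (lam : ℂ) * oscIntegral (ω * lam) T = oscIntegral ω (lam * T) := by
  have h := intervalIntegral.smul_integral_comp_mul_left (a := 0) (b := T)
    (fun s : ℝ => Complex.exp (Complex.I * ω * s)) lam
  rw [mul_zero] at h
  unfold oscIntegral
  rw [← h, Complex.real_smul]
  congr 1
  refine intervalIntegral.integral_congr fun s _ => ?_
  congr 1; push_cast; ring

namespace Discretization

variable (D : Discretization)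

theorem two_mul_mid_nat : 2 * (D.mid : ℕ) = 2 ^ D.np := by
  have := D.two_mul_mid
  exact_mod_cast this

theorem mu_eq_of_dp {K : ℕ} (hK : 0 < K) (hdp : D.dp = 1 / K) (l : Fin (2 ^ D.np)) :
    D.mu l = 2 * Real.pi * K * ((((l : ℕ) : ℝ) - (D.mid : ℕ)) / (2 * (D.mid : ℕ) : ℕ)) := by
  have hK' : (K : ℝ) ≠ 0 := by exact_mod_cast hK.ne'
  have h := D.mu_mul_dp l
  rw [hdp] at h
  push_cast
  rw [D.two_mul_mid]
  field_simp at h ⊢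
  linarith

/-- The interpolation coefficients, referred to the midpoint `p = 0`, are the samples of the
partial sums of `sampleSeries`. -/
theorem zetaTilde_mul_phase {K : ℕ} (hK : 0 < K) (hdp : D.dp = 1 / K) (l : Fin (2 ^ D.np)) :
    D.zetaTilde l * Complex.exp (Complex.I * (D.mu l : ℝ) * ((Real.pi * D.R : ℝ) : ℂ))
      = ((2 * (D.mid : ℕ) : ℕ) : ℂ)⁻¹ * ∑ j ∈ Finset.Ico (-((D.mid : ℕ) : ℤ)) (D.mid : ℕ),
        ((zeta (j / K) : ℝ) : ℂ) * Complex.exp (-(2 * Real.pi * Complex.I * j *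
          (((((l : ℕ) : ℝ) - (D.mid : ℕ)) / (2 * (D.mid : ℕ) : ℕ) : ℝ) : ℂ))) := by
  have hK' : (K : ℂ) ≠ 0 := by exact_mod_cast hK.ne'
  rw [← sum_range_two_mul_sub, D.two_mul_mid_nat,
    ← Fin.sum_univ_eq_sum_range (fun k : ℕ => ((zeta (((k : ℤ) - ((D.mid : ℕ) : ℤ) : ℤ) / K) : ℝ) : ℂ) *
      Complex.exp (-(2 * Real.pi * Complex.I * ((k : ℤ) - ((D.mid : ℕ) : ℤ) : ℤ) *
        (((((l : ℕ) : ℝ) - (D.mid : ℕ)) / (2 ^ D.np : ℕ) : ℝ) : ℂ)))),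
    zetaTilde, mul_assoc, Finset.sum_mul]
  congr 1
  · push_cast; rw [one_div]
  refine Finset.sum_congr rfl fun k _ => ?_
  have hg : D.grid k = (((k : ℤ) - ((D.mid : ℕ) : ℤ) : ℤ) : ℝ) / K := by
    rw [grid_eq, hdp]; push_cast; ring
  rw [mul_assoc, ← Complex.exp_add, hg]
  congr 2
  have hmu := D.mu_eq_of_dp hK hdp l
  rw [D.two_mul_mid_nat] at hmu
  rw [hmu]
  push_cast
  field_simp
  ring

/-- For a fixed mesh size, the discretized integral over `p`-frequencies approaches its limit when
the number of grid points grows, uniformly in the eigenvalue `lam`. -/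
theorem exists_np_close {K : ℕ} (hK : 0 < K) (σ T : ℝ) (hT : 0 < T) {η : ℝ} (hη : 0 < η) :
    ∃ n₀ : ℕ, ∀ D : Discretization, D.dp = 1 / K → n₀ ≤ D.np → ∀ lam : ℝ, |lam| ≤ σ →
      ‖∑ l, D.zetaTilde l * Complex.exp (Complex.I * (D.mu l : ℝ) * ((Real.pi * D.R : ℝ) : ℂ)) *
          oscIntegral (D.mu l * lam) T
        - ∫ θ in (-(1 / 2) : ℝ)..(1 / 2),
          sampleSeries K θ * oscIntegral (2 * Real.pi * K * θ * lam) T‖ ≤ η := by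
  have hcont : Continuous fun p : ℝ × ℝ =>
      sampleSeries K p.2 * oscIntegral (2 * Real.pi * K * p.2 * p.1) T :=
    ((continuous_sampleSeries hK).comp continuous_snd).mul
      (continuous_oscIntegral.comp
        (by fun_prop : Continuous fun p : ℝ × ℝ => (2 * Real.pi * K * p.2 * p.1, T)))
  obtain ⟨M₁, hM₁⟩ := exists_riemann_sum_close hcont σ (half_pos hη)
  have htail := (tendsto_sum_Ico_int (summable_zeta hK))
  obtain ⟨M₂, hM₂⟩ := Metric.tendsto_atTop.1 htail (η / (2 * T)) (by positivity)
  refine ⟨M₁ + M₂ + 1, fun D hdp hnp lam hlam => ?_⟩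
  set M : ℕ := (D.mid : ℕ) with hM
  have hMlarge : M₁ + M₂ ≤ M := by
    have h1 : D.np - 1 < 2 ^ (D.np - 1) := Nat.lt_two_pow_self
    have h2 : M = 2 ^ (D.np - 1) := rfl
    omega
  have hR := hM₁ M (by omega) lam hlam
  have hTl := hM₂ M (by omega)
  have hMpos : 0 < M := by
    have h2 : M = 2 ^ (D.np - 1) := rfl
    rw [h2]; positivity
  have hNc : ((2 * M : ℕ) : ℝ) ≠ 0 := by exact_mod_cast (by omega : 2 * M ≠ 0)
  set θl : ℕ → ℝ := fun l => ((l : ℝ) - M) / (2 * M : ℕ) with hθl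
  have hcast : ∀ g : ℕ → ℂ, ∑ l : Fin (2 ^ D.np), g l = ∑ l ∈ Finset.range (2 * M), g l := by
    intro g
    rw [Fin.sum_univ_eq_sum_range g, D.two_mul_mid_nat]
  -- truncating the sample series: each of the `2 M` summands carries the weight `1 / (2 M)`
  have hmid : ‖∑ l, D.zetaTilde l *
        Complex.exp (Complex.I * (D.mu l : ℝ) * ((Real.pi * D.R : ℝ) : ℂ)) *
          oscIntegral (D.mu l * lam) T
      - ((2 * M : ℕ) : ℂ)⁻¹ * ∑ l ∈ Finset.range (2 * M),
        sampleSeries K (θl l) * oscIntegral (2 * Real.pi * K * θl l * lam) T‖ ≤ η / 2 := by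
    rw [← hcast fun l => sampleSeries K (θl l) * oscIntegral (2 * Real.pi * K * θl l * lam) T,
      Finset.mul_sum, ← Finset.sum_sub_distrib]
    calc _ ≤ ∑ l : Fin (2 ^ D.np), ((2 * M : ℕ) : ℝ)⁻¹ * (η / (2 * T) * T) := by
          refine (norm_sum_le _ _).trans (Finset.sum_le_sum fun l _ => ?_)
          rw [D.zetaTilde_mul_phase hK hdp l, D.mu_eq_of_dp hK hdp l, mul_assoc, ← mul_sub,
            ← sub_mul, norm_mul, norm_mul, norm_inv, Complex.norm_natCast]
          refine mul_le_mul_of_nonneg_left ?_ (by positivity)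
          refine mul_le_mul ?_ ?_ (norm_nonneg _) (by positivity)
          · rw [norm_sub_rev]
            have hsum : Summable fun j : ℤ => ‖((zeta (j / K) : ℝ) : ℂ) *
                Complex.exp (-(2 * Real.pi * Complex.I * j * (θl l : ℝ)))‖ := by
              simpa only [norm_sampleSeries_term] using summable_zeta hK
            refine (norm_tsum_sub_sum_le hsum _).trans ?_
            simp only [norm_sampleSeries_term]
            rw [Real.dist_eq, abs_sub_comm] at hTl
            exact (le_abs_self _).trans hTl.le
          · exact (norm_oscIntegral_le_abs _ _).trans (abs_of_pos hT).le
      _ = η / 2 := by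
          rw [Finset.sum_const, Finset.card_univ, Fintype.card_fin, nsmul_eq_mul,
            ← D.two_mul_mid_nat, ← hM]
          field_simp
  have htri := norm_sub_le_norm_sub_add_norm_sub
    (∑ l, D.zetaTilde l *
        Complex.exp (Complex.I * (D.mu l : ℝ) * ((Real.pi * D.R : ℝ) : ℂ)) *
          oscIntegral (D.mu l * lam) T)
    (((2 * M : ℕ) : ℂ)⁻¹ * ∑ l ∈ Finset.range (2 * M),
        sampleSeries K (θl l) * oscIntegral (2 * Real.pi * K * θl l * lam) T)
    (∫ θ in (-(1 / 2) : ℝ)..(1 / 2),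
          sampleSeries K θ * oscIntegral (2 * Real.pi * K * θ * lam) T)
  linarith

/-- The scalar function that the linear combination of evolutions, read out at `p = 0`, applies to
the eigenvalues of `A`. -/
def response (lam : ℝ) : ℂ :=
  ∑ l, D.zetaTilde l * Complex.exp (Complex.I * (D.mu l : ℝ) * ((Real.pi * D.R : ℝ) : ℂ)) *
    ∑ j, (D.alpha j : ℂ) * Complex.exp (Complex.I * ((D.mu l * lam : ℝ) : ℂ) * D.time j)

/-- The response approximates `1 / lam`, with a relative error from truncating the time integral
and sampling in `p`, and an absolute one from the finite grid and the quadrature. -/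
theorem norm_response_sub_inv_le {K : ℕ} (hK : 0 < K) {η lam : ℝ} (hlam : lam ≠ 0)
    (hgrid : ‖∑ l, D.zetaTilde l *
          Complex.exp (Complex.I * (D.mu l : ℝ) * ((Real.pi * D.R : ℝ) : ℂ)) *
          oscIntegral (D.mu l * lam) D.T
        - ∫ θ in (-(1 / 2) : ℝ)..(1 / 2),
          sampleSeries K θ * oscIntegral (2 * Real.pi * K * θ * lam) D.T‖ ≤ η)
    (hτ : ∀ l, |D.mu l * lam| * D.tau ≤ 1) :
    ‖D.response lam - (lam : ℂ)⁻¹‖ ≤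
      (Real.exp (-((lam * D.T) ^ 2) / 2) + 400 * Real.exp (-(K : ℝ) ^ 2)) / |lam|
        + η + (∑ k, |zeta (D.grid k)|) * (4 * D.T / (2 * D.Q).factorial) := by
  have hlc : (lam : ℂ) ≠ 0 := by exact_mod_cast hlam
  set G := ∑ l, D.zetaTilde l *
          Complex.exp (Complex.I * (D.mu l : ℝ) * ((Real.pi * D.R : ℝ) : ℂ)) *
          oscIntegral (D.mu l * lam) D.T with hG
  set I := ∫ θ in (-(1 / 2) : ℝ)..(1 / 2),
          sampleSeries K θ * oscIntegral (2 * Real.pi * K * θ * lam) D.T with hI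
  have h1 : ‖D.response lam - G‖ ≤
      (∑ k, |zeta (D.grid k)|) * (4 * D.T / (2 * D.Q).factorial) := by
    rw [response, hG, ← Finset.sum_sub_distrib]
    refine (norm_sum_le _ _).trans ?_
    have hT := D.T_pos
    refine le_trans ?_ (mul_le_mul_of_nonneg_right D.sum_norm_zetaTilde_le (by positivity))
    rw [Finset.sum_mul]
    refine Finset.sum_le_sum fun l _ => ?_
    rw [← mul_sub, norm_mul, norm_mul, norm_exp_I_mul_ofReal, mul_one]
    exact mul_le_mul_of_nonneg_left (D.composite_error _ (hτ l)) (norm_nonneg _)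
  -- `lam * I` is the interpolated integral of `ζ` over `[0, lam T]`
  have h2 : ‖I - (lam : ℂ)⁻¹‖ ≤
      (Real.exp (-((lam * D.T) ^ 2) / 2) + 400 * Real.exp (-(K : ℝ) ^ 2)) / |lam| := by
    have h3 := interpolation_error hK (lam * D.T)
    have h4 : (lam : ℂ) * I = ∫ θ in (-(1 / 2) : ℝ)..(1 / 2),
        sampleSeries K θ * oscIntegral (2 * Real.pi * K * θ) (lam * D.T) := by
      rw [hI, ← intervalIntegral.integral_const_mul]
      refine intervalIntegral.integral_congr fun θ _ => ?_
      rw [← mul_oscIntegral]; ring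
    rw [← h4] at h3
    have h5 : I - (lam : ℂ)⁻¹ = ((lam * I - ((1 - Real.exp (-((lam * D.T) ^ 2) / 2) : ℝ) : ℂ))
        - ((Real.exp (-((lam * D.T) ^ 2) / 2) : ℝ) : ℂ)) / lam := by
      push_cast; field_simp; ring
    rw [h5, norm_div, Complex.norm_real, Real.norm_eq_abs]
    refine div_le_div_of_nonneg_right ((norm_sub_le _ _).trans ?_) (abs_nonneg _)
    rw [Complex.norm_real, Real.norm_of_nonneg (Real.exp_pos _).le]
    linarith
  have t1 := norm_sub_le_norm_sub_add_norm_sub (D.response lam) G (lam : ℂ)⁻¹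
  have t2 := norm_sub_le_norm_sub_add_norm_sub G I (lam : ℂ)⁻¹
  linarith

theorem sum_abs_zeta_grid_le {K : ℕ} (hK : 0 < K) (hdp : D.dp = 1 / K) :
    ∑ k, |zeta (D.grid k)| ≤ Real.exp 2 * (2 * ((K : ℝ) + 1)) := by
  refine le_trans ?_ (tsum_zeta_le hK)
  have h1 : ∑ k, |zeta (D.grid k)|
      = ∑ j ∈ Finset.Ico (-((D.mid : ℕ) : ℤ)) (D.mid : ℕ), |zeta (j / K)| := by
    rw [← sum_range_two_mul_sub, D.two_mul_mid_nat, ← Fin.sum_univ_eq_sum_range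
      (fun k : ℕ => |zeta (((k : ℤ) - ((D.mid : ℕ) : ℤ) : ℤ) / K)|)]
    refine Finset.sum_congr rfl fun k _ => ?_
    rw [grid_eq, hdp]
    congr 2; push_cast; ring
  rw [h1]
  exact (summable_zeta hK).sum_le_tsum _ fun _ _ => abs_nonneg _

theorem abs_zeta_le_one (p : ℝ) : |zeta p| ≤ 1 := by
  unfold zeta
  rw [abs_mul, Real.abs_exp, ← le_div_iff₀ (Real.exp_pos _), one_div, ← Real.exp_neg]
  have := Real.add_one_le_exp (-(-(p ^ 2) / 2))
  nlinarith [sq_nonneg (|p| - 1), sq_abs p]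

theorem norm_zetaVec_sq_le {K : ℕ} (hK : 0 < K) (hdp : D.dp = 1 / K) :
    ‖D.zetaVec‖ ^ 2 ≤ Real.exp 2 * (2 * ((K : ℝ) + 1)) := by
  refine le_trans ?_ (D.sum_abs_zeta_grid_le hK hdp)
  rw [EuclideanSpace.norm_sq_eq]
  refine Finset.sum_le_sum fun k _ => ?_
  simp only [zetaVec, Real.norm_eq_abs]
  have := abs_zeta_le_one (D.grid k)
  nlinarith [abs_nonneg (zeta (D.grid k))]

/-- The grid point `p = 1` keeps the norm of `ζ` away from `0`. -/
theorem exp_le_norm_zetaVec {K : ℕ} (hK : 0 < K) (hdp : D.dp = 1 / K) (hnp : K < D.np) :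
    Real.exp (-1 / 2) ≤ ‖D.zetaVec‖ := by
  have hM : K < (D.mid : ℕ) := by
    have h1 : D.np - 1 < 2 ^ (D.np - 1) := Nat.lt_two_pow_self
    have h2 : (D.mid : ℕ) = 2 ^ (D.np - 1) := rfl
    omega
  have hN := D.two_mul_mid_nat
  have h := PiLp.norm_apply_le D.zetaVec ⟨(D.mid : ℕ) + K, by omega⟩
  have hK' : (K : ℝ) ≠ 0 := by exact_mod_cast hK.ne'
  have hg : D.grid ⟨(D.mid : ℕ) + K, by omega⟩ = 1 := by
    rw [grid_eq, hdp]; push_cast; field_simp; ring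
  simp only [zetaVec, hg] at h ⊢
  refine le_trans (le_of_eq ?_) h
  rw [zeta, one_mul, Real.norm_of_nonneg (Real.exp_pos _).le]
  norm_num

end Discretization

/-! ### Spectral calculus -/

theorem mulVec_le_specNorm {ι : Type} [Fintype ι] [DecidableEq ι] (A : Matrix ι ι ℂ) (v : ι → ℂ) :
    ‖WithLp.toLp 2 (A *ᵥ v)‖ ≤ specNorm A * ‖WithLp.toLp 2 v‖ := by
  rw [← Matrix.toEuclideanCLM_toLp]
  exact ContinuousLinearMap.le_opNorm _ _

theorem specNorm_le {ι : Type} [Fintype ι] [DecidableEq ι] (A : Matrix ι ι ℂ) {c : ℝ} (hc : 0 ≤ c)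
    (h : ∀ v : ι → ℂ, ‖WithLp.toLp 2 (A *ᵥ v)‖ ≤ c * ‖WithLp.toLp 2 v‖) : specNorm A ≤ c := by
  refine ContinuousLinearMap.opNorm_le_bound _ hc fun v => ?_
  have := h v.ofLp
  rwa [← Matrix.toEuclideanCLM_toLp] at this

theorem specNorm_nonneg {ι : Type} [Fintype ι] [DecidableEq ι] (A : Matrix ι ι ℂ) :
    0 ≤ specNorm A := norm_nonneg _

theorem norm_toLp_smul {ι : Type} [Fintype ι] (c : ℂ) (v : ι → ℂ) :
    ‖WithLp.toLp 2 (c • v)‖ = ‖c‖ * ‖WithLp.toLp 2 v‖ := by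
  rw [WithLp.toLp_smul, norm_smul]

/-- A unitary matrix preserves the Euclidean norm. -/
theorem norm_toLp_mulVec_of_star_mul {ι : Type} [Fintype ι] [DecidableEq ι] {W : Matrix ι ι ℂ}
    (hW : Wᴴ * W = 1) (v : ι → ℂ) : ‖WithLp.toLp 2 (W *ᵥ v)‖ = ‖WithLp.toLp 2 v‖ := by
  have hdot : ∀ w : ι → ℂ, star w ⬝ᵥ w = ((‖WithLp.toLp 2 w‖ ^ 2 : ℝ) : ℂ) := by
    intro w
    rw [dotProduct, EuclideanSpace.norm_sq_eq]
    push_cast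
    exact Finset.sum_congr rfl fun k _ => by
      rw [Pi.star_apply, Complex.star_def, Complex.conj_mul']
  have h1 : star (W *ᵥ v) ⬝ᵥ (W *ᵥ v) = star v ⬝ᵥ v := by
    rw [Matrix.star_mulVec, ← Matrix.dotProduct_mulVec, Matrix.mulVec_mulVec, hW,
      Matrix.one_mulVec]
  rw [hdot, hdot] at h1
  have h2 := Complex.ofReal_injective h1
  exact (sq_eq_sq₀ (norm_nonneg _) (norm_nonneg _)).1 h2

theorem isHermitian_diagonalization {ι : Type} [Fintype ι] [DecidableEq ι] {A : Matrix ι ι ℂ}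
    (hA : A.IsHermitian) : ∃ (W : Matrix ι ι ℂ) (lam : ι → ℝ), Wᴴ * W = 1 ∧
      A = W * Matrix.diagonal (fun i => ((lam i : ℝ) : ℂ)) * Wᴴ := by
  refine ⟨hA.eigenvectorUnitary.1, hA.eigenvalues,
    Matrix.mem_unitaryGroup_iff'.1 hA.eigenvectorUnitary.2, ?_⟩
  have h := hA.spectral_theorem
  rw [Unitary.conjStarAlgAut_apply] at h
  exact h

/-- `W diag(f) Wᴴ v`, the function with values `f i` on the eigenvalues applied to `v`. -/
def applyFun {ι : Type} [Fintype ι] (W : Matrix ι ι ℂ) (f : ι → ℂ) (v : ι → ℂ) : ι → ℂ :=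
  W *ᵥ fun i => f i * (Wᴴ *ᵥ v) i

theorem applyFun_sub {ι : Type} [Fintype ι] (W : Matrix ι ι ℂ) (f g : ι → ℂ) (v : ι → ℂ) :
    applyFun W f v - applyFun W g v = applyFun W (f - g) v := by
  unfold applyFun
  rw [← Matrix.mulVec_sub]
  congr 1; ext i
  simp [sub_mul]

section Diagonalization

variable {ι : Type} [Fintype ι] [DecidableEq ι] {A W : Matrix ι ι ℂ} {lam : ι → ℝ}

theorem diagonalization_col (hW : Wᴴ * W = 1)
    (hA : A = W * Matrix.diagonal (fun i => ((lam i : ℝ) : ℂ)) * Wᴴ) (i : ι) :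
    A *ᵥ (W *ᵥ Pi.single i 1) = ((lam i : ℝ) : ℂ) • (W *ᵥ Pi.single i 1) := by
  rw [Matrix.mulVec_mulVec, hA, Matrix.mul_assoc, hW, Matrix.mul_one, ← Matrix.mulVec_mulVec,
    ← Matrix.mulVec_smul]
  congr 1
  ext j
  rw [Matrix.mulVec_diagonal]
  rcases eq_or_ne j i with rfl | h
  · simp
  · simp [h]

theorem norm_diagonalization_col (hW : Wᴴ * W = 1) (i : ι) :
    ‖WithLp.toLp 2 (W *ᵥ (Pi.single i 1 : ι → ℂ))‖ = 1 := by
  rw [norm_toLp_mulVec_of_star_mul hW]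
  have : WithLp.toLp 2 (Pi.single i (1 : ℂ)) = EuclideanSpace.single i (1 : ℂ) := rfl
  rw [this]
  simp

theorem abs_eigenvalue_le (hW : Wᴴ * W = 1)
    (hA : A = W * Matrix.diagonal (fun i => ((lam i : ℝ) : ℂ)) * Wᴴ) (i : ι) :
    |lam i| ≤ specNorm A := by
  have h := mulVec_le_specNorm A (W *ᵥ Pi.single i 1)
  rw [diagonalization_col hW hA, norm_toLp_smul, norm_diagonalization_col hW, mul_one, mul_one,
    Complex.norm_real] at h
  exact h

theorem one_le_abs_eigenvalue_mul (hW : Wᴴ * W = 1)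
    (hA : A = W * Matrix.diagonal (fun i => ((lam i : ℝ) : ℂ)) * Wᴴ) (hu : IsUnit A) (i : ι) :
    1 ≤ |lam i| * specNorm A⁻¹ := by
  have h := mulVec_le_specNorm A⁻¹ (A *ᵥ (W *ᵥ Pi.single i 1))
  rw [Matrix.mulVec_mulVec, Matrix.nonsing_inv_mul _ ((Matrix.isUnit_iff_isUnit_det A).1 hu),
    Matrix.one_mulVec, diagonalization_col hW hA, norm_toLp_smul, norm_diagonalization_col hW,
    mul_one, Complex.norm_real, Real.norm_eq_abs] at h
  linarith

theorem inv_diagonalization (hW : Wᴴ * W = 1)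
    (hA : A = W * Matrix.diagonal (fun i => ((lam i : ℝ) : ℂ)) * Wᴴ) (h0 : ∀ i, lam i ≠ 0) :
    A⁻¹ = W * Matrix.diagonal (fun i => ((lam i : ℝ) : ℂ)⁻¹) * Wᴴ := by
  refine Matrix.inv_eq_right_inv ?_
  have hW' : W * Wᴴ = 1 := mul_eq_one_comm.1 hW
  have h1 : Matrix.diagonal (fun i => ((lam i : ℝ) : ℂ)) *
      Matrix.diagonal (fun i => ((lam i : ℝ) : ℂ)⁻¹) = 1 := by
    rw [Matrix.diagonal_mul_diagonal, ← Matrix.diagonal_one]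
    congr 1; ext i
    exact mul_inv_cancel₀ (by exact_mod_cast h0 i)
  calc A * (W * Matrix.diagonal (fun i => ((lam i : ℝ) : ℂ)⁻¹) * Wᴴ)
      = W * (Matrix.diagonal (fun i => ((lam i : ℝ) : ℂ)) * (Wᴴ * W) *
        Matrix.diagonal (fun i => ((lam i : ℝ) : ℂ)⁻¹)) * Wᴴ := by
        rw [hA]; simp only [Matrix.mul_assoc]
    _ = 1 := by rw [hW, Matrix.mul_one, h1, Matrix.mul_one, hW']

theorem mul_diagonal_mulVec (f : ι → ℂ) (v : ι → ℂ) :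
    (W * Matrix.diagonal f * Wᴴ) *ᵥ v = applyFun W f v := by
  rw [← Matrix.mulVec_mulVec, ← Matrix.mulVec_mulVec]
  unfold applyFun
  congr 1; ext i
  rw [Matrix.mulVec_diagonal]

/-- A pointwise mixed relative and absolute error of a function of `A` gives the corresponding error
of the vectors. -/
theorem norm_applyFun_sq_le (hW : Wᴴ * W = 1) (v : ι → ℂ) {f g : ι → ℂ} {r q : ℝ}
    (h : ∀ i, ‖f i‖ ≤ r * ‖g i‖ + q) :
    ‖WithLp.toLp 2 (applyFun W f v)‖ ^ 2 ≤
      2 * r ^ 2 * ‖WithLp.toLp 2 (applyFun W g v)‖ ^ 2 + 2 * q ^ 2 * ‖WithLp.toLp 2 v‖ ^ 2 := by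
  have hWs : (Wᴴ)ᴴ * Wᴴ = 1 := by
    rw [Matrix.conjTranspose_conjTranspose]; exact mul_eq_one_comm.1 hW
  have hv := norm_toLp_mulVec_of_star_mul hWs v
  unfold applyFun
  rw [norm_toLp_mulVec_of_star_mul hW, norm_toLp_mulVec_of_star_mul hW, ← hv]
  simp only [EuclideanSpace.norm_sq_eq, Finset.mul_sum, norm_mul, mul_pow]
  rw [← Finset.sum_add_distrib]
  refine Finset.sum_le_sum fun i _ => ?_
  have h1 : ‖f i‖ ^ 2 ≤ 2 * r ^ 2 * ‖g i‖ ^ 2 + 2 * q ^ 2 := by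
    have h2 : ‖f i‖ ^ 2 ≤ (r * ‖g i‖ + q) ^ 2 := pow_le_pow_left₀ (norm_nonneg _) (h i) 2
    nlinarith [sq_nonneg (r * ‖g i‖ - q)]
  nlinarith [mul_le_mul_of_nonneg_right h1 (sq_nonneg ‖(Wᴴ *ᵥ v) i‖)]

end Diagonalization

theorem kronecker_mulVec_product {ι κ : Type*} [Fintype ι] [Fintype κ] (A : Matrix ι ι ℂ)
    (B : Matrix κ κ ℂ) (f : ι → ℂ) (g : κ → ℂ) :
    (A ⊗ₖ B) *ᵥ (fun p => f p.1 * g p.2) = fun p => (A *ᵥ f) p.1 * (B *ᵥ g) p.2 := by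
  ext p
  simp only [Matrix.mulVec, dotProduct, Matrix.kroneckerMap_apply, Fintype.sum_prod_type,
    Finset.sum_mul_sum]
  exact Finset.sum_congr rfl fun i _ => Finset.sum_congr rfl fun j _ => by ring

theorem one_kronecker_mulVec_apply {ι κ : Type*} [Fintype ι] [Fintype κ] [DecidableEq ι]
    (B : Matrix κ κ ℂ) (v : ι × κ → ℂ) (p : ι × κ) :
    (((1 : Matrix ι ι ℂ) ⊗ₖ B) *ᵥ v) p = (B *ᵥ fun k => v (p.1, k)) p.2 := by
  simp only [Matrix.mulVec, dotProduct, Matrix.kroneckerMap_apply, Fintype.sum_prod_type,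
    Matrix.one_apply, ite_mul, one_mul, zero_mul]
  rw [Finset.sum_eq_single p.1]
  · simp
  · intro i _ hi; simp [hi.symm]
  · simp

theorem diagonal_kronecker_mulVec_apply {ι κ : Type*} [Fintype ι] [Fintype κ] [DecidableEq ι]
    (d : ι → ℂ) (B : Matrix κ κ ℂ) (v : ι × κ → ℂ) (p : ι × κ) :
    ((Matrix.diagonal d ⊗ₖ B) *ᵥ v) p = d p.1 * (B *ᵥ fun k => v (p.1, k)) p.2 := by
  simp only [Matrix.mulVec, dotProduct, Matrix.kroneckerMap_apply, Fintype.sum_prod_type,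
    Matrix.diagonal_apply, ite_mul, zero_mul]
  rw [Finset.sum_eq_single p.1]
  · simp [Finset.mul_sum, mul_assoc]
  · intro i _ hi; simp [hi.symm]
  · simp

namespace Discretization

variable (D : Discretization) {n : ℕ} {A W : Matrix (Fin (2 ^ n)) (Fin (2 ^ n)) ℂ}
  {lam : Fin (2 ^ n) → ℝ}

theorem hamiltonian_diagonalization
    (hA : A = W * Matrix.diagonal (fun i => ((lam i : ℝ) : ℂ)) * Wᴴ) :
    D.hamiltonian A = ((1 : Matrix (Fin (2 ^ D.np)) (Fin (2 ^ D.np)) ℂ) ⊗ₖ W) *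
      Matrix.diagonal (fun p => ((D.mu p.1 : ℝ) : ℂ) * ((lam p.2 : ℝ) : ℂ)) *
        ((1 : Matrix (Fin (2 ^ D.np)) (Fin (2 ^ D.np)) ℂ) ⊗ₖ W)ᴴ := by
  rw [hamiltonian, Dmu, hA, Matrix.conjTranspose_kronecker, Matrix.conjTranspose_one,
    ← Matrix.diagonal_kronecker_diagonal (fun l => ((D.mu l : ℝ) : ℂ))
      (fun i => ((lam i : ℝ) : ℂ)), ← Matrix.mul_kronecker_mul, ← Matrix.mul_kronecker_mul,
    Matrix.one_mul, Matrix.mul_one]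

/-- The evolution is diagonal in the eigenbasis of `A` and in the frequency. -/
theorem evolution_mulVec (hW : Wᴴ * W = 1)
    (hA : A = W * Matrix.diagonal (fun i => ((lam i : ℝ) : ℂ)) * Wᴴ) (t : ℝ)
    (c : Fin (2 ^ D.np) → ℂ) (v : Fin (2 ^ n) → ℂ) (p : Fin (2 ^ D.np) × Fin (2 ^ n)) :
    (D.evolution A t *ᵥ fun p => c p.1 * v p.2) p
      = c p.1 * applyFun W (fun i => Complex.exp (Complex.I * ((D.mu p.1 * lam i : ℝ) : ℂ) * t)) v
        p.2 := by
  set X := (1 : Matrix (Fin (2 ^ D.np)) (Fin (2 ^ D.np)) ℂ) ⊗ₖ W with hX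
  have hXX : X * Xᴴ = 1 := by
    rw [hX, Matrix.conjTranspose_kronecker, Matrix.conjTranspose_one, ← Matrix.mul_kronecker_mul,
      mul_eq_one_comm.1 hW, Matrix.one_mul, Matrix.one_kronecker_one]
  have hXinv : Xᴴ = X⁻¹ := (Matrix.inv_eq_right_inv hXX).symm
  have hXu : IsUnit X := IsUnit.of_mul_eq_one _ hXX
  set d : Fin (2 ^ D.np) × Fin (2 ^ n) → ℂ :=
    fun p => ((D.mu p.1 : ℝ) : ℂ) * ((lam p.2 : ℝ) : ℂ) with hd
  have h1 : (Complex.I * (t : ℂ)) • D.hamiltonian A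
      = X * Matrix.diagonal ((Complex.I * (t : ℂ)) • d) * X⁻¹ := by
    rw [D.hamiltonian_diagonalization hA, ← hX, ← hXinv, Matrix.diagonal_smul, Matrix.mul_smul,
      Matrix.smul_mul]
  rw [evolution, h1, Matrix.exp_conj _ _ hXu, Matrix.exp_diagonal, ← hXinv, hX,
    Matrix.conjTranspose_kronecker, Matrix.conjTranspose_one, ← Matrix.mulVec_mulVec,
    ← Matrix.mulVec_mulVec, kronecker_mulVec_product, Matrix.one_mulVec, one_kronecker_mulVec_apply]
  unfold applyFun
  rw [← smul_eq_mul (c p.1), ← Pi.smul_apply, ← Matrix.mulVec_smul]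
  congr 2
  ext i
  rw [Matrix.mulVec_diagonal, Pi.coe_exp]
  simp only [Pi.smul_apply, smul_eq_mul, hd, ← Complex.exp_eq_exp_ℂ]
  push_cast
  rw [show Complex.I * (t : ℂ) * ((D.mu p.1 : ℂ) * (lam i : ℂ))
    = Complex.I * ((D.mu p.1 : ℂ) * (lam i : ℂ)) * t by ring]
  ring

theorem abs_mu_le (l : Fin (2 ^ D.np)) : |D.mu l| ≤ Real.pi / D.dp := by
  have hR := D.R_pos
  have hpi := Real.pi_pos
  have hN : (0 : ℝ) < 2 ^ D.np := by positivity
  have hdp : 0 < D.dp := by unfold dp; positivity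
  have h1 := D.mu_mul_dp l
  have h2 := D.two_mul_mid
  have hl : ((l : ℕ) : ℝ) ≤ 2 ^ D.np := by exact_mod_cast l.2.le
  have hl0 : (0 : ℝ) ≤ ((l : ℕ) : ℝ) := Nat.cast_nonneg _
  rw [le_div_iff₀ hdp, ← abs_of_pos hdp, ← abs_mul, h1, abs_div, abs_of_pos hN, div_le_iff₀ hN,
    abs_mul, abs_of_pos (by positivity : 0 < 2 * Real.pi)]
  have h3 : |((l : ℕ) : ℝ) - (D.mid : ℕ)| ≤ (D.mid : ℕ) := by
    rw [abs_le]; constructor <;> linarith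
  rw [← h2]
  nlinarith

theorem abs_mu_zero : |D.mu 0| = Real.pi / D.dp := by
  have hR := D.R_pos
  have hpi := Real.pi_pos
  have hN : (0 : ℝ) < 2 ^ D.np := by positivity
  have hdp : 0 < D.dp := by unfold dp; positivity
  have h1 := D.mu_mul_dp 0
  have h2 := D.two_mul_mid
  rw [eq_div_iff hdp.ne', ← abs_of_pos hdp, ← abs_mul, h1, ← h2]
  have hm : (0 : ℝ) < (D.mid : ℕ) := by linarith
  rw [Fin.val_zero, Nat.cast_zero, zero_sub, abs_div, mul_neg, abs_neg,
    abs_of_pos (by positivity), abs_of_pos (by positivity)]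
  field_simp

/-- `‖D_μ ⊗ A‖ = max_l |μ_l| ‖A‖`, and the largest frequency is `π / Δp`. -/
theorem specNorm_hamiltonian (A : Matrix (Fin (2 ^ n)) (Fin (2 ^ n)) ℂ) :
    specNorm (D.hamiltonian A) = Real.pi / D.dp * specNorm A := by
  have hR := D.R_pos
  have hpi := Real.pi_pos
  have hdp : 0 < D.dp := by unfold dp; positivity
  have hm : 0 < Real.pi / D.dp := by positivity
  refine le_antisymm (specNorm_le _ (mul_nonneg hm.le (specNorm_nonneg _)) fun v => ?_) ?_
  · refine le_of_sq_le_sq ?_ (by have := specNorm_nonneg A; positivity)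
    rw [mul_pow, EuclideanSpace.norm_sq_eq, EuclideanSpace.norm_sq_eq, Fintype.sum_prod_type,
      Fintype.sum_prod_type, Finset.mul_sum]
    refine Finset.sum_le_sum fun l _ => ?_
    have h1 := mulVec_le_specNorm A fun i => v (l, i)
    have h2 := pow_le_pow_left₀ (norm_nonneg _) h1 2
    rw [mul_pow, EuclideanSpace.norm_sq_eq, EuclideanSpace.norm_sq_eq] at h2
    simp only [hamiltonian, Dmu, diagonal_kronecker_mulVec_apply, norm_mul, mul_pow,
      Complex.norm_real, ← Finset.mul_sum] at h2 ⊢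
    have h3 : ‖D.mu l‖ ^ 2 ≤ (Real.pi / D.dp) ^ 2 :=
      pow_le_pow_left₀ (norm_nonneg _) (D.abs_mu_le l) 2
    calc _ ≤ (Real.pi / D.dp) ^ 2 * (specNorm A ^ 2 * ∑ i, ‖v (l, i)‖ ^ 2) := by
          refine mul_le_mul h3 h2 (Finset.sum_nonneg fun _ _ => by positivity) (by positivity)
      _ = _ := by ring
  · rw [← le_div_iff₀' hm]
    refine specNorm_le _ (div_nonneg (specNorm_nonneg _) hm.le) fun v => ?_
    have h1 := mulVec_le_specNorm (D.hamiltonian A)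
      fun p => (Pi.single 0 1 : Fin (2 ^ D.np) → ℂ) p.1 * v p.2
    have hn : ∀ (c : ℂ) (w : Fin (2 ^ n) → ℂ), ‖WithLp.toLp 2 (fun p : Fin (2 ^ D.np) × Fin (2 ^ n) =>
        c * (Pi.single 0 1 : Fin (2 ^ D.np) → ℂ) p.1 * w p.2)‖ = ‖c‖ * ‖WithLp.toLp 2 w‖ := by
      intro c w
      refine (sq_eq_sq₀ (norm_nonneg _) (by positivity)).1 ?_
      rw [mul_pow, EuclideanSpace.norm_sq_eq, EuclideanSpace.norm_sq_eq, Fintype.sum_prod_type,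
        Finset.sum_eq_single 0]
      · simp [mul_pow, Finset.mul_sum]
      · intro l _ hl; simp [hl]
      · simp
    have hD : (Matrix.diagonal fun l => ((D.mu l : ℝ) : ℂ)) *ᵥ (Pi.single 0 1 : Fin (2 ^ D.np) → ℂ)
        = fun l => ((D.mu 0 : ℝ) : ℂ) * (Pi.single 0 1 : Fin (2 ^ D.np) → ℂ) l := by
      ext l
      rw [Matrix.mulVec_diagonal]
      rcases eq_or_ne l 0 with rfl | hl
      · simp
      · simp [hl]
    have h2 := hn 1 v
    simp only [one_mul, norm_one] at h2
    rw [hamiltonian, Dmu, kronecker_mulVec_product, hD, hn, h2, Complex.norm_real,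
      Real.norm_eq_abs, abs_mu_zero] at h1
    rw [div_mul_eq_mul_div, le_div_iff₀' hm]
    exact h1

end Discretization

/-! ### Circuits and amplitude amplification -/

namespace Gate

variable {na np n a : ℕ}

/-- The inverse gate. -/
def inv : Gate na np n a → Gate na np n a
  | free U => free U⁻¹
  | coef b => coef !b
  | sel b => sel !b
  | prep b => prep !b

theorem conjTranspose_orInv {ι : Type} [Fintype ι] [DecidableEq ι]
    (U : Matrix.unitaryGroup ι ℂ) (b : Bool) : orInv U (!b) = (orInv U b)ᴴ := by
  cases b <;> simp [orInv]

theorem toMatrix_inv (O : Oracles na np n) (g : Gate na np n a) :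
    g.inv.toMatrix O = (g.toMatrix O)ᴴ := by
  cases g with
  | free U => rfl
  | _ b => simp [inv, toMatrix, conjTranspose_orInv, Matrix.conjTranspose_kronecker]

theorem orInv_mem {ι : Type} [Fintype ι] [DecidableEq ι]
    (U : Matrix.unitaryGroup ι ℂ) (b : Bool) : orInv U b ∈ Matrix.unitaryGroup ι ℂ := by
  cases b
  · exact U.2
  · exact Unitary.star_mem U.2

theorem toMatrix_mem (O : Oracles na np n) (g : Gate na np n a) :
    g.toMatrix O ∈ Matrix.unitaryGroup (Reg na np n a) ℂ := by
  cases g with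
  | free U => exact U.2
  | coef b =>
    exact Matrix.kronecker_mem_unitary
      (Matrix.kronecker_mem_unitary (orInv_mem O.coef b) (one_mem _)) (one_mem _)
  | sel b => exact Matrix.kronecker_mem_unitary (orInv_mem O.sel b) (one_mem _)
  | prep b =>
    exact Matrix.kronecker_mem_unitary
      (Matrix.kronecker_mem_unitary (one_mem _) (orInv_mem O.prep b)) (one_mem _)

theorem queries_inv (g : Gate na np n a) : g.inv.queries = g.queries := by
  cases g <;> rfl

end Gate

section Circuit

variable {na np n a : ℕ}

/-- The unitary implemented by a list of gates, the head of the list acting first. -/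
def circuitMatrix (O : Oracles na np n) :
    List (Gate na np n a) → Matrix (Reg na np n a) (Reg na np n a) ℂ
  | [] => 1
  | g :: l => circuitMatrix O l * g.toMatrix O

theorem foldl_eq_circuitMatrix (O : Oracles na np n) (l : List (Gate na np n a))
    (ψ : Reg na np n a → ℂ) :
    l.foldl (fun ψ g => g.toMatrix O *ᵥ ψ) ψ = circuitMatrix O l *ᵥ ψ := by
  induction l generalizing ψ with
  | nil => simp [circuitMatrix]
  | cons g l ih => rw [List.foldl_cons, ih, circuitMatrix, Matrix.mulVec_mulVec]

theorem circuitMatrix_append (O : Oracles na np n) (l l' : List (Gate na np n a)) :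
    circuitMatrix O (l ++ l') = circuitMatrix O l' * circuitMatrix O l := by
  induction l with
  | nil => simp [circuitMatrix]
  | cons g l ih => rw [List.cons_append, circuitMatrix, ih, circuitMatrix, Matrix.mul_assoc]

theorem circuitMatrix_singleton (O : Oracles na np n) (g : Gate na np n a) :
    circuitMatrix O [g] = g.toMatrix O := by
  simp [circuitMatrix]

/-- The reversed list of inverse gates. -/
def inverseCircuit (l : List (Gate na np n a)) : List (Gate na np n a) := (l.map Gate.inv).reverse

theorem circuitMatrix_inverse (O : Oracles na np n) (l : List (Gate na np n a)) :
    circuitMatrix O (inverseCircuit l) = (circuitMatrix O l)ᴴ := by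
  induction l with
  | nil => simp [circuitMatrix, inverseCircuit]
  | cons g l ih =>
    rw [inverseCircuit, List.map_cons, List.reverse_cons, circuitMatrix_append,
      circuitMatrix_singleton, ← inverseCircuit, ih, Gate.toMatrix_inv, circuitMatrix,
      Matrix.conjTranspose_mul]

theorem circuitMatrix_mem (O : Oracles na np n) (l : List (Gate na np n a)) :
    circuitMatrix O l ∈ Matrix.unitaryGroup (Reg na np n a) ℂ := by
  induction l with
  | nil => exact one_mem _
  | cons g l ih => exact mul_mem ih (g.toMatrix_mem O)

theorem sum_queries_inverse (l : List (Gate na np n a)) :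
    ((inverseCircuit l).map Gate.queries).sum = (l.map Gate.queries).sum := by
  rw [inverseCircuit, List.map_reverse, List.sum_reverse, List.map_map]
  congr 1
  exact List.map_congr_left fun g _ => g.queries_inv

/-- The unitary that flips the sign of the basis states in `S`. -/
def signFlip {ι : Type} [Fintype ι] [DecidableEq ι] (S : ι → Prop) [DecidablePred S] :
    Matrix.unitaryGroup ι ℂ :=
  ⟨Matrix.diagonal fun x => if S x then -1 else 1, by
    rw [Matrix.mem_unitaryGroup_iff, Matrix.star_eq_conjTranspose, Matrix.diagonal_conjTranspose,
      Matrix.diagonal_mul_diagonal, ← Matrix.diagonal_one]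
    congr 1; ext x
    by_cases h : S x <;> simp [h]⟩

theorem signFlip_mulVec {ι : Type} [Fintype ι] [DecidableEq ι] (S : ι → Prop) [DecidablePred S]
    (v : ι → ℂ) (x : ι) : ((signFlip S).1 *ᵥ v) x = if S x then -v x else v x := by
  simp only [signFlip, Matrix.mulVec_diagonal]
  by_cases h : S x <;> simp [h]

/-- One round of amplitude amplification: flip the sign of the good states, then reflect about the
state prepared by `l`. -/
def amplifyRound (l : List (Gate na np n a)) (S : Reg na np n a → Prop) [DecidablePred S] :
    List (Gate na np n a) :=
  [Gate.free (signFlip S)] ++ inverseCircuit l ++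
    [Gate.free (signFlip fun x => x ≠ ((0, (0, 0)), 0))] ++ l

theorem amplifyRound_mulVec (O : Oracles na np n) (l : List (Gate na np n a))
    (S : Reg na np n a → Prop) [DecidablePred S] (v : Reg na np n a → ℂ) :
    circuitMatrix O (amplifyRound l S) *ᵥ v =
      (2 * (star (circuitMatrix O l *ᵥ Pi.single ((0, (0, 0)), 0) 1) ⬝ᵥ
        fun x => if S x then -v x else v x)) •
        (circuitMatrix O l *ᵥ Pi.single ((0, (0, 0)), 0) 1) -
        fun x => if S x then -v x else v x := by
  set U := circuitMatrix O l with hU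
  have hUU : U * Uᴴ = 1 := Matrix.mem_unitaryGroup_iff.1 (circuitMatrix_mem O l)
  set w : Reg na np n a → ℂ := fun x => if S x then -v x else v x with hw
  have hF : (signFlip S).1 *ᵥ v = w := by ext x; rw [signFlip_mulVec]
  have hZ : ∀ u : Reg na np n a → ℂ,
      (signFlip fun x : Reg na np n a => x ≠ ((0, (0, 0)), 0)).1 *ᵥ u
      = (2 * u ((0, (0, 0)), 0)) • (Pi.single ((0, (0, 0)), 0) 1) - u := by
    intro u; ext x
    rw [signFlip_mulVec]
    by_cases h : x = ((0, (0, 0)), 0)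
    · subst h; simp; ring
    · simp [h]
  rw [amplifyRound, circuitMatrix_append, circuitMatrix_append, circuitMatrix_append,
    circuitMatrix_inverse, circuitMatrix_singleton, circuitMatrix_singleton, ← hU,
    ← Matrix.mulVec_mulVec, ← Matrix.mulVec_mulVec, ← Matrix.mulVec_mulVec, Gate.toMatrix,
    Gate.toMatrix, hF, hZ, Matrix.mulVec_sub, Matrix.mulVec_smul, Matrix.mulVec_mulVec, hUU,
    Matrix.one_mulVec]
  congr 3
  rw [Matrix.star_mulVec, ← Matrix.dotProduct_mulVec, ← Pi.single_star, star_one,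
    single_one_dotProduct]

/-- Preparation followed by `m` rounds of amplification. -/
def amplifiedCircuit (l : List (Gate na np n a)) (S : Reg na np n a → Prop) [DecidablePred S]
    (m : ℕ) : List (Gate na np n a) :=
  l ++ (List.replicate m (amplifyRound l S)).flatten

theorem sum_queries_amplifiedCircuit (l : List (Gate na np n a)) (S : Reg na np n a → Prop)
    [DecidablePred S] (m : ℕ) :
    ((amplifiedCircuit l S m).map Gate.queries).sum
      = (2 * m + 1) * (l.map Gate.queries).sum := by
  have h : ((amplifyRound l S).map Gate.queries).sum = 2 * (l.map Gate.queries).sum := by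
    simp only [amplifyRound, List.map_append, List.sum_append, sum_queries_inverse, List.map_cons,
      List.map_nil, List.sum_cons, List.sum_nil, Gate.queries]
    ring
  have h2 : (((List.replicate m (amplifyRound l S)).flatten).map Gate.queries).sum
      = m * (2 * (l.map Gate.queries).sum) := by
    induction m with
    | zero => simp
    | succ m ih =>
      rw [List.replicate_succ, List.flatten_cons, List.map_append, List.sum_append, ih, h]
      ring
  rw [amplifiedCircuit, List.map_append, List.sum_append, h2]
  ring

/-- Amplitude amplification. If the good part of the prepared state has norm `sin θ`, then after `m`
rounds it is multiplied by `sin ((2 m + 1) θ) / sin θ`. -/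
theorem amplifiedCircuit_good (O : Oracles na np n) (l : List (Gate na np n a))
    (S : Reg na np n a → Prop) [DecidablePred S] {θ : ℝ} (hθ : Real.sin θ ≠ 0)
    (hgood : ∑ x, (if S x then ‖(circuitMatrix O l *ᵥ Pi.single ((0, (0, 0)), 0) 1) x‖ ^ 2 else 0)
      = Real.sin θ ^ 2) (m : ℕ) (x : Reg na np n a) (hx : S x) :
    (circuitMatrix O (amplifiedCircuit l S m) *ᵥ Pi.single ((0, (0, 0)), 0) 1) x
      = ((Real.sin ((2 * m + 1) * θ) / Real.sin θ : ℝ) : ℂ) *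
        (circuitMatrix O l *ᵥ Pi.single ((0, (0, 0)), 0) 1) x := by
  set Ψ := circuitMatrix O l *ᵥ Pi.single ((0, (0, 0)), 0) 1 with hΨ
  have hnorm : ∑ x, ‖Ψ x‖ ^ 2 = 1 := by
    have h1 := norm_toLp_mulVec_of_star_mul
      (Matrix.mem_unitaryGroup_iff'.1 (circuitMatrix_mem O l)) (Pi.single ((0, (0, 0)), 0) 1)
    rw [← hΨ] at h1
    have h2 : WithLp.toLp 2 (Pi.single (((0, (0, 0)), 0) : Reg na np n a) (1 : ℂ))
      = EuclideanSpace.single ((0, (0, 0)), 0) (1 : ℂ) := rfl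
    have h3 := EuclideanSpace.norm_sq_eq (WithLp.toLp 2 Ψ)
    rw [h1, h2] at h3
    simpa using h3.symm
  have hbad : ∑ x, (if S x then 0 else ‖Ψ x‖ ^ 2) = Real.cos θ ^ 2 := by
    have h1 : ∑ x, (if S x then ‖Ψ x‖ ^ 2 else 0) + ∑ x, (if S x then 0 else ‖Ψ x‖ ^ 2)
        = ∑ x, ‖Ψ x‖ ^ 2 := by
      rw [← Finset.sum_add_distrib]
      exact Finset.sum_congr rfl fun x _ => by by_cases h : S x <;> simp [h]
    rw [hgood, hnorm] at h1
    linarith [Real.sin_sq_add_cos_sq θ]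
  -- the state stays in the plane spanned by the good and the bad part of `Ψ`
  have key : ∀ m : ℕ, ∃ α β : ℝ, α * Real.sin θ = Real.sin ((2 * m + 1) * θ) ∧
      β * Real.cos θ = Real.cos ((2 * m + 1) * θ) ∧
      circuitMatrix O (amplifiedCircuit l S m) *ᵥ Pi.single ((0, (0, 0)), 0) 1
        = fun x => if S x then (α : ℂ) * Ψ x else (β : ℂ) * Ψ x := by
    intro m
    induction m with
    | zero =>
      refine ⟨1, 1, by simp, by simp, ?_⟩
      ext x
      simp [amplifiedCircuit, hΨ]
    | succ m ih =>
      obtain ⟨α, β, hα, hβ, hst⟩ := ih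
      have hsucc : amplifiedCircuit l S (m + 1) = amplifiedCircuit l S m ++ amplifyRound l S := by
        simp [amplifiedCircuit, List.replicate_succ']
      have hdot : (star Ψ ⬝ᵥ fun x => if S x then -(if S x then (α : ℂ) * Ψ x else (β : ℂ) * Ψ x)
          else (if S x then (α : ℂ) * Ψ x else (β : ℂ) * Ψ x))
          = ((-α * Real.sin θ ^ 2 + β * Real.cos θ ^ 2 : ℝ) : ℂ) := by
        rw [← hgood, ← hbad, Finset.mul_sum, Finset.mul_sum, ← Finset.sum_add_distrib, dotProduct]
        rw [Complex.ofReal_sum]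
        refine Finset.sum_congr rfl fun x _ => ?_
        have h1 : star (Ψ x) * Ψ x = ((‖Ψ x‖ ^ 2 : ℝ) : ℂ) := by
          rw [Complex.star_def, Complex.conj_mul']; push_cast; rfl
        by_cases h : S x
        · simp only [h, if_true, Pi.star_apply, mul_zero, add_zero]
          rw [Complex.ofReal_mul, ← h1]
          push_cast; ring
        · simp only [h, if_false, Pi.star_apply, mul_zero, zero_add]
          rw [Complex.ofReal_mul, ← h1]
          ring
      have e2 := Real.cos_two_mul θ
      have e2' := Real.sin_two_mul θ
      have e3 := Real.sin_sq_add_cos_sq θ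
      have e4 : Real.cos (2 * θ) = 1 - 2 * Real.sin θ ^ 2 := by rw [e2]; linarith
      have earg : (2 * ((m + 1 : ℕ) : ℝ) + 1) * θ = (2 * m + 1) * θ + 2 * θ := by push_cast; ring
      refine ⟨α + 2 * (-α * Real.sin θ ^ 2 + β * Real.cos θ ^ 2),
        -β + 2 * (-α * Real.sin θ ^ 2 + β * Real.cos θ ^ 2), ?_, ?_, ?_⟩
      · rw [earg, Real.sin_add, ← hα, ← hβ, e4, e2']
        ring
      · rw [earg, Real.cos_add, ← hα, ← hβ, e2, e2']
        ring
      · rw [hsucc, circuitMatrix_append, ← Matrix.mulVec_mulVec, hst, amplifyRound_mulVec, ← hΨ,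
          hdot]
        ext x
        simp only [Pi.sub_apply, Pi.smul_apply, smul_eq_mul]
        by_cases h : S x
        · simp only [h, if_true]; push_cast; ring
        · simp only [h, if_false]; push_cast; ring
  obtain ⟨α, β, hα, -, hst⟩ := key m
  rw [hst, ← hα, mul_div_assoc, div_self hθ, mul_one]
  simp [hx]

end Circuit

/-! ### The linear combination of evolutions -/

theorem kronecker_one_mulVec_apply {ι κ : Type*} [Fintype ι] [Fintype κ] [DecidableEq κ]
    (B : Matrix ι ι ℂ) (v : ι × κ → ℂ) (p : ι × κ) :
    ((B ⊗ₖ (1 : Matrix κ κ ℂ)) *ᵥ v) p = (B *ᵥ fun i => v (i, p.2)) p.1 := by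
  simp only [Matrix.mulVec, dotProduct, Matrix.kroneckerMap_apply, Fintype.sum_prod_type,
    Matrix.one_apply, mul_ite, mul_one, mul_zero, ite_mul, zero_mul]
  refine Finset.sum_congr rfl fun i _ => ?_
  rw [Finset.sum_eq_single p.2]
  · simp
  · intro k _ hk; simp [hk.symm]
  · simp

theorem norm_ket {ι : Type} [Fintype ι] {v : EuclideanSpace ℂ ι} (hv : v ≠ 0) : ‖ket v‖ = 1 := by
  have : ‖v‖ ≠ 0 := norm_ne_zero_iff.2 hv
  rw [ket, norm_smul, Complex.norm_real, norm_inv, norm_norm, inv_mul_cancel₀ this]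

namespace Discretization

variable (D : Discretization)

/-- The inverse Fourier transform on the `p` register, which turns the coefficients of the
interpolant into its values on the grid. -/
def readout (n : ℕ) : Matrix.unitaryGroup (Reg D.na D.np n 0) ℂ :=
  ⟨((1 : Matrix (Fin (2 ^ D.na)) (Fin (2 ^ D.na)) ℂ) ⊗ₖ
      (D.fourier ⊗ₖ (1 : Matrix (Fin (2 ^ n)) (Fin (2 ^ n)) ℂ))) ⊗ₖ
      (1 : Matrix (Fin (2 ^ 0)) (Fin (2 ^ 0)) ℂ),
    Matrix.kronecker_mem_unitary (Matrix.kronecker_mem_unitary (one_mem _)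
      (Matrix.kronecker_mem_unitary D.fourierUnitary.2 (one_mem _))) (one_mem _)⟩

/-- Prepares `∑_j α_j U_j |w̃_h(0)⟩ / ‖α‖₁` in the branch where the index register is `0`, and then
transforms from frequencies to grid points. -/
def lcuCircuit (n : ℕ) : List (Gate D.na D.np n 0) :=
  [Gate.coef false, Gate.prep false, Gate.sel false, Gate.coef true, Gate.free (D.readout n)]

theorem selectMatrix_mulVec_apply {n : ℕ} (A : Matrix (Fin (2 ^ n)) (Fin (2 ^ n)) ℂ)
    (v : Fin (2 ^ D.na) × (Fin (2 ^ D.np) × Fin (2 ^ n)) → ℂ)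
    (p : Fin (2 ^ D.na) × (Fin (2 ^ D.np) × Fin (2 ^ n))) :
    (D.selectMatrix A *ᵥ v) p
      = (D.evolution A (D.time p.1) *ᵥ fun k => v (p.1, k)) p.2 := by
  simp only [selectMatrix, Matrix.sum_mulVec, Finset.sum_apply, ← Matrix.diagonal_single,
    diagonal_kronecker_mulVec_apply]
  rw [Finset.sum_eq_single p.1]
  · simp
  · intro j _ hj; simp [hj.symm]
  · simp

theorem grid_mid : D.grid D.mid = 0 := by rw [grid_eq, sub_self, zero_mul]

theorem norm_initVec {n : ℕ} (b : EuclideanSpace ℂ (Fin (2 ^ n))) :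
    ‖D.initVec b‖ = ‖D.zetaVec‖ / √(2 ^ D.np) * ‖b‖ := by
  have hN : (0 : ℝ) ≤ 2 ^ D.np := by positivity
  refine (sq_eq_sq₀ (norm_nonneg _) (by positivity)).1 ?_
  rw [mul_pow, div_pow, Real.sq_sqrt hN, ← sum_norm_zetaTilde_sq, EuclideanSpace.norm_sq_eq,
    EuclideanSpace.norm_sq_eq, Fintype.sum_prod_type, Finset.sum_mul_sum]
  simp [initVec, mul_pow]

/-- In the branch with index register `0` and `p = 0` the data register carries the function
`response` of `A`, applied to `b` and divided by `‖α‖₁ ‖ζ‖`. -/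
theorem lcuCircuit_good {n : ℕ} {A W : Matrix (Fin (2 ^ n)) (Fin (2 ^ n)) ℂ}
    {lam : Fin (2 ^ n) → ℝ} (hW : Wᴴ * W = 1)
    (hA : A = W * Matrix.diagonal (fun i => ((lam i : ℝ) : ℂ)) * Wᴴ)
    {b : EuclideanSpace ℂ (Fin (2 ^ n))} (hζ : ‖D.zetaVec‖ ≠ 0)
    {O : Oracles D.na D.np n} (hO : O.Implement D A b) (i : Fin (2 ^ n)) :
    (circuitMatrix O (D.lcuCircuit n) *ᵥ Pi.single ((0, (0, 0)), 0) 1) ((0, (D.mid, i)), 0)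
      = (((D.T * ‖D.zetaVec‖)⁻¹ : ℝ) : ℂ) *
        applyFun W (fun i' => D.response (lam i')) (ket b).ofLp i := by
  have hT := D.T_pos
  -- `ψ, …, ψ₄` are the states after `0, …, 4` gates
  set ψ : Reg D.na D.np n 0 → ℂ := Pi.single ((0, (0, 0)), 0) 1 with hψ
  set ψ₁ := (Gate.coef false : Gate D.na D.np n 0).toMatrix O *ᵥ ψ with hψ₁
  set ψ₂ := (Gate.prep false : Gate D.na D.np n 0).toMatrix O *ᵥ ψ₁ with hψ₂
  set ψ₃ := (Gate.sel false : Gate D.na D.np n 0).toMatrix O *ᵥ ψ₂ with hψ₃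
  set ψ₄ := (Gate.coef true : Gate D.na D.np n 0).toMatrix O *ᵥ ψ₃ with hψ₄
  have e1 : ∀ j p, ψ₁ ((j, p), 0) = O.coef.1 j 0 * (Pi.single (0, 0) 1 : _ → ℂ) p := by
    intro j p
    have h0 : (fun j' => ψ ((j', p), 0)) = (Pi.single (0, 0) (1 : ℂ) : _ → ℂ) p •
        (Pi.single 0 1 : Fin (2 ^ D.na) → ℂ) := by
      ext j'
      rw [hψ]
      by_cases hp : p = (0, 0) <;> by_cases hj : j' = 0 <;> simp [hp, hj]
    rw [hψ₁]
    simp only [Gate.toMatrix, kronecker_one_mulVec_apply, Gate.orInv, Bool.false_eq_true, if_false]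
    rw [h0, Matrix.mulVec_smul, Matrix.mulVec_single_one, Pi.smul_apply, smul_eq_mul, mul_comm]
    rfl
  set w : ℝ := (‖D.initVec b‖)⁻¹ with hw
  have e2 : ∀ j p, ψ₂ ((j, p), 0) = O.coef.1 j 0 * ((w : ℂ) * D.zetaTilde p.1 * b p.2) := by
    intro j p
    rw [hψ₂]
    simp only [Gate.toMatrix, kronecker_one_mulVec_apply, one_kronecker_mulVec_apply, Gate.orInv,
      Bool.false_eq_true, if_false, e1]
    have h0 : (fun k => O.coef.1 j 0 * (Pi.single (0, 0) 1 : Fin (2 ^ D.np) × Fin (2 ^ n) → ℂ) k)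
        = O.coef.1 j 0 • Pi.single (0, 0) 1 := rfl
    rw [h0, Matrix.mulVec_smul, Matrix.mulVec_single_one, Pi.smul_apply, smul_eq_mul]
    have h1 : O.prep.1.col (0, 0) p = ket (D.initVec b) p := hO.prep_apply p
    rw [h1]
    simp only [ket, initVec, hw, PiLp.smul_apply, smul_eq_mul, mul_assoc]
  have e3 : ∀ j p, ψ₃ ((j, p), 0) = O.coef.1 j 0 * ((w : ℂ) * D.zetaTilde p.1) *
      applyFun W (fun i => Complex.exp (Complex.I * ((D.mu p.1 * lam i : ℝ) : ℂ) * D.time j)) b.ofLp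
        p.2 := by
    intro j p
    rw [hψ₃]
    simp only [Gate.toMatrix, kronecker_one_mulVec_apply, Gate.orInv, Bool.false_eq_true, if_false,
      hO.sel_eq, selectMatrix_mulVec_apply, e2]
    rw [← D.evolution_mulVec hW hA (D.time j)
      (fun l => O.coef.1 j 0 * ((w : ℂ) * D.zetaTilde l)) b.ofLp p]
    congr 2
    ext k
    ring
  -- the first row of the inverse coefficient oracle supplies the second factor `√α_j`
  have hcoef : ∀ j, star (O.coef.1 j 0) * O.coef.1 j 0 = ((D.alpha j / D.T : ℝ) : ℂ) := by
    intro j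
    rw [hO.coef_apply, Complex.star_def, Complex.conj_ofReal, ← Complex.ofReal_mul,
      div_mul_div_comm, Real.mul_self_sqrt (D.alpha_nonneg j), D.alphaNorm_eq,
      Real.mul_self_sqrt hT.le]
  have e4 : ∀ p, ψ₄ ((0, p), 0) = ((w / D.T : ℝ) : ℂ) * D.zetaTilde p.1 *
      ∑ j, (D.alpha j : ℂ) * applyFun W
        (fun i => Complex.exp (Complex.I * ((D.mu p.1 * lam i : ℝ) : ℂ) * D.time j)) b.ofLp p.2 := by
    intro p
    rw [hψ₄]
    simp only [Gate.toMatrix, kronecker_one_mulVec_apply, Gate.orInv, if_true, e3]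
    rw [Matrix.mulVec, dotProduct, Finset.mul_sum]
    refine Finset.sum_congr rfl fun j _ => ?_
    rw [Matrix.conjTranspose_apply, ← mul_assoc, ← mul_assoc, hcoef]
    push_cast
    ring
  have hchain : circuitMatrix O (D.lcuCircuit n) *ᵥ ψ = (D.readout n).1 *ᵥ ψ₄ := by
    rw [hψ₄, hψ₃, hψ₂, hψ₁]
    simp only [lcuCircuit, circuitMatrix, Matrix.one_mul, Matrix.mulVec_mulVec, Matrix.mul_assoc]
    rfl
  rw [hchain]
  have e5 : ((D.readout n).1 *ᵥ ψ₄) ((0, (D.mid, i)), 0)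
      = ∑ l, D.fourier D.mid l * ψ₄ ((0, (l, i)), 0) := by
    simp only [readout, kronecker_one_mulVec_apply, one_kronecker_mulVec_apply]
    rfl
  -- the normalizations of the readout and of the initial vector cancel up to `1 / ‖ζ‖`
  have hconst : (√(2 ^ D.np))⁻¹ * (w / D.T) = (D.T * ‖D.zetaVec‖)⁻¹ * ‖b‖⁻¹ := by
    have hN : √((2 : ℝ) ^ D.np) ≠ 0 := by positivity
    rw [hw, D.norm_initVec]
    simp only [div_eq_mul_inv, mul_inv, inv_inv]
    field_simp
  rw [e5]
  have e6 : ∀ l, D.fourier D.mid l * ψ₄ ((0, (l, i)), 0)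
      = (((D.T * ‖D.zetaVec‖)⁻¹ : ℝ) : ℂ) * ∑ i', W i i' *
        ((D.zetaTilde l * Complex.exp (Complex.I * (D.mu l : ℝ) * ((Real.pi * D.R : ℝ) : ℂ)) *
          ∑ j, (D.alpha j : ℂ) * Complex.exp (Complex.I * ((D.mu l * lam i' : ℝ) : ℂ) * D.time j)) *
          (Wᴴ *ᵥ (ket b).ofLp) i') := by
    intro l
    have hket : (Wᴴ *ᵥ (ket b).ofLp) = ((‖b‖⁻¹ : ℝ) : ℂ) • (Wᴴ *ᵥ b.ofLp) := by
      rw [ket, WithLp.ofLp_smul, Matrix.mulVec_smul]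
    have hF : D.fourier D.mid l = ((√(2 ^ D.np))⁻¹ : ℝ) *
        Complex.exp (Complex.I * (D.mu l : ℝ) * ((Real.pi * D.R : ℝ) : ℂ)) := by
      rw [fourier, Matrix.of_apply, grid_mid, zero_add]
    have hsum : ∑ j, (D.alpha j : ℂ) * applyFun W
        (fun i => Complex.exp (Complex.I * ((D.mu l * lam i : ℝ) : ℂ) * D.time j)) b.ofLp i
        = ∑ i', W i i' * ((∑ j, (D.alpha j : ℂ) *
          Complex.exp (Complex.I * ((D.mu l * lam i' : ℝ) : ℂ) * D.time j)) *
          (Wᴴ *ᵥ b.ofLp) i') := by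
      have happ : ∀ f : Fin (2 ^ n) → ℂ, applyFun W f b.ofLp i
          = ∑ i', W i i' * (f i' * (Wᴴ *ᵥ b.ofLp) i') := fun _ => rfl
      simp only [happ]
      generalize Wᴴ *ᵥ b.ofLp = β
      simp only [Finset.mul_sum, Finset.sum_mul]
      rw [Finset.sum_comm]
      exact Finset.sum_congr rfl fun i' _ => Finset.sum_congr rfl fun j _ => by ring
    rw [e4, hF, hsum, hket]
    have hc := congrArg (fun x : ℝ => (x : ℂ)) hconst
    simp only [Complex.ofReal_mul] at hc
    simp only [Pi.smul_apply, smul_eq_mul, Finset.mul_sum (s := (Finset.univ : Finset (Fin (2 ^ n))))]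
    refine Finset.sum_congr rfl fun i' _ => ?_
    linear_combination (Complex.exp (Complex.I * (D.mu l : ℝ) * ((Real.pi * D.R : ℝ) : ℂ)) *
      D.zetaTilde l * (W i i' * ((∑ j, (D.alpha j : ℂ) *
          Complex.exp (Complex.I * ((D.mu l * lam i' : ℝ) : ℂ) * D.time j)) *
          (Wᴴ *ᵥ b.ofLp) i'))) * hc
  simp only [e6]
  rw [← Finset.mul_sum, Finset.sum_comm]
  congr 1
  rw [applyFun, Matrix.mulVec, dotProduct]
  refine Finset.sum_congr rfl fun i' _ => ?_
  rw [← Finset.mul_sum, ← Finset.sum_mul]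
  rfl

end Discretization

/-! ### The success probability and the output state -/

/-- Knowing the amplitude `r` up to a relative error of `1 / 4` suffices to choose a number of rounds
after which the success amplitude is bounded below: the angle `(2 m + 1) θ` stays between `3 / 16` and
`π / 2`, where `sin` is above its chord. -/
theorem sin_amplified_ge {a r : ℝ} (ha : 0 < a) (h1 : 3 / 4 * a ≤ r) (h2 : r ≤ 5 / 4 * a)
    (hr : r ≤ 1) :
    1 / 10 ≤ Real.sin ((2 * (⌊1 / (4 * a)⌋₊ : ℝ) + 1) * Real.arcsin r) := by
  set m := ⌊1 / (4 * a)⌋₊ with hm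
  set θ := Real.arcsin r with hθ
  have hr0 : 0 < r := by linarith
  have hsin : Real.sin θ = r := Real.sin_arcsin (by linarith) hr
  have hθ0 : 0 ≤ θ := Real.arcsin_nonneg.2 hr0.le
  have hθpi : θ ≤ Real.pi / 2 := Real.arcsin_le_pi_div_two r
  have hpi := Real.pi_pos
  have hpi3 := Real.pi_gt_three
  have hpi32 := Real.pi_lt_d2
  have hge : r ≤ θ := by rw [← hsin]; exact Real.sin_le hθ0
  -- no amplification takes place when the amplitude is already at least `3 / 16`
  rcases Nat.eq_zero_or_pos m with h0 | h0
  · rw [h0, Nat.cast_zero, mul_zero, zero_add, one_mul, hsin]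
    have : 1 / (4 * a) < 1 := Nat.floor_eq_zero.1 h0
    rw [div_lt_one (by positivity)] at this
    linarith
  · have hle : (m : ℝ) ≤ 1 / (4 * a) := Nat.floor_le (by positivity)
    have hlt : 1 / (4 * a) < m + 1 := Nat.lt_floor_add_one _
    have hm1 : (1 : ℝ) ≤ m := by exact_mod_cast h0
    have ha4 : a ≤ 1 / 4 := by
      have := hm1.trans hle
      rw [le_div_iff₀ (by positivity)] at this
      linarith
    have hjor := Real.mul_le_sin hθ0 hθpi
    rw [hsin, div_mul_eq_mul_div, div_le_iff₀ hpi] at hjor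
    have hθ2 : θ ≤ 2 * a := by nlinarith
    rw [le_div_iff₀ (by positivity)] at hle
    rw [div_lt_iff₀ (by positivity)] at hlt
    have hup : (2 * (m : ℝ) + 1) * θ ≤ Real.pi / 2 := by
      have : (2 * (m : ℝ) + 1) * θ ≤ (2 * m + 1) * (2 * a) :=
        mul_le_mul_of_nonneg_left hθ2 (by positivity)
      nlinarith
    have hlow : 3 / 16 ≤ (2 * (m : ℝ) + 1) * θ := by
      have : (2 * (m : ℝ) + 1) * (3 / 4 * a) ≤ (2 * m + 1) * θ :=
        mul_le_mul_of_nonneg_left (h1.trans hge) (by positivity)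
      nlinarith
    have hfin := Real.mul_le_sin (by linarith : 0 ≤ (2 * (m : ℝ) + 1) * θ) hup
    refine le_trans ?_ hfin
    rw [div_mul_eq_mul_div, le_div_iff₀ hpi]
    linarith

/-- Normalization at most doubles the relative error. -/
theorem norm_normalize_sub_le {E : Type*} [NormedAddCommGroup E] [NormedSpace ℂ E] {u v : E}
    (hu : u ≠ 0) (hv : v ≠ 0) :
    ‖((‖v‖⁻¹ : ℝ) : ℂ) • v - ((‖u‖⁻¹ : ℝ) : ℂ) • u‖ ≤ 2 * ‖v - u‖ / ‖u‖ := by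
  have hu' : 0 < ‖u‖ := norm_pos_iff.2 hu
  have hv' : 0 < ‖v‖ := norm_pos_iff.2 hv
  have e : ((‖v‖⁻¹ : ℝ) : ℂ) • v - ((‖u‖⁻¹ : ℝ) : ℂ) • u
      = ((‖v‖⁻¹ - ‖u‖⁻¹ : ℝ) : ℂ) • v + ((‖u‖⁻¹ : ℝ) : ℂ) • (v - u) := by
    push_cast
    module
  rw [e]
  refine (norm_add_le _ _).trans ?_
  rw [norm_smul, norm_smul, Complex.norm_real, Complex.norm_real, norm_inv, norm_norm,
    Real.norm_eq_abs]
  have e2 : |‖v‖⁻¹ - ‖u‖⁻¹| * ‖v‖ = |‖u‖ - ‖v‖| / ‖u‖ := by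
    rw [inv_sub_inv hv'.ne' hu'.ne', abs_div, abs_of_pos (mul_pos hv' hu')]
    field_simp
  have e3 : |‖u‖ - ‖v‖| ≤ ‖v - u‖ := by
    rw [abs_sub_comm]; exact abs_norm_sub_norm_le v u
  rw [e2, inv_mul_eq_div, ← add_div]
  exact div_le_div_of_nonneg_right (by linarith) hu'.le

namespace Discretization

variable (D : Discretization)

/-- The linear combination of evolutions, followed by `m` rounds of amplitude amplification. The
flag is raised when the index register is `0` and the `p` register is at the grid point `0`. -/
def solver (n m : ℕ) : Algorithm D.na D.np n where
  a := 0
  circuit := amplifiedCircuit (D.lcuCircuit n) (fun x => x.1.1 = 0 ∧ x.1.2.1 = D.mid) m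
  success := {((0, D.mid), 0)}

theorem queries_solver (n m : ℕ) : (D.solver n m).queries = (2 * m + 1) * 4 :=
  sum_queries_amplifiedCircuit _ _ _

/-- Sums over the good basis states are sums over the output register. -/
theorem sum_good {n : ℕ} (f : Reg D.na D.np n 0 → ℝ) :
    ∑ x, (if x.1.1 = 0 ∧ x.1.2.1 = D.mid then f x else 0) = ∑ i, f ((0, (D.mid, i)), 0) := by
  rw [← Finset.sum_filter]
  refine (Finset.sum_bij (fun i _ => ((0, (D.mid, i)), 0)) (fun i _ => ?_) (fun i _ j _ h => ?_)
    (fun x hx => ?_) fun _ _ => rfl).symm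
  · simp
  · simpa using h
  · simp only [Finset.mem_filter, Finset.mem_univ, true_and] at hx
    obtain ⟨⟨j, l, i⟩, z⟩ := x
    obtain ⟨hj, hl⟩ := hx
    refine ⟨i, Finset.mem_univ i, ?_⟩
    have hz : z = 0 := Fin.ext (by have := z.2; simp at this ⊢)
    simp only at hj hl
    rw [hj, hl, hz]

/-- If the response applied to `|b⟩` approximates `u` with relative error `ε / 4`, then amplification of its
amplitude `≈ ‖u‖ / (T ‖ζ‖)` prepares `|u⟩` up to an error of `ε`. -/
theorem solver_prepares {n : ℕ} {A W : Matrix (Fin (2 ^ n)) (Fin (2 ^ n)) ℂ}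
    {lam : Fin (2 ^ n) → ℝ} (hW : Wᴴ * W = 1)
    (hA : A = W * Matrix.diagonal (fun i => ((lam i : ℝ) : ℂ)) * Wᴴ)
    {b u : EuclideanSpace ℂ (Fin (2 ^ n))} (hζ : 0 < ‖D.zetaVec‖) (hu : u ≠ 0) {ε : ℝ}
    (hε : ε < 1)
    (hclose : ‖WithLp.toLp 2 (applyFun W (fun i => D.response (lam i)) (ket b).ofLp) - u‖
      ≤ ε / 4 * ‖u‖)
    (O : Oracles D.na D.np n) (hO : O.Implement D A b) :
    (D.solver n ⌊1 / (4 * (‖u‖ / (D.T * ‖D.zetaVec‖)))⌋₊).Prepares O (ket u) ε (1 / 100) := by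
  have hT := D.T_pos
  set v : EuclideanSpace ℂ (Fin (2 ^ n)) :=
    WithLp.toLp 2 (applyFun W (fun i => D.response (lam i)) (ket b).ofLp) with hv
  have hu' : 0 < ‖u‖ := norm_pos_iff.2 hu
  set s : ℝ := D.T * ‖D.zetaVec‖ with hs
  have hs0 : 0 < s := by positivity
  have hdiff : |‖v‖ - ‖u‖| ≤ 1 / 4 * ‖u‖ :=
    (abs_norm_sub_norm_le v u).trans (hclose.trans (by nlinarith))
  rw [abs_le] at hdiff
  have hvpos : 0 < ‖v‖ := by linarith
  have hv0 : v ≠ 0 := norm_pos_iff.1 hvpos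
  set S : Reg D.na D.np n 0 → Prop := fun x => x.1.1 = 0 ∧ x.1.2.1 = D.mid
  set r : ℝ := ‖v‖ / s with hr
  have hamp : ∀ i, (circuitMatrix O (D.lcuCircuit n) *ᵥ Pi.single ((0, (0, 0)), 0) 1)
      ((0, (D.mid, i)), 0) = ((s⁻¹ : ℝ) : ℂ) * v i :=
    fun i => D.lcuCircuit_good hW hA hζ.ne' hO i
  have hgood : ∑ x, (if S x then
      ‖(circuitMatrix O (D.lcuCircuit n) *ᵥ Pi.single ((0, (0, 0)), 0) 1) x‖ ^ 2 else 0)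
      = r ^ 2 := by
    refine (D.sum_good _).trans ?_
    simp only [hamp, norm_mul, mul_pow, Complex.norm_real, norm_inv, Real.norm_of_nonneg hs0.le]
    rw [← Finset.mul_sum, ← EuclideanSpace.norm_sq_eq, hr, div_pow, inv_pow, inv_mul_eq_div]
  have hr0 : 0 < r := div_pos hvpos hs0
  have hr1 : r ≤ 1 := by
    have h1 := norm_toLp_mulVec_of_star_mul
      (Matrix.mem_unitaryGroup_iff'.1 (circuitMatrix_mem O (D.lcuCircuit n)))
      (Pi.single ((0, (0, 0)), 0) 1)
    have h2 : WithLp.toLp 2 (Pi.single (((0, (0, 0)), 0) : Reg D.na D.np n 0) (1 : ℂ))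
      = EuclideanSpace.single ((0, (0, 0)), 0) (1 : ℂ) := rfl
    have h3 := EuclideanSpace.norm_sq_eq (WithLp.toLp 2
      (circuitMatrix O (D.lcuCircuit n) *ᵥ Pi.single ((0, (0, 0)), 0) 1))
    rw [h1, h2] at h3
    simp only [PiLp.norm_single, norm_one, one_pow] at h3
    have h4 : r ^ 2 ≤ 1 := by
      rw [← hgood, h3]
      refine Finset.sum_le_sum fun x _ => ?_
      split_ifs
      · exact le_rfl
      · positivity
    nlinarith
  set m := ⌊1 / (4 * (‖u‖ / s))⌋₊ with hm
  set θ := Real.arcsin r with hθ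
  have hsinθ : Real.sin θ = r := Real.sin_arcsin (by linarith) hr1
  have hbig : 1 / 10 ≤ Real.sin ((2 * (m : ℝ) + 1) * θ) := by
    refine sin_amplified_ge (div_pos hu' hs0) ?_ ?_ hr1
    · rw [hr, ← mul_div_assoc]; exact div_le_div_of_nonneg_right (by linarith) hs0.le
    · rw [hr, ← mul_div_assoc]; exact div_le_div_of_nonneg_right (by linarith) hs0.le
  have hfinal := amplifiedCircuit_good O (D.lcuCircuit n) S (θ := θ)
    (by rw [hsinθ]; exact hr0.ne') (by rw [hsinθ]; exact hgood) m
  set p : ℝ := Real.sin ((2 * (m : ℝ) + 1) * θ) with hp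
  refine ⟨fun _ => (p : ℂ), ket v, norm_ket hv0, ?_, ?_, ?_⟩
  · refine (norm_normalize_sub_le hu hv0).trans ?_
    rw [div_le_iff₀ hu']
    nlinarith [norm_nonneg (v - u)]
  · change 1 / 100 ≤ ∑ _k ∈ {((0, D.mid), 0)}, ‖(p : ℂ)‖ ^ 2
    rw [Finset.sum_singleton, Complex.norm_real, Real.norm_eq_abs, sq_abs]
    nlinarith
  · intro k hk i
    have hk' : k = ((0, D.mid), 0) := Finset.mem_singleton.1 hk
    subst hk'
    have h1 : (D.solver n m).finalState O = circuitMatrix O (amplifiedCircuit (D.lcuCircuit n) S m)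
        *ᵥ Pi.single ((0, (0, 0)), 0) 1 := foldl_eq_circuitMatrix O _ _
    rw [h1]
    refine (hfinal ((0, (D.mid, i)), 0) ⟨rfl, rfl⟩).trans ?_
    rw [hamp, hsinθ, hr]
    simp only [ket, PiLp.smul_apply, smul_eq_mul]
    have hvc : ((‖v‖ : ℝ) : ℂ) ≠ 0 := by exact_mod_cast hvpos.ne'
    have hsc : (s : ℂ) ≠ 0 := by exact_mod_cast hs0.ne'
    push_cast
    field_simp

end Discretization

/-! ### The choice of the parameters -/

/-- The elementary consequences of `ε ξ ≤ 1 / e`. -/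
theorem deltaOf_bounds {ε ξ : ℝ} (hε : 0 < ε) (hξ : 0 < ξ) (h : ε * ξ ≤ Real.exp (-1)) :
    0 < deltaOf ε ξ ∧ deltaOf ε ξ ≤ ε * ξ ∧ 1 ≤ Real.log (1 / deltaOf ε ξ) := by
  have hpos : 0 < ε * ξ := by positivity
  have hlog : 1 ≤ Real.log (1 / (ε * ξ)) := by
    rw [Real.le_log_iff_exp_le (by positivity), le_div_iff₀ hpos]
    calc Real.exp 1 * (ε * ξ) ≤ Real.exp 1 * Real.exp (-1) := by gcongr
      _ = 1 := by rw [← Real.exp_add]; norm_num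
  have hroot : 1 ≤ Real.log (1 / (ε * ξ)) ^ (1 / 4 : ℝ) := Real.one_le_rpow hlog (by norm_num)
  have hd : 0 < deltaOf ε ξ := by unfold deltaOf; positivity
  have hle : deltaOf ε ξ ≤ ε * ξ := div_le_self hpos.le hroot
  exact ⟨hd, hle, hlog.trans (Real.log_le_log (by positivity)
    (one_div_le_one_div_of_le hd hle))⟩

theorem exp_two_le : Real.exp 2 ≤ 8 := by
  have h := Real.exp_one_lt_d9
  have : Real.exp 2 = Real.exp 1 * Real.exp 1 := by rw [← Real.exp_add]; norm_num
  rw [this]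
  nlinarith [Real.exp_pos 1]

theorem exp_neg_ten_le : 400 * Real.exp (-10) ≤ 1 / 16 := by
  have h := Real.exp_one_gt_d9
  have h1 : (2 : ℝ) ^ 10 ≤ Real.exp 1 ^ 10 := pow_le_pow_left₀ (by norm_num) (by linarith) 10
  have h2 : Real.exp 10 = Real.exp 1 ^ 10 := by rw [← Real.exp_nat_mul]; norm_num
  have h3 : (6400 : ℝ) ≤ Real.exp 1 ^ 10 := by
    calc (6400 : ℝ) ≤ (2.5 : ℝ) ^ 10 := by norm_num
      _ ≤ _ := pow_le_pow_left₀ (by norm_num) (by linarith) 10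
  rw [Real.exp_neg, h2, ← div_eq_mul_inv, div_le_iff₀ (by positivity)]
  linarith

/-- The number of grid points per unit length: `K² ≥ 10 + log (1 / ε)` makes the sampling error
`400 exp (-K²)` smaller than `ε / 16`. -/
def gridDensity (ε : ℝ) : ℕ := ⌈√(10 + Real.log (1 / ε))⌉₊

theorem gridDensity_bounds {ε : ℝ} (hε : 0 < ε) (hε1 : ε < 1) :
    0 < gridDensity ε ∧ 400 * Real.exp (-(gridDensity ε : ℝ) ^ 2) ≤ ε / 16 ∧
      (gridDensity ε : ℝ) + 1 ≤ 3 * √(10 + Real.log (1 / ε)) := by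
  have hl : 0 ≤ Real.log (1 / ε) := Real.log_nonneg (by rw [le_div_iff₀ hε]; linarith)
  have hs : 1 ≤ √(10 + Real.log (1 / ε)) := by
    rw [Real.one_le_sqrt]; linarith
  have hge : √(10 + Real.log (1 / ε)) ≤ gridDensity ε := Nat.le_ceil _
  have hlt : (gridDensity ε : ℝ) < √(10 + Real.log (1 / ε)) + 1 := Nat.ceil_lt_add_one (by linarith)
  refine ⟨?_, ?_, by linarith⟩
  · exact_mod_cast (by linarith : (0 : ℝ) < gridDensity ε)
  · have h1 : 10 + Real.log (1 / ε) ≤ (gridDensity ε : ℝ) ^ 2 := by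
      rw [← Real.sq_sqrt (by linarith : 0 ≤ 10 + Real.log (1 / ε))]
      exact pow_le_pow_left₀ (by linarith) hge 2
    have h2 : Real.exp (-(gridDensity ε : ℝ) ^ 2) ≤ Real.exp (-10) * ε := by
      calc _ ≤ Real.exp (-10 + Real.log ε) := by
            refine Real.exp_le_exp.2 ?_
            rw [one_div, Real.log_inv] at h1
            linarith
        _ = _ := by rw [Real.exp_add, Real.exp_log hε]
    calc _ ≤ 400 * (Real.exp (-10) * ε) := by gcongr
      _ = 400 * Real.exp (-10) * ε := by ring
      _ ≤ 1 / 16 * ε := by gcongr; exact exp_neg_ten_le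
      _ = _ := by ring

/-- Integrating up to `2 timeScale` makes the truncation error at most `ε / 16` on the spectrum, whose
distance to `0` is `σ / κ`. -/
theorem timeScale_bounds {σ κ ξ ε δ : ℝ} (hσ : 0 < σ) (hξ : 0 < ξ) (hξκ : ξ ≤ κ / σ)
    (hε : 0 < ε) (hε1 : ε < 1) (hδ : 0 < δ) (hδε : δ ≤ ε * ξ) :
    κ / σ ≤ timeScale σ κ δ ∧
      Real.exp (-((2 * timeScale σ κ δ / (κ / σ)) ^ 2) / 2) ≤ ε / 16 := by
  set ν := κ / σ with hν
  have hν0 : 0 < ν := hξ.trans_le hξκ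
  have hdiv : 2 * κ / (σ * δ) = 2 * ν / δ := by rw [hν]; field_simp
  have hge : 2 / ε ≤ 2 * ν / δ := by
    rw [div_le_div_iff₀ hε hδ]
    nlinarith
  have h2 : 2 ≤ 2 / ε := by rw [le_div_iff₀ hε]; linarith
  have hlog2 := Real.log_two_gt_d9
  have hlog : Real.log 2 ≤ Real.log (2 * ν / δ) := Real.log_le_log two_pos (h2.trans hge)
  have hsq : 0 ≤ 2 * Real.log (2 * ν / δ) := by linarith
  unfold timeScale
  rw [hdiv, ← hν]
  constructor
  · refine le_mul_of_one_le_right hν0.le ?_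
    rw [Real.one_le_sqrt]; linarith
  · have e1 : 2 * (ν * √(2 * Real.log (2 * ν / δ))) / ν = 2 * √(2 * Real.log (2 * ν / δ)) := by
      field_simp
    rw [e1, mul_pow, Real.sq_sqrt hsq]
    have e2 : -(2 ^ 2 * (2 * Real.log (2 * ν / δ))) / 2 = 4 * -Real.log (2 * ν / δ) := by ring
    have e3 : Real.exp (-Real.log (2 * ν / δ)) ≤ ε / 2 := by
      rw [Real.exp_neg, Real.exp_log (by positivity), ← inv_div 2 ε]
      exact inv_anti₀ (by positivity) hge
    rw [e2, show (4 : ℝ) * -Real.log (2 * ν / δ) = (4 : ℕ) * -Real.log (2 * ν / δ) by norm_num,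
      Real.exp_nat_mul]
    calc _ ≤ (ε / 2) ^ 4 := pow_le_pow_left₀ (Real.exp_pos _).le e3 4
      _ = ε ^ 3 * (ε / 16) := by ring
      _ ≤ 1 * (ε / 16) := by
          gcongr
          exact pow_le_one₀ hε.le hε1.le
      _ = _ := one_mul _

/-- `Q = ⌈25 log Y⌉` nodes make `(2 Q)!` larger than `Y ^ 17`. -/
theorem pow_le_factorial {Y : ℝ} (hY : 2 ≤ Y) :
    Y ^ 17 ≤ ((2 * ⌈25 * Real.log Y⌉₊).factorial : ℝ) := by
  set Q := ⌈25 * Real.log Y⌉₊ with hQ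
  have hle : 25 * Real.log Y ≤ Q := Nat.le_ceil _
  have h1 : ((2 ^ Q : ℕ) : ℝ) ≤ ((2 * Q).factorial : ℝ) := by
    have h := Nat.two_pow_mul_factorial_le_factorial_two_mul Q
    have h' : 2 ^ Q ≤ 2 ^ Q * Q.factorial := Nat.le_mul_of_pos_right _ (Nat.factorial_pos Q)
    exact_mod_cast h'.trans h
  refine le_trans ?_ h1
  have hlog2 := Real.log_two_gt_d9
  have hlogY : 0 ≤ Real.log Y := Real.log_nonneg (by linarith)
  push_cast
  rw [← Real.log_le_log_iff (by positivity) (by positivity), Real.log_pow, Real.log_pow]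
  push_cast
  nlinarith

/-- The quadrature error fits into `ε ξ / 16`. Of the `17` powers of `Y = T / δ` one turns `T` into `δ`, one
absorbs the number `K` of grid points, and the others the constants. -/
theorem quadrature_budget {ε ξ δ T Y : ℝ} {K : ℕ} (hε : 0 < ε) (hδ : 0 < δ)
    (hδε : δ ≤ ε * ξ) (hK : (K : ℝ) + 1 ≤ 3 * √(10 + Real.log (1 / ε)))
    (hYT : Y = T / δ) (hY : 2 / ε ≤ Y) (hε1 : ε < 1) {F : ℝ} (hF : Y ^ 17 ≤ F) :
    Real.exp 2 * (2 * ((K : ℝ) + 1)) * (4 * T / F) ≤ ε * ξ / 16 := by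
  have h2 : 2 ≤ 2 / ε := by rw [le_div_iff₀ hε]; linarith
  have hY2 : 2 ≤ Y := h2.trans hY
  have hY0 : 0 < Y := by linarith
  have hT : T = Y * δ := by rw [hYT]; field_simp
  have hl : Real.log (1 / ε) ≤ Y := by
    have h3 : Real.log (1 / ε) ≤ 1 / ε - 1 := Real.log_le_sub_one_of_pos (by positivity)
    have h4 : 1 / ε ≤ 2 / ε := div_le_div_of_nonneg_right (by norm_num) hε.le
    linarith
  have hsq : √(10 + Real.log (1 / ε)) ≤ 6 * Y := by
    rw [Real.sqrt_le_left (by linarith)]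
    nlinarith
  have hK' : (K : ℝ) + 1 ≤ 18 * Y := by linarith
  have hF0 : 0 < F := lt_of_lt_of_le (by positivity) hF
  have hY15 : (2 : ℝ) ^ 15 ≤ Y ^ 15 := pow_le_pow_left₀ (by norm_num) hY2 15
  have hTF : 4 * T / F ≤ 4 * δ / (2 ^ 15 * Y) := by
    rw [div_le_div_iff₀ hF0 (by positivity), hT]
    calc 4 * (Y * δ) * (2 ^ 15 * Y) = 4 * δ * (Y ^ 2 * 2 ^ 15) := by ring
      _ ≤ 4 * δ * (Y ^ 2 * Y ^ 15) := by gcongr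
      _ = 4 * δ * Y ^ 17 := by ring
      _ ≤ 4 * δ * F := by gcongr
  calc Real.exp 2 * (2 * ((K : ℝ) + 1)) * (4 * T / F)
      ≤ 8 * (2 * (18 * Y)) * (4 * δ / (2 ^ 15 * Y)) := by
        have := exp_two_le
        have h0 : 0 ≤ 4 * T / F := by rw [hT]; positivity
        gcongr
    _ = (1152 / 2 ^ 15) * δ := by field_simp; ring
    _ ≤ 1 / 16 * δ := mul_le_mul_of_nonneg_right (by norm_num) hδ.le
    _ ≤ ε * ξ / 16 := by linarith

/-- Any grid density `K` and any quadrature time step `1 / ω` are realized by a discretization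
with a prescribed number of qubits. -/
theorem exists_discretization {K Nt Q np : ℕ} {ω : ℝ} (hK : 0 < K) (hω : 0 < ω) (hNt : 0 < Nt)
    (hQ : 0 < Q) (hnp : 0 < np) :
    ∃ D : Discretization, D.T = Nt / ω ∧ D.Q = Q ∧ D.np = np ∧ D.dp = 1 / K ∧
      D.tau = 1 / ω := by
  have hKr : (0 : ℝ) < K := by exact_mod_cast hK
  have hNtr : (0 : ℝ) < Nt := by exact_mod_cast hNt
  refine ⟨{
    R := 2 ^ np / (2 * Real.pi * K)
    R_pos := by positivity
    np := np
    np_pos := hnp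
    T := Nt / ω
    T_pos := by positivity
    Nt := Nt
    Nt_pos := hNt
    Q := Q
    Q_pos := hQ
    rule := (nonempty_gaussRule Q).some }, rfl, rfl, rfl, ?_, ?_⟩
  · simp only [Discretization.dp]
    field_simp
  · simp only [Discretization.tau]
    field_simp

/-- The number of rounds of amplitude amplification is proportional to the inverse
`T ‖ζ‖ / ξ` of the initial amplitude; the lower bounds on `T` and `‖ζ‖` absorb the constant
overhead. -/
theorem queries_solver_le (D : Discretization) (n : ℕ) {ξ : ℝ} (hξ : 0 < ξ) (hT : 2 * ξ ≤ D.T)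
    (hζ : Real.exp (-1 / 2) ≤ ‖D.zetaVec‖) :
    ((D.solver n ⌊1 / (4 * (ξ / (D.T * ‖D.zetaVec‖)))⌋₊).queries : ℝ) ≤
      6 * (D.T * ‖D.zetaVec‖ / ξ) := by
  have hbase : 1 ≤ D.T * ‖D.zetaVec‖ / ξ := by
    rw [le_div_iff₀ hξ, one_mul]
    have h1 : 1 / 2 ≤ Real.exp (-1 / 2) := by linarith [Real.add_one_le_exp (-1 / 2 : ℝ)]
    nlinarith
  have he : 1 / (4 * (ξ / (D.T * ‖D.zetaVec‖))) = D.T * ‖D.zetaVec‖ / ξ / 4 := by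
    field_simp
  have hfl : (⌊1 / (4 * (ξ / (D.T * ‖D.zetaVec‖)))⌋₊ : ℝ) ≤ D.T * ‖D.zetaVec‖ / ξ / 4 :=
    he ▸ Nat.floor_le (by have := D.T_pos; positivity)
  rw [Discretization.queries_solver]
  push_cast
  linarith

/-- The discretization, with all quantitative properties that do not involve `A` and `b`. -/
theorem exists_good_discretization {σ κ ξ ε : ℝ} (hσ : 0 < σ) (hκ : 1 ≤ κ) (hξ : 0 < ξ)
    (hξκ : ξ ≤ κ / σ) (hε : 0 < ε) (hε1 : ε < 1) (hεξ : ε * ξ ≤ Real.exp (-1)) :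
    ∃ D : Discretization,
      Real.exp (-1 / 2) ≤ ‖D.zetaVec‖ ∧
      2 * ξ ≤ D.T ∧
      (∀ lam : ℝ, |lam| ≤ σ → 1 ≤ |lam| * (κ / σ) →
        ‖D.response lam - (lam : ℂ)⁻¹‖ ≤ ε / 8 * ‖(lam : ℂ)⁻¹‖ + ε * ξ / 8) ∧
      D.T ≤ 3 * timeScale σ κ (deltaOf ε ξ) ∧
      timeScale σ κ (deltaOf ε ξ) ≤ D.T ∧
      ‖D.zetaVec‖ ^ 2 ≤ 48 * √(10 + Real.log (1 / ε)) ∧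
      D.tau * (Real.pi / D.dp * σ) = 1 ∧
      (D.Q : ℝ) ≤ 27 * Real.log (D.T / deltaOf ε ξ) ∧
      Real.log (D.T / deltaOf ε ξ) ≤ D.Q := by
  obtain ⟨hδ, hδε, -⟩ := deltaOf_bounds hε hξ hεξ
  set δ := deltaOf ε ξ with hδdef
  obtain ⟨hK, hKexp, hKup⟩ := gridDensity_bounds hε hε1
  set K := gridDensity ε with hKdef
  obtain ⟨hts, htrunc⟩ := timeScale_bounds (κ := κ) hσ hξ hξκ hε hε1 hδ hδε
  set ts := timeScale σ κ δ with htsdef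
  set ν := κ / σ with hν
  have hν0 : 0 < ν := hξ.trans_le hξκ
  have hts0 : 0 < ts := hν0.trans_le hts
  have hK1 : (1 : ℝ) ≤ K := by exact_mod_cast hK
  have hpi := Real.pi_gt_three
  -- `ω` is the largest frequency `‖D_μ ⊗ A‖`; the time is rounded up to a multiple of `1 / ω`
  set ω : ℝ := Real.pi * K * σ with hω
  have hω0 : 0 < ω := by positivity
  have hων : 1 ≤ ω * ν := by
    have : ω * ν = Real.pi * K * κ := by rw [hω, hν]; field_simp
    rw [this]
    nlinarith [mul_le_mul hK1 hκ zero_le_one (by positivity)]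
  set Nt : ℕ := ⌈2 * ts * ω⌉₊ with hNt
  have hNtpos : 0 < Nt := Nat.ceil_pos.2 (by positivity)
  set T : ℝ := Nt / ω with hT
  have hNtr : (0 : ℝ) < Nt := by exact_mod_cast hNtpos
  have hTpos : 0 < T := by positivity
  have hTge : 2 * ts ≤ T := by
    rw [hT, le_div_iff₀ hω0]; exact Nat.le_ceil _
  have hTle : T ≤ 3 * ts := by
    rw [hT, div_le_iff₀ hω0]
    have h1 : (Nt : ℝ) < 2 * ts * ω + 1 := Nat.ceil_lt_add_one (by positivity)
    have h2 : ω * ν ≤ ω * ts := mul_le_mul_of_nonneg_left hts hω0.le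
    linarith
  set Y : ℝ := T / δ with hY
  have hYge : 2 / ε ≤ Y := by
    rw [hY, div_le_div_iff₀ hε hδ]
    have : ξ ≤ ts := hξκ.trans hts
    nlinarith
  have hY2 : 2 ≤ Y := le_trans (by rw [le_div_iff₀ hε]; linarith) hYge
  have hlogY : 0.69 ≤ Real.log Y :=
    le_trans (by linarith [Real.log_two_gt_d9]) (Real.log_le_log two_pos hY2)
  set Q : ℕ := ⌈25 * Real.log Y⌉₊ with hQ
  have hQpos : 0 < Q := Nat.ceil_pos.2 (by linarith)
  obtain ⟨n₀, hn₀⟩ := Discretization.exists_np_close hK σ T hTpos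
    (show 0 < ε * ξ / 16 by positivity)
  -- more than `K` qubits put `p = 1` on the grid
  set np : ℕ := n₀ + K + 1 with hnp
  obtain ⟨D, hDT, hDQ, hDnp, hdp, htau⟩ := exists_discretization hK hω0 hNtpos hQpos
    (show 0 < np by omega)
  have hζlow : Real.exp (-1 / 2) ≤ ‖D.zetaVec‖ := D.exp_le_norm_zetaVec hK hdp (by omega)
  rw [← hT] at hDT
  refine ⟨D, hζlow, by rw [hDT]; linarith, ?_, by rw [hDT]; exact hTle, by rw [hDT]; linarith,
    ?_, ?_, ?_, ?_⟩
  · intro lam hlam hlamν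
    have hlam0 : 0 < |lam| := by
      by_contra h
      have : |lam| = 0 := le_antisymm (not_lt.1 h) (abs_nonneg _)
      rw [this] at hlamν; linarith
    have hres := D.norm_response_sub_inv_le (η := ε * ξ / 16) hK (abs_pos.1 hlam0)
      (by rw [hDT]; exact hn₀ D hdp (by omega) lam hlam) (fun l => by
        rw [htau, mul_one_div, div_le_one hω0, abs_mul]
        have h1 := D.abs_mu_le l
        rw [hdp, div_div_eq_mul_div, div_one] at h1
        exact mul_le_mul h1 hlam (abs_nonneg _) (by positivity))
    have hq : (∑ k, |zeta (D.grid k)|) * (4 * D.T / (2 * D.Q).factorial) ≤ ε * ξ / 16 := by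
      rw [hDT, hDQ]
      refine (mul_le_mul_of_nonneg_right (D.sum_abs_zeta_grid_le hK hdp) ?_).trans
        (quadrature_budget hε hδ hδε hKup hY hYge hε1 (pow_le_factorial hY2))
      exact div_nonneg (by positivity) (Nat.cast_nonneg _)
    have hX : Real.exp (-((lam * D.T) ^ 2) / 2) ≤ ε / 16 := by
      rw [hDT]
      refine le_trans (Real.exp_le_exp.2 ?_) htrunc
      have h1 : 2 * ts / ν ≤ |lam| * T := by
        rw [div_le_iff₀ hν0]
        nlinarith
      have h2 : (2 * ts / ν) ^ 2 ≤ (|lam| * T) ^ 2 := pow_le_pow_left₀ (by positivity) h1 2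
      rw [mul_pow, sq_abs, ← mul_pow] at h2
      linarith
    have hrel : (Real.exp (-((lam * D.T) ^ 2) / 2) + 400 * Real.exp (-(K : ℝ) ^ 2)) / |lam|
        ≤ ε / 8 * ‖(lam : ℂ)⁻¹‖ := by
      rw [norm_inv, Complex.norm_real, Real.norm_eq_abs, ← div_eq_mul_inv]
      exact div_le_div_of_nonneg_right (by linarith) hlam0.le
    linarith
  · refine (D.norm_zetaVec_sq_le hK hdp).trans ?_
    have := exp_two_le
    have h0 : 0 ≤ √(10 + Real.log (1 / ε)) := Real.sqrt_nonneg _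
    calc Real.exp 2 * (2 * ((K : ℝ) + 1)) ≤ 8 * (2 * (3 * √(10 + Real.log (1 / ε)))) := by gcongr
      _ = _ := by ring
  · rw [htau, hdp, div_div_eq_mul_div, div_one, ← hω, one_div, inv_mul_cancel₀ hω0.ne']
  · have : (Q : ℝ) < 25 * Real.log Y + 1 := Nat.ceil_lt_add_one (by linarith)
    rw [hDT, hDQ]
    linarith
  · have : 25 * Real.log Y ≤ Q := Nat.le_ceil _
    rw [hDT, hDQ]
    linarith

/-- What a plan has to satisfy in order to solve every system with `‖A‖ = σ`, condition number `κ`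
and `‖A⁻¹ |b⟩‖ = ξ`. The solution operator enters only through the scalar response, on the
spectrum of `A`. -/
structure Plan.IsAccurate {n : ℕ} (P : Plan n) (σ κ ξ ε : ℝ) : Prop where
  alg_eq : P.alg = P.disc.solver n ⌊1 / (4 * (ξ / (P.disc.T * ‖P.disc.zetaVec‖)))⌋₊
  zetaVec_pos : 0 < ‖P.disc.zetaVec‖
  response : ∀ lam : ℝ, |lam| ≤ σ → 1 ≤ |lam| * (κ / σ) →
    ‖P.disc.response lam - (lam : ℂ)⁻¹‖ ≤ ε / 8 * ‖(lam : ℂ)⁻¹‖ + ε * ξ / 8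
  queries_le : (P.alg.queries : ℝ) ≤ 6 * (P.disc.T * ‖P.disc.zetaVec‖ / ξ)
  time_le : P.disc.T ≤ 3 * timeScale σ κ (deltaOf ε ξ)
  le_time : timeScale σ κ (deltaOf ε ξ) ≤ P.disc.T
  zetaVec_sq_le : ‖P.disc.zetaVec‖ ^ 2 ≤ 48 * √(10 + Real.log (1 / ε))
  tau_mul : P.disc.tau * (Real.pi / P.disc.dp * σ) = 1
  nodes_le : (P.disc.Q : ℝ) ≤ 27 * Real.log (P.disc.T / deltaOf ε ξ)
  le_nodes : Real.log (P.disc.T / deltaOf ε ξ) ≤ P.disc.Q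

theorem exists_isAccurate (n : ℕ) {σ κ ξ ε : ℝ} (hσ : 0 < σ) (hκ : 1 ≤ κ) (hξ : 0 < ξ)
    (hξκ : ξ ≤ κ / σ) (hε : 0 < ε) (hε1 : ε < 1) (hεξ : ε * ξ ≤ Real.exp (-1)) :
    ∃ P : Plan n, P.IsAccurate σ κ ξ ε := by
  obtain ⟨D, hζ, hT, hres, hT1, hT2, hζ2, htau, hQ1, hQ2⟩ :=
    exists_good_discretization hσ hκ hξ hξκ hε hε1 hεξ
  exact ⟨⟨D, D.solver n ⌊1 / (4 * (ξ / (D.T * ‖D.zetaVec‖)))⌋₊⟩, rfl,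
    (Real.exp_pos _).trans_le hζ, hres, queries_solver_le D n hξ hT hζ, hT1, hT2, hζ2, htau, hQ1,
    hQ2⟩

theorem nonempty_plan (n : ℕ) : Nonempty (Plan n) :=
  let D : Discretization :=
    { R := 1, R_pos := one_pos, np := 1, np_pos := one_pos, T := 1, T_pos := one_pos, Nt := 1,
      Nt_pos := one_pos, Q := 1, Q_pos := one_pos, rule := (nonempty_gaussRule 1).some }
  ⟨⟨D, D.solver n 0⟩⟩

/-- With `z = ‖ζ‖`, `ℓ = log (1 / ε)` and `y = log (1 / δ)`: the passage from `ε` to `δ` in the bound for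
`‖ζ‖`. -/
theorem norm_le_of_sq_le {z ℓ L y : ℝ} (hy : 1 ≤ y) (hL : 1 ≤ L)
    (hℓ : ℓ ≤ L * y) (h : z ^ 2 ≤ 48 * √(10 + ℓ)) : z ≤ 100 * (L * y) ^ (1 / 4 : ℝ) := by
  have hLy : 1 ≤ L * y := by nlinarith
  have h0 : 0 ≤ L * y := by linarith
  have h1 : √(10 + ℓ) ≤ 4 * √(L * y) := by
    rw [Real.sqrt_le_left (by positivity), mul_pow, Real.sq_sqrt h0]
    linarith
  have h2 : ((L * y) ^ (1 / 4 : ℝ)) ^ 2 = √(L * y) := by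
    rw [Real.sqrt_eq_rpow, ← Real.rpow_natCast, ← Real.rpow_mul h0]
    norm_num
  refine le_of_sq_le_sq ?_ (by positivity)
  rw [mul_pow, h2]
  have := Real.sqrt_nonneg (L * y)
  linarith

/-! ### The linear system -/

section LinearSystem

variable {n : ℕ} {A W : Matrix (Fin (2 ^ n)) (Fin (2 ^ n)) ℂ} {lam : Fin (2 ^ n) → ℝ}
  {b x : EuclideanSpace ℂ (Fin (2 ^ n))}

/-- The index set `Fin (2 ^ n)` is never empty, so that norms and condition number are nondegenerate. -/
theorem specNorm_pos_of_isUnit (hA : A.IsHermitian) (hu : IsUnit A) :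
    0 < specNorm A ∧ 0 < specNorm A⁻¹ ∧ 1 ≤ condNumber A := by
  obtain ⟨W, lam, hW, hAW⟩ := isHermitian_diagonalization hA
  have h1 := one_le_abs_eigenvalue_mul hW hAW hu 0
  have h2 := abs_eigenvalue_le hW hAW 0
  have h3 := specNorm_nonneg A⁻¹
  have h4 : 1 ≤ specNorm A * specNorm A⁻¹ := h1.trans (mul_le_mul_of_nonneg_right h2 h3)
  refine ⟨?_, ?_, h4⟩
  · exact (specNorm_nonneg A).lt_of_ne fun h => by rw [← h, zero_mul] at h4; linarith
  · exact h3.lt_of_ne fun h => by rw [← h, mul_zero] at h4; linarith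

theorem xiOf_le (hb : b ≠ 0) : xiOf A b ≤ specNorm A⁻¹ := by
  have h := (Matrix.toEuclideanCLM (n := Fin (2 ^ n)) (𝕜 := ℂ) A⁻¹).le_opNorm (ket b)
  rwa [norm_ket hb, mul_one] at h

theorem toEuclideanCLM_inv_ket (hu : IsUnit A)
    (hx : Matrix.toEuclideanCLM (n := Fin (2 ^ n)) (𝕜 := ℂ) A x = b) :
    Matrix.toEuclideanCLM (n := Fin (2 ^ n)) (𝕜 := ℂ) A⁻¹ (ket b) =
      ((‖b‖⁻¹ : ℝ) : ℂ) • x := by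
  have h : Matrix.toEuclideanCLM (n := Fin (2 ^ n)) (𝕜 := ℂ) A⁻¹ b = x := by
    rw [← hx, ← mul_apply_eq_comp, ← map_mul,
      Matrix.nonsing_inv_mul _ ((Matrix.isUnit_iff_isUnit_det A).1 hu), map_one,
      one_apply_eq_self]
  rw [ket, map_smul, h]

theorem ket_smul {r : ℝ} (hr : 0 < r) (v : EuclideanSpace ℂ (Fin (2 ^ n))) :
    ket ((r : ℂ) • v) = ket v := by
  rw [ket, ket, norm_smul, Complex.norm_real, Real.norm_of_nonneg hr.le, smul_smul,
    ← Complex.ofReal_mul, mul_inv, mul_comm r⁻¹, mul_assoc, inv_mul_cancel₀ hr.ne', mul_one]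

/-- A response within `ε / 8` of the reciprocal on the spectrum, in the mixed sense, reproduces
`A⁻¹ |b⟩` with relative error `ε / 4`. -/
theorem norm_applyFun_sub_le (hu : IsUnit A) (hW : Wᴴ * W = 1)
    (hA : A = W * Matrix.diagonal (fun i => ((lam i : ℝ) : ℂ)) * Wᴴ) (hb : b ≠ 0)
    {f : Fin (2 ^ n) → ℂ} {ε : ℝ} (hε : 0 < ε)
    (hf : ∀ i, ‖f i - (lam i : ℂ)⁻¹‖ ≤ ε / 8 * ‖(lam i : ℂ)⁻¹‖ + ε * xiOf A b / 8) :
    ‖WithLp.toLp 2 (applyFun W f (ket b).ofLp) -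
        Matrix.toEuclideanCLM (n := Fin (2 ^ n)) (𝕜 := ℂ) A⁻¹ (ket b)‖ ≤
      ε / 4 * ‖Matrix.toEuclideanCLM (n := Fin (2 ^ n)) (𝕜 := ℂ) A⁻¹ (ket b)‖ := by
  have h0 : ∀ i, lam i ≠ 0 := fun i h => by
    have := one_le_abs_eigenvalue_mul hW hA hu i
    rw [h, abs_zero, zero_mul] at this
    linarith
  have hinv : Matrix.toEuclideanCLM (n := Fin (2 ^ n)) (𝕜 := ℂ) A⁻¹ (ket b) =
      WithLp.toLp 2 (applyFun W (fun i => (lam i : ℂ)⁻¹) (ket b).ofLp) := by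
    rw [← mul_diagonal_mulVec, ← inv_diagonalization hW hA h0, ← Matrix.toEuclideanCLM_toLp]
  have hξ : xiOf A b = ‖WithLp.toLp 2 (applyFun W (fun i => (lam i : ℂ)⁻¹) (ket b).ofLp)‖ := by
    rw [xiOf, hinv]
  have h := norm_applyFun_sq_le hW (ket b).ofLp
    (f := f - fun i => (lam i : ℂ)⁻¹) (g := fun i => (lam i : ℂ)⁻¹) hf
  have hk : ‖WithLp.toLp 2 (ket b).ofLp‖ = 1 := norm_ket hb
  rw [hk, ← hξ] at h
  rw [hinv, ← WithLp.toLp_sub, applyFun_sub, ← hξ]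
  have hξ0 : 0 ≤ xiOf A b := norm_nonneg _
  refine le_of_sq_le_sq (h.trans (le_of_eq ?_)) (by positivity)
  ring

end LinearSystem

end

end SchrQLS

theorem mainTheorem5 :
    ∃ C c : ℝ, 0 < C ∧ 0 < c ∧
    -- the plan is determined by `n`, `‖A‖`, `κ`, `ξ` and `ε`
    ∃ plan : (n : ℕ) → (σ κ ξ ε : ℝ) → SchrQLS.Plan n,
    ∀ (n : ℕ) (A : Matrix (Fin (2 ^ n)) (Fin (2 ^ n)) ℂ)
      (b x : EuclideanSpace ℂ (Fin (2 ^ n))) (σ κ ξ ε δ : ℝ)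
      (P : SchrQLS.Plan n),
      A.IsHermitian → IsUnit A → b ≠ 0 →
      Matrix.toEuclideanCLM (n := Fin (2 ^ n)) (𝕜 := ℂ) A x = b →
      σ = SchrQLS.specNorm A → κ = SchrQLS.condNumber A → ξ = SchrQLS.xiOf A b →
      0 < ε → ε < 1 → ε * ξ ≤ Real.exp (-1) → δ = SchrQLS.deltaOf ε ξ →
      P = plan n σ κ ξ ε →
      -- the algorithm prepares an `ε`-approximation of `|x⟩`, whatever oracles it is given
      (∀ O : SchrQLS.Oracles P.disc.na P.disc.np n, O.Implement P.disc A b →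
        P.alg.Prepares O (SchrQLS.ket x) ε c) ∧
      -- the query complexity
      (P.alg.queries : ℝ) ≤ C * (P.disc.alphaNorm * ‖P.disc.zetaVec‖ / ξ) ∧
      -- `‖α‖₁ = O(T)` and `T = Θ((κ / ‖A‖) √(2 log (2 κ / (‖A‖ δ))))`
      P.disc.alphaNorm ≤ C * P.disc.T ∧
      P.disc.T ≤ C * SchrQLS.timeScale σ κ δ ∧
      SchrQLS.timeScale σ κ δ ≤ C * P.disc.T ∧
      -- `‖ζ‖ = O(log^{1/4}(1 / δ))`
      (∀ L : ℝ, 1 ≤ L → Real.log (1 / ε) ≤ L * Real.log (1 / δ) →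
        ‖P.disc.zetaVec‖ ≤ C * (L * Real.log (1 / δ)) ^ (1 / 4 : ℝ)) ∧
      -- the time step and the number of quadrature nodes per step
      P.disc.tau * SchrQLS.specNorm (P.disc.hamiltonian A) = 1 ∧
      (P.disc.Q : ℝ) ≤ C * Real.log (P.disc.T / δ) ∧
      Real.log (P.disc.T / δ) ≤ C * P.disc.Q := by
  have hplan : ∀ (n : ℕ) (σ κ ξ ε : ℝ), ∃ P : SchrQLS.Plan n,
      0 < σ → 1 ≤ κ → 0 < ξ → ξ ≤ κ / σ → 0 < ε → ε < 1 → ε * ξ ≤ Real.exp (-1) →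
        P.IsAccurate σ κ ξ ε := by
    intro n σ κ ξ ε
    by_cases h : ∃ P : SchrQLS.Plan n, P.IsAccurate σ κ ξ ε
    · exact h.imp fun P hP _ _ _ _ _ _ _ => hP
    · -- parameters that belong to no linear system: any plan will do
      exact ⟨(SchrQLS.nonempty_plan n).some, fun h1 h2 h3 h4 h5 h6 h7 =>
        absurd (SchrQLS.exists_isAccurate n h1 h2 h3 h4 h5 h6 h7) h⟩
  choose plan hplan using hplan
  refine ⟨100, 1 / 100, by norm_num, by norm_num, plan, ?_⟩
  intro n A b x σ κ ξ ε δ P hA hu hb hx hσ hκ hξ hε hε1 hεξ hδ hP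
  obtain ⟨hσ0, hν0, hκ1⟩ := SchrQLS.specNorm_pos_of_isUnit hA hu
  have hν : κ / σ = SchrQLS.specNorm A⁻¹ := by
    rw [hκ, hσ, SchrQLS.condNumber, mul_div_cancel_left₀ _ hσ0.ne']
  have hxb := SchrQLS.toEuclideanCLM_inv_ket hu hx
  have hb0 : 0 < ‖b‖ := norm_pos_iff.2 hb
  have hx0 : x ≠ 0 := by
    rintro rfl
    exact hb (by rw [← hx, map_zero])
  have hu0 : Matrix.toEuclideanCLM (n := Fin (2 ^ n)) (𝕜 := ℂ) A⁻¹ (SchrQLS.ket b) ≠ 0 := by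
    rw [hxb]
    exact smul_ne_zero (by exact_mod_cast (inv_pos.2 hb0).ne') hx0
  have hξ0 : 0 < ξ := hξ ▸ norm_pos_iff.2 hu0
  rw [← hσ] at hσ0
  rw [← hκ] at hκ1
  have hξν : ξ ≤ κ / σ := by rw [hν, hξ]; exact SchrQLS.xiOf_le hb
  obtain ⟨halg, hζ0, hres, hq, hT1, hT2, hζ, htau, hQ1, hQ2⟩ :=
    hplan n σ κ ξ ε hσ0 hκ1 hξ0 hξν hε hε1 hεξ
  rw [← hP] at halg hζ0 hres hq hT1 hT2 hζ htau hQ1 hQ2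
  rw [← hδ] at hT1 hT2 hQ1 hQ2
  obtain ⟨hδ0, -, hlog⟩ := SchrQLS.deltaOf_bounds hε hξ0 hεξ
  rw [← hδ] at hδ0 hlog
  have hTpos := P.disc.T_pos
  have hts : 0 ≤ SchrQLS.timeScale σ κ δ :=
    mul_nonneg (hξ0.le.trans hξν) (Real.sqrt_nonneg _)
  have hQ0 : 0 ≤ (P.disc.Q : ℝ) := Nat.cast_nonneg _
  refine ⟨?_, ?_, ?_, ?_, ?_, ?_, ?_, ?_, ?_⟩
  · intro O hO
    obtain ⟨W, lam, hW, hAW⟩ := SchrQLS.isHermitian_diagonalization hA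
    have hclose := SchrQLS.norm_applyFun_sub_le hu hW hAW hb hε
      (f := fun i => P.disc.response (lam i)) fun i => by
        rw [← hξ]
        exact hres (lam i) (hσ ▸ SchrQLS.abs_eigenvalue_le hW hAW i)
          (hν ▸ SchrQLS.one_le_abs_eigenvalue_mul hW hAW hu i)
    have h := P.disc.solver_prepares hW hAW hζ0 hu0 hε1 hclose O hO
    have hnorm : ‖Matrix.toEuclideanCLM (n := Fin (2 ^ n)) (𝕜 := ℂ) A⁻¹ (SchrQLS.ket b)‖ = ξ :=
      hξ.symm
    rw [hnorm, hxb, SchrQLS.ket_smul (inv_pos.2 hb0)] at h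
    rw [halg]
    exact h
  · rw [P.disc.alphaNorm_eq]
    have : 0 ≤ P.disc.T * ‖P.disc.zetaVec‖ / ξ := by positivity
    linarith
  · rw [P.disc.alphaNorm_eq]
    linarith
  · linarith
  · linarith
  · intro L hL hℓ
    exact SchrQLS.norm_le_of_sq_le hlog hL hℓ hζ
  · rw [SchrQLS.Discretization.specNorm_hamiltonian, ← hσ]
    exact htau
  · have : 0 ≤ Real.log (P.disc.T / δ) := by linarith
    linarith
  · linarith
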